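/- **Setting.** Let $k\ge 2$ be an integer, $a=\pi/k$, $\alpha,\beta\in\{0,1\}$. For a complex-valued $q\in L_2(0,\pi)$ let $L(q)$ denote the boundary value problem with frozen argument $$-y''(x)+q(x)y(a)=\lambda y(x),\quad 0<x<\pi,\qquad y^{(\alpha)}(0)=y^{(\beta)}(\pi)=0 .$$ Let $C(x,\lambda),S(x,\lambda)$ be the solutions of the equation with $C(a,\lambda)=S'(a,\lambda)=1$, $S(a,\lambda)=C'(a,\lambda)=0$, and let $$\Delta_q(\lambda)=C^{(\alpha)}(0,\lambda)S^{(\beta)}(\pi,\lambda)-S^{(\alpha)}(0,\lambda)C^{(\beta)}(\pi,\lambda)$$ be the characteristic function. The spectrum of $L(q)$ is the sequence $\{\lambda_n\}_{n\ge1}$ of the zeros of $\Delta_q$, listed with multiplicities. Put $b=(-1)^{\alpha+\beta}$, $c=(-1)^{1+\beta}$, and let $A$ be the three-diagonal $k\times k$ matrix whose entries just above the main diagonal are all $b$, whose entries just below it are all $c$, and whose main diagonal is $(1,0,\dots,0,c)$. The *degenerate case* is the case $\det A=0$, that is: $\alpha=\beta=0$; or $\alpha=1,\beta=0$ and $k$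 odd; or $\alpha=\beta=1$ and $k$ even. **Algorithm.** Given a sequence $\{\lambda_n\}_{n\ge1}$ and an operator $K$ in $L_2(0,a)$, not necessarily linear, with $I+K$ invertible: 1. Put $\displaystyle\Delta(\lambda)=(-1)^\alpha\pi^{\delta_{\alpha,\beta}}(\lambda_1-\lambda)^{\alpha\beta}\prod_{n=1+\alpha\beta}^\infty\frac{\lambda_n-\lambda}{\left(n-\frac{\alpha+\beta}2\right)^2}$, where $\delta_{\alpha,\beta}$ is the Kronecker delta. 2. Find $W\in L_2(0,\pi)$ such that for all $\rho\in\mathbb C\setminus\{0\}$ $$\Delta(\rho^2)=\rho^{2\alpha}\Big(\frac{\sin\rho\pi}{\rho}+\int_0^\pi W(t)\frac{\cos\rho t}{\rho^2}\,dt\Big)\ \text{ if }\alpha=\beta,\qquad \Delta(\rho^2)=(-1)^\alpha\cos\rho\pi+\int_0^\pi W(t)\frac{\sin\rho t}{\rho}\,dt\ \text{ if }\alpha\neq\beta,$$ where $\int_0^\pi W(t)\,dt=0$ in the case $\alpha=\beta=0$. 3. Put $q(a+x)=(I+K)^{-1}(-2W(\pi-x))$ for $x\in(0,a)$. 4. Put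 $q(a-x)=-2W(\pi-x)-q(a+x)$ for $x\in(0,a)$. 5. For $j=2,\dots,k-1$ successively put $q(x)=-2W(\pi+a-x)+(-1)^\alpha q(x-2a)$ for $x\in(ja,(j+1)a)$. **Theorem 4.3.** Assume the degenerate case, and let $\{\lambda_n\}_{n\ge1}$ be the spectrum of $L(q_0)$ for some $q_0\in L_2(0,\pi)$, numbered so that $|\lambda_n|$ is nondecreasing for all large $n$. Then there is exactly one $W\in L_2(0,\pi)$ as in Steps 1 and 2. For each $p\in L_2(0,a)$ and the constant operator $K(f)=p$, the operator $I+K$ is bijective, and the algorithm gives exactly one $q\in L_2(0,\pi)$; it satisfies $q(x)=p(a-x)$ a.e. on $(0,a)$. When $p$ varies through $L_2(0,a)$, the functions $q$ so constructed form exactly the set of all potentials $q\in L_2(0,\pi)$ for which $L(q)$ has the spectrum $\{\lambda_n\}_{n\ge1}$. -/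

import Mathlib

open MeasureTheory

noncomputable section

namespace FrozenArgument

/-- The complex space `L₂(0, c)`. -/
abbrev L2 (c : ℝ) : Type := Lp ℂ 2 (volume.restrict (Set.Ioo (0 : ℝ) c))

/-- The frozen point `a = π / k`. -/
def pt (k : ℕ) : ℝ := Real.pi / k

/-- `y`, with derivative `dy`, is a solution on `[0, π]` of the equation with frozen argument
`-y''(x) + q(x) y(a) = z y(x)`: `y` is differentiable on `[0, π]`, `dy` is its derivative, and
`dy` is absolutely continuous with `dy' = q y(a) - z y` a.e. (integrated form). -/
structure IsSolution (q : ℝ → ℂ) (a : ℝ) (z : ℂ) (y dy : ℝ → ℂ) : Prop where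
  deriv_y : ∀ x ∈ Set.Icc 0 Real.pi, HasDerivWithinAt y (dy x) (Set.Icc 0 Real.pi) x
  deriv_dy : ∀ x ∈ Set.Icc 0 Real.pi,
    dy x = dy 0 + ∫ t in (0 : ℝ)..x, (q t * y a - z * y t)

/-- `y^{(j)}(x)` for `j ∈ {0, 1}`, where `dy` is the derivative of `y`. -/
def derivOrder (j : ℕ) (y dy : ℝ → ℂ) (x : ℝ) : ℂ := if j = 0 then y x else dy x

/-- `Δ` is the characteristic function of the boundary value problem `L(q, π/k, α, β)`
`-y''(x) + q(x) y(a) = z y(x)`, `y^{(α)}(0) = y^{(β)}(π) = 0`: the determinant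
`C^{(α)}(0) S^{(β)}(π) - S^{(α)}(0) C^{(β)}(π)` of the solutions `C`, `S` with
`C(a) = S'(a) = 1`, `S(a) = C'(a) = 0`. Its zeros are the eigenvalues of the problem. -/
def IsCharacteristicFunction (k α β : ℕ) (q : L2 Real.pi) (Δ : ℂ → ℂ) : Prop :=
  ∃ C dC S dS : ℂ → ℝ → ℂ, ∀ z : ℂ,
    IsSolution q (pt k) z (C z) (dC z) ∧ C z (pt k) = 1 ∧ dC z (pt k) = 0 ∧
    IsSolution q (pt k) z (S z) (dS z) ∧ S z (pt k) = 0 ∧ dS z (pt k) = 1 ∧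
    Δ z = Matrix.det
      !![derivOrder α (C z) (dC z) 0, derivOrder α (S z) (dS z) 0;
         derivOrder β (C z) (dC z) Real.pi, derivOrder β (S z) (dS z) Real.pi]

/-- `(lam n)`, `n ≥ 1`, is the spectrum of `L(q, π/k, α, β)`: it lists the eigenvalues, each as
often as its multiplicity as a zero of the characteristic function. (`lam 0` plays no role.) -/
def IsSpectrum (k α β : ℕ) (q : L2 Real.pi) (lam : ℕ → ℂ) : Prop :=
  ∃ Δ : ℂ → ℂ, IsCharacteristicFunction k α β q Δ ∧
    ∀ z : ℂ, {n : ℕ | 1 ≤ n ∧ lam n = z}.encard = analyticOrderAt Δ z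

/-- The three-diagonal matrix of order `k > 1` of the main equation: first row `(1, b, 0, …)`,
last row `(0, …, 0, c, c)`, zeros elsewhere on the main diagonal, `b` above and `c` below it,
with `b = (-1)^(α+β)` and `c = (-1)^(1+β)`. -/
def mainMatrix (k α β : ℕ) : Matrix (Fin k) (Fin k) ℤ :=
  Matrix.of fun i j =>
    if i.val = 0 ∧ j.val = 0 then 1
    else if i.val + 1 = k ∧ j.val + 1 = k then (-1) ^ (1 + β)
    else if j.val = i.val + 1 then (-1) ^ (α + β)
    else if i.val = j.val + 1 then (-1) ^ (1 + β)
    else 0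

/-- The degenerate case. -/
def Degenerate (k α β : ℕ) : Prop := (mainMatrix k α β).det = 0

/-- Step 1. `Δ` is given by the convergent product
`Δ(z) = (-1)^α π^δ (λ₁ - z)^(αβ) ∏_{n ≥ 1 + αβ} (λₙ - z) / (n - (α+β)/2)²`,
where `δ = 1` if `α = β` and `δ = 0` otherwise. -/
def IsProductOf (α β : ℕ) (lam : ℕ → ℂ) (Δ : ℂ → ℂ) : Prop :=
  ∀ z : ℂ, ∃ P : ℂ,
    HasProd (fun m : ℕ => (lam (m + (1 + α * β)) - z) /
      (((m + (1 + α * β) : ℕ) : ℂ) - ((α : ℂ) + β) / 2) ^ 2) P ∧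
    Δ z = (-1) ^ α * (if α = β then (Real.pi : ℂ) else 1) * (lam 1 - z) ^ (α * β) * P

/-- Step 2. `W ∈ L₂(0, π)` represents `Δ`, with `z = ρ²`: if `α = β`,
`Δ(ρ²) = ρ^(2α) (sin ρπ / ρ + ∫₀^π W(t) cos ρt / ρ² dt)`, and `∫₀^π W = 0` if `α = β = 0`;
if `α ≠ β`, `Δ(ρ²) = (-1)^α cos ρπ + ∫₀^π W(t) sin ρt / ρ dt`. -/
def Represents (α β : ℕ) (W : L2 Real.pi) (Δ : ℂ → ℂ) : Prop :=
  (α = β → ∀ ρ : ℂ, ρ ≠ 0 → Δ (ρ ^ 2) = ρ ^ (2 * α) *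
      (Complex.sin (ρ * Real.pi) / ρ +
        ∫ t in (0 : ℝ)..Real.pi, W t * (Complex.cos (ρ * t) / ρ ^ 2))) ∧
  (α = 0 → β = 0 → ∫ t in (0 : ℝ)..Real.pi, W t = 0) ∧
  (α ≠ β → ∀ ρ : ℂ, ρ ≠ 0 → Δ (ρ ^ 2) = (-1) ^ α * Complex.cos (ρ * Real.pi) +
      ∫ t in (0 : ℝ)..Real.pi, W t * (Complex.sin (ρ * t) / ρ))

/-- `W` is obtained from the spectrum by Steps 1 and 2. -/
def IsObtainedW (α β : ℕ) (lam : ℕ → ℂ) (W : L2 Real.pi) : Prop :=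
  ∃ Δ : ℂ → ℂ, IsProductOf α β lam Δ ∧ Represents α β W Δ

/-- Steps 3 to 5: `q` is constructed from `W` and the (not necessarily linear) operator `K`.
In Step 3, `f = (I + K)⁻¹ (-2 W(π - ·))`. All the equalities hold almost everywhere. -/
def IsConstructed (k α : ℕ) (K : L2 (pt k) → L2 (pt k)) (W q : L2 Real.pi) : Prop :=
  (∃ f : L2 (pt k),
    (∀ᵐ x ∂volume.restrict (Set.Ioo 0 (pt k)),
      (f + K f : L2 (pt k)) x = -2 * W (Real.pi - x)) ∧
    (∀ᵐ x ∂volume.restrict (Set.Ioo 0 (pt k)), q (pt k + x) = f x)) ∧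
  (∀ᵐ x ∂volume.restrict (Set.Ioo 0 (pt k)),
    q (pt k - x) = -2 * W (Real.pi - x) - q (pt k + x)) ∧
  (∀ j : ℕ, 2 ≤ j → j ≤ k - 1 →
    ∀ᵐ x ∂volume.restrict (Set.Ioo (j * pt k) ((j + 1) * pt k)),
      q x = -2 * W (Real.pi + pt k - x) + (-1) ^ α * q (x - 2 * pt k))

/-- `q` is an output of the algorithm run on the spectrum `lam` with the operator `K`. -/
def IsOutput (k α β : ℕ) (K : L2 (pt k) → L2 (pt k)) (lam : ℕ → ℂ) (q : L2 Real.pi) : Prop :=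
  ∃ W : L2 Real.pi, IsObtainedW α β lam W ∧ IsConstructed k α K W q

/-- The constant operator `K(f) = p`. -/
def constOp (k : ℕ) (p : L2 (pt k)) : L2 (pt k) → L2 (pt k) := fun _ => p

end FrozenArgument

end

open FrozenArgument

/-! The potential acts only through the number y(a). Hence C comes from variation of constants
(`solC`), S is the free solution `sinK z (x - a)`, and Δ_q is affine in q. Regrouping its integrals
by the addition formulas writes Δ_q (times z if α = β = 0) as a free function plus the cosine or
sine transform of one function `mainW`, built from shifts and reflections of q extended by zero
(`charFn_zero_zero`, `charFn_one_zero`, `charFn_one_one`).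

On intervals of length a, knowing W amounts to k relations between pieces of q. The algorithm uses
all but the last: `mainW_right` and `mainW_middle`. The difference of two solutions of these is
homogeneous, hence odd or even about each point ja with 0 < j < k (`IsHomogeneous.reflect`). In the
degenerate case its parity about π - a is exactly the one required by the last relation `mainW_left`
(`pow_sign_of_cases`), which therefore comes for free once some q₀ satisfies it
(`mainW_ae_eq_of_isHomogeneous`). A homogeneous function can be prescribed on (0, a)
(`exists_isHomogeneous`) and is determined there (`IsHomogeneous.ae_eq_zero`). A constant operator K
= p prescribes just these values (`isConstructed_constOp_iff`), so p parametrizes all potentials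
with the same W.

It remains to see that spectrum, Δ and W determine each other. W is recovered from Δ because the
polynomials in cos t are dense (`Represents.unique`). Δ is recovered from the spectrum as a product
over its zeros (`Represents.isProductOf`). For the latter, Δ is compared with its free part M, whose
zeros are (n - t/2)² with t = α + β, on circles separating these zeros. There Δ/M tends to 1.
Rouché's theorem and the ordering of the moduli put exactly λ_1, …, λ_N into the N-th disc, and the
lower bound for the sine gives λ_n = (n - t/2)² + O(1). With the zeros in the disc divided out, the
maximum principle carries the estimate from the circle to a fixed z, so that Δ/M is the limit of
quotients of finite products (`IsSinePerturbation.tendsto_prod_ratio`). Euler's products for sine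
and cosine evaluate the products belonging to M (`IsSinePerturbation.hasProd`). -/

namespace FrozenArgument

/-! ### Cosine and sine kernels with spectral parameter z -/

/-- A square root of `z`. -/
noncomputable def sqrtC (z : ℂ) : ℂ := z ^ (1 / 2 : ℂ)

lemma sqrtC_sq (z : ℂ) : sqrtC z ^ 2 = z := by
  rw [sqrtC, ← Complex.cpow_nat_mul]; norm_num

lemma sqrtC_zero : sqrtC 0 = 0 := by simp [sqrtC]

lemma sqrtC_ne_zero {z : ℂ} (hz : z ≠ 0) : sqrtC z ≠ 0 := by
  intro h; apply hz; rw [← sqrtC_sq z, h]; simp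

lemma sqrtC_sq_eq_or (ρ : ℂ) : sqrtC (ρ ^ 2) = ρ ∨ sqrtC (ρ ^ 2) = -ρ :=
  sq_eq_sq_iff_eq_or_eq_neg.1 (sqrtC_sq (ρ ^ 2))

/-- `cos (√z x)`, the solution of `-y'' = z y` with `y(0) = 1`, `y'(0) = 0`. -/
noncomputable def cosK (z : ℂ) (x : ℝ) : ℂ := Complex.cos (sqrtC z * x)

/-- `sin (√z x) / √z`, the solution of `-y'' = z y` with `y(0) = 0`, `y'(0) = 1`. -/
noncomputable def sinK (z : ℂ) (x : ℝ) : ℂ :=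
  if z = 0 then x else Complex.sin (sqrtC z * x) / sqrtC z

lemma cosK_sq (ρ : ℂ) (x : ℝ) : cosK (ρ ^ 2) x = Complex.cos (ρ * x) := by
  rcases sqrtC_sq_eq_or ρ with h | h <;> simp [cosK, h]

lemma sinK_sq {ρ : ℂ} (hρ : ρ ≠ 0) (x : ℝ) : sinK (ρ ^ 2) x = Complex.sin (ρ * x) / ρ := by
  rcases sqrtC_sq_eq_or ρ with h | h <;> simp [sinK, h, hρ]

lemma sinK_zero_left (x : ℝ) : sinK 0 x = x := by simp [sinK]
lemma cosK_zero_left (x : ℝ) : cosK 0 x = 1 := by simp [cosK, sqrtC_zero]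
lemma cosK_zero (z : ℂ) : cosK z 0 = 1 := by simp [cosK]
lemma sinK_zero (z : ℂ) : sinK z 0 = 0 := by simp [sinK]
lemma cosK_neg (z : ℂ) (x : ℝ) : cosK z (-x) = cosK z x := by simp [cosK]
lemma sinK_neg (z : ℂ) (x : ℝ) : sinK z (-x) = -sinK z x := by
  by_cases h : z = 0 <;> simp [sinK, h, neg_div]

/-- In terms of z instead of its root the addition formulas are polynomial in the kernels and hold
at z = 0 too; every later identity reduces to them and to `cosK_sq_add`. -/
lemma cosK_sub (z : ℂ) (x t : ℝ) :
    cosK z (x - t) = cosK z x * cosK z t + z * sinK z x * sinK z t := by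
  by_cases h : z = 0
  · simp [h, cosK_zero_left]
  · have h' := sqrtC_ne_zero h
    have h2 := sqrtC_sq z
    simp only [cosK, sinK, h, if_false, Complex.ofReal_sub, mul_sub, Complex.cos_sub]
    generalize sqrtC z = r at *
    subst h2
    field_simp

lemma sinK_sub (z : ℂ) (x t : ℝ) :
    sinK z (x - t) = sinK z x * cosK z t - cosK z x * sinK z t := by
  by_cases h : z = 0
  · simp [h, cosK_zero_left, sinK_zero_left]
  · have h' := sqrtC_ne_zero h
    simp only [cosK, sinK, h, if_false, Complex.ofReal_sub, mul_sub, Complex.sin_sub]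
    field_simp

lemma cosK_sq_add (z : ℂ) (x : ℝ) : cosK z x ^ 2 + z * sinK z x ^ 2 = 1 := by
  have := cosK_sub z x x
  rw [sub_self, cosK_zero] at this
  rw [this]; ring

lemma hasDerivAt_cosK (z : ℂ) (x : ℝ) : HasDerivAt (cosK z) (-z * sinK z x) x := by
  by_cases h : z = 0
  · have : cosK z = fun _ => 1 := by ext; simp [h, cosK_zero_left]
    rw [this, h]; simpa using hasDerivAt_const x (1 : ℂ)
  · have h' := sqrtC_ne_zero h
    have h1 : HasDerivAt (fun w : ℂ => Complex.cos (sqrtC z * w))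
        (-Complex.sin (sqrtC z * x) * (sqrtC z * 1)) (x : ℂ) :=
      ((hasDerivAt_id' _).const_mul _).ccos
    have h2 := h1.comp_ofReal
    convert! h2 using 1
    simp only [sinK, h, if_false]
    nth_rewrite 1 [← sqrtC_sq z]
    field_simp

lemma hasDerivAt_sinK (z : ℂ) (x : ℝ) : HasDerivAt (sinK z) (cosK z x) x := by
  by_cases h : z = 0
  · have : sinK z = fun x : ℝ => (x : ℂ) := by ext; simp [h, sinK_zero_left]
    rw [this, h, cosK_zero_left]; exact (hasDerivAt_id' (x : ℂ)).comp_ofReal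
  · have h' := sqrtC_ne_zero h
    have h1 : HasDerivAt (fun w : ℂ => Complex.sin (sqrtC z * w) / sqrtC z)
        (Complex.cos (sqrtC z * x) * (sqrtC z * 1) / sqrtC z) (x : ℂ) :=
      ((hasDerivAt_id' _).const_mul _).csin.div_const _
    have h2 := h1.comp_ofReal
    have e : sinK z = fun y : ℝ => Complex.sin (sqrtC z * y) / sqrtC z := by
      ext y; simp [sinK, h]
    rw [e]
    convert! h2 using 1
    simp only [cosK]
    field_simp

lemma contDiff_cosK (z : ℂ) : ContDiff ℝ 1 (cosK z) := by
  unfold cosK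
  exact Complex.contDiff_cos.restrict_scalars ℝ |>.comp
    (contDiff_const.mul Complex.ofRealCLM.contDiff)

lemma contDiff_sinK (z : ℂ) : ContDiff ℝ 1 (sinK z) := by
  by_cases h : z = 0
  · have : sinK z = fun x : ℝ => (x : ℂ) := by ext; simp [h, sinK_zero_left]
    rw [this]; exact Complex.ofRealCLM.contDiff
  · have e : sinK z = fun y : ℝ => Complex.sin (sqrtC z * y) / sqrtC z := by
      ext y; simp [sinK, h]
    rw [e]
    exact (Complex.contDiff_sin.restrict_scalars ℝ |>.comp
      (contDiff_const.mul Complex.ofRealCLM.contDiff)).div_const _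

lemma continuous_cosK (z : ℂ) : Continuous (cosK z) := (contDiff_cosK z).continuous
lemma continuous_sinK (z : ℂ) : Continuous (sinK z) := (contDiff_sinK z).continuous

/-! ### Absolute continuity, explicit solutions and their uniqueness -/

lemma ac_congr {f g : ℝ → ℂ} {a b : ℝ} (hf : AbsolutelyContinuousOnInterval f a b)
    (h : ∀ x ∈ Set.uIcc a b, f x = g x) : AbsolutelyContinuousOnInterval g a b := by
  rw [absolutelyContinuousOnInterval_iff] at hf ⊢
  intro ε hε
  obtain ⟨δ, hδ, H⟩ := hf ε hε
  refine ⟨δ, hδ, fun E hE hlt => ?_⟩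
  refine (Finset.sum_congr rfl fun i hi => ?_).trans_lt (H E hE hlt)
  rw [h _ (hE.1 i hi).1, h _ (hE.1 i hi).2]

lemma ac_integral {f : ℝ → ℂ} {a b c : ℝ} (hf : IntervalIntegrable f volume a b)
    (hc : c ∈ Set.uIcc a b) :
    AbsolutelyContinuousOnInterval (fun x => ∫ t in c..x, f t) a b := by
  have hre : IntervalIntegrable (fun t => (f t).re) volume a b := ⟨hf.1.re, hf.2.re⟩
  have him : IntervalIntegrable (fun t => (f t).im) volume a b := ⟨hf.1.im, hf.2.im⟩
  have const : ∀ w : ℂ, AbsolutelyContinuousOnInterval (fun _ : ℝ => w) a b := fun w =>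
    contDiffOn_const.absolutelyContinuousOnInterval
  have h := ((hre.absolutelyContinuousOnInterval_intervalIntegral hc).smul (const 1)).add
    ((him.absolutelyContinuousOnInterval_intervalIntegral hc).smul (const Complex.I))
  refine ac_congr h fun x hx => ?_
  have hcx : IntervalIntegrable f volume c x := hf.mono_set (Set.uIcc_subset_uIcc hc hx)
  have e : (∫ t in c..x, f t) = ((∫ t in c..x, (f t).re : ℝ) : ℂ) + (∫ t in c..x, (f t).im : ℝ) * Complex.I := by
    rw [← intervalIntegral.integral_ofReal, ← intervalIntegral.integral_ofReal,
      ← intervalIntegral.integral_mul_const, ← intervalIntegral.integral_add]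
    · simp only [Complex.re_add_im]
    · exact ⟨hcx.1.re.ofReal, hcx.2.re.ofReal⟩
    · exact IntervalIntegrable.mul_const ⟨hcx.1.im.ofReal, hcx.2.im.ofReal⟩ _
  rw [e]; simp

/-- An absolutely continuous function is the integral of its derivative. -/
lemma eq_integral_of_absolutelyContinuous {f f' : ℝ → ℂ} {a b : ℝ}
    (hf : AbsolutelyContinuousOnInterval f a b) (hf' : IntervalIntegrable f' volume a b)
    (h : ∀ᵐ x, x ∈ Set.uIcc a b → HasDerivAt f (f' x) x) :
    ∀ x ∈ Set.uIcc a b, f x = f a + ∫ t in a..x, f' t := by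
  have hg := hf.sub (ac_integral (c := a) hf' (by simp))
  obtain ⟨C, hC⟩ := hg.const_of_ae_hasDerivAt_zero (by
    filter_upwards [h, hf'.ae_hasDerivAt_integral] with x h1 h2 hx
    simpa using! (h1 hx).sub (h2 hx a (by simp)))
  intro x hx
  have h1 := hC x hx
  have h2 := hC a (by simp)
  simp only [Pi.sub_apply, intervalIntegral.integral_same, sub_zero] at h1 h2
  rw [h2, ← h1]; ring

/-- The solution with `C(a) = 1`, `C'(a) = 0`. -/
noncomputable def solC (q : ℝ → ℂ) (a : ℝ) (z : ℂ) (x : ℝ) : ℂ :=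
  cosK z (x - a) + (sinK z x * (∫ t in a..x, q t * cosK z t)
    - cosK z x * ∫ t in a..x, q t * sinK z t)

/-- The derivative of `solC`. -/
noncomputable def dsolC (q : ℝ → ℂ) (a : ℝ) (z : ℂ) (x : ℝ) : ℂ :=
  -z * sinK z (x - a) + (cosK z x * (∫ t in a..x, q t * cosK z t)
    + z * sinK z x * ∫ t in a..x, q t * sinK z t)

lemma solC_self (q : ℝ → ℂ) (a : ℝ) (z : ℂ) : solC q a z a = 1 := by
  simp [solC, cosK_zero]

lemma dsolC_self (q : ℝ → ℂ) (a : ℝ) (z : ℂ) : dsolC q a z a = 0 := by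
  simp [dsolC, sinK_zero]

lemma ac_of_contDiff {f : ℝ → ℂ} (hf : ContDiff ℝ 1 f) (a b : ℝ) :
    AbsolutelyContinuousOnInterval f a b :=
  hf.contDiffOn.absolutelyContinuousOnInterval

lemma isSolution_solC {q : ℝ → ℂ} (hq : IntervalIntegrable q volume 0 Real.pi)
    {a : ℝ} (ha : a ∈ Set.Icc 0 Real.pi) (z : ℂ) :
    IsSolution q a z (solC q a z) (dsolC q a z) := by
  have hpi := Real.pi_pos.le
  have hu : Set.uIcc 0 Real.pi = Set.Icc 0 Real.pi := Set.uIcc_of_le hpi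
  have hqc := hq.mul_continuousOn (continuous_cosK z).continuousOn
  have hqs := hq.mul_continuousOn (continuous_sinK z).continuousOn
  have hA := ac_integral (c := a) hqc (hu ▸ ha)
  have hB := ac_integral (c := a) hqs (hu ▸ ha)
  have hc := ac_of_contDiff (contDiff_cosK z) 0 Real.pi
  have hs := ac_of_contDiff (contDiff_sinK z) 0 Real.pi
  have hca := ac_of_contDiff ((contDiff_cosK z).comp (contDiff_id.sub contDiff_const))
    0 Real.pi (f := fun x => cosK z (x - a))
  have hsa := ac_of_contDiff ((contDiff_sinK z).comp (contDiff_id.sub contDiff_const))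
    0 Real.pi (f := fun x => sinK z (x - a))
  have hy : AbsolutelyContinuousOnInterval (solC q a z) 0 Real.pi :=
    hca.add ((hs.smul hA).sub (hc.smul hB))
  have hdy : AbsolutelyContinuousOnInterval (dsolC q a z) 0 Real.pi :=
    (hsa.const_smul (-z)).add ((hc.smul hA).add ((hs.const_smul z).smul hB))
  have hda : ∀ x, HasDerivAt (fun x => cosK z (x - a)) (-z * sinK z (x - a)) x := fun x => by
    simpa using! (hasDerivAt_cosK z (x - a)).scomp x ((hasDerivAt_id' x).sub_const a)
  have hdb : ∀ x, HasDerivAt (fun x => sinK z (x - a)) (cosK z (x - a)) x := fun x => by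
    simpa using! (hasDerivAt_sinK z (x - a)).scomp x ((hasDerivAt_id' x).sub_const a)
  have hy' : ∀ᵐ x, x ∈ Set.uIcc 0 Real.pi → HasDerivAt (solC q a z) (dsolC q a z x) x := by
    filter_upwards [hqc.ae_hasDerivAt_integral, hqs.ae_hasDerivAt_integral] with x h1 h2 hx
    have h1 := h1 hx a (hu ▸ ha)
    have h2 := h2 hx a (hu ▸ ha)
    -- The two terms containing `q x` cancel, as they should in variation of constants; in the
    -- second derivative they add up to `q x` by `cosK_sq_add`.
    have h := (hda x).add (((hasDerivAt_sinK z x).mul h1).sub ((hasDerivAt_cosK z x).mul h2))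
    convert! h using 1
    simp only [dsolC]; ring
  have hdy' : ∀ᵐ x, x ∈ Set.uIcc 0 Real.pi →
      HasDerivAt (dsolC q a z) (q x * solC q a z a - z * solC q a z x) x := by
    filter_upwards [hqc.ae_hasDerivAt_integral, hqs.ae_hasDerivAt_integral] with x h1 h2 hx
    have h1 := h1 hx a (hu ▸ ha)
    have h2 := h2 hx a (hu ▸ ha)
    have h := ((hdb x).const_mul (-z)).add (((hasDerivAt_cosK z x).mul h1).add
      (((hasDerivAt_sinK z x).const_mul z).mul h2))
    convert! h using 1
    rw [solC_self]
    simp only [solC]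
    linear_combination (-q x) * cosK_sq_add z x
  have hyc := hy.continuousOn
  have hdyc := hdy.continuousOn
  constructor
  · intro x hx
    -- The derivative is known only almost everywhere so far. As `dsolC` is continuous, integrating
    -- it back yields the derivative at every point.
    have e := eq_integral_of_absolutelyContinuous hy hdyc.intervalIntegrable hy'
    rw [hu] at e hdyc
    have h1 : HasDerivWithinAt (fun u => ∫ t in (0 : ℝ)..u, dsolC q a z t) (dsolC q a z x)
        (Set.Icc 0 Real.pi) x := by
      have : Fact (x ∈ Set.Icc 0 Real.pi) := ⟨hx⟩
      refine intervalIntegral.integral_hasDerivWithinAt_right ?_ ?_ (hdyc x hx)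
      · exact (hdyc.mono (Set.Icc_subset_Icc_right hx.2)).intervalIntegrable_of_Icc hx.1
      · exact hdyc.stronglyMeasurableAtFilter_nhdsWithin measurableSet_Icc x
    exact (h1.const_add (solC q a z 0)).congr (fun u hu => e u hu) (e x hx)
  · intro x hx
    refine eq_integral_of_absolutelyContinuous hdy ?_ hdy' x (hu ▸ hx)
    exact (hq.mul_const _).sub (hyc.intervalIntegrable.const_mul z)

/-- A solution vanishing at the frozen point does not feel the potential, so S is the same for all
q. -/
lemma isSolution_sinK (q : ℝ → ℂ) (a : ℝ) (z : ℂ) :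
    IsSolution q a z (fun x => sinK z (x - a)) (fun x => cosK z (x - a)) := by
  have hda : ∀ x, HasDerivAt (fun x => cosK z (x - a)) (-z * sinK z (x - a)) x := fun x => by
    simpa using! (hasDerivAt_cosK z (x - a)).scomp x ((hasDerivAt_id' x).sub_const a)
  have hdb : ∀ x, HasDerivAt (fun x => sinK z (x - a)) (cosK z (x - a)) x := fun x => by
    simpa using! (hasDerivAt_sinK z (x - a)).scomp x ((hasDerivAt_id' x).sub_const a)
  refine ⟨fun x _ => (hdb x).hasDerivWithinAt, fun x _ => ?_⟩
  have h := intervalIntegral.integral_eq_sub_of_hasDerivAt (a := 0) (b := x) (fun t _ => hda t)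
    (by
      have := continuous_sinK z
      exact Continuous.intervalIntegrable (by fun_prop) _ _)
  simp only [sub_self, sinK_zero, mul_zero, zero_sub, ← neg_mul, h]
  ring

/-- A solution is determined by its Cauchy data at the frozen point. -/
lemma IsSolution.unique {q : ℝ → ℂ} (hq : IntervalIntegrable q volume 0 Real.pi)
    {a : ℝ} (ha : a ∈ Set.Icc 0 Real.pi) {z : ℂ} {y dy u du : ℝ → ℂ}
    (h₁ : IsSolution q a z y dy) (h₂ : IsSolution q a z u du) (h0 : y a = u a)
    (h1 : dy a = du a) {x : ℝ} (hx : x ∈ Set.Icc 0 Real.pi) : y x = u x ∧ dy x = du x := by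
  have hyc : ContinuousOn y (Set.Icc 0 Real.pi) := fun x hx => (h₁.1 x hx).continuousWithinAt
  have huc : ContinuousOn u (Set.Icc 0 Real.pi) := fun x hx => (h₂.1 x hx).continuousWithinAt
  set w : ℝ → ℂ := fun x => y x - u x with hw
  set dw : ℝ → ℂ := fun x => dy x - du x with hdw
  have hwc : ContinuousOn w (Set.Icc 0 Real.pi) := hyc.sub huc
  have hD : ∀ x ∈ Set.Icc 0 Real.pi, HasDerivWithinAt w (dw x) (Set.Icc 0 Real.pi) x :=
    fun x hx => (h₁.1 x hx).sub (h₂.1 x hx)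
  have hI : ∀ x ∈ Set.Icc 0 Real.pi, dw x = dw 0 + ∫ t in (0 : ℝ)..x, -z * w t := by
    intro x hx
    have hs : Set.Icc 0 x ⊆ Set.Icc 0 Real.pi := Set.Icc_subset_Icc_right hx.2
    have hqx : IntervalIntegrable q volume 0 x := hq.mono_set (by
      rw [Set.uIcc_of_le hx.1, Set.uIcc_of_le Real.pi_pos.le]; exact hs)
    have i1 : IntervalIntegrable (fun t => q t * y a - z * y t) volume 0 x :=
      (hqx.mul_const _).sub (((hyc.mono hs).intervalIntegrable_of_Icc hx.1).const_mul z)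
    have i2 : IntervalIntegrable (fun t => q t * u a - z * u t) volume 0 x :=
      (hqx.mul_const _).sub (((huc.mono hs).intervalIntegrable_of_Icc hx.1).const_mul z)
    have := intervalIntegral.integral_sub i1 i2
    simp only [hdw]
    rw [h₁.2 x hx, h₂.2 x hx, add_sub_add_comm, ← this]
    congr 1
    refine intervalIntegral.integral_congr fun t _ => ?_
    simp only [hw, h0]; ring
  have hE : ∀ x ∈ Set.Icc 0 Real.pi, HasDerivWithinAt dw (-z * w x) (Set.Icc 0 Real.pi) x := by
    intro x hx
    have hc : ContinuousOn (fun t => -z * w t) (Set.Icc 0 Real.pi) := hwc.const_smul (-z)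
    have h1 : HasDerivWithinAt (fun v => ∫ t in (0 : ℝ)..v, -z * w t) (-z * w x)
        (Set.Icc 0 Real.pi) x := by
      have : Fact (x ∈ Set.Icc 0 Real.pi) := ⟨hx⟩
      refine intervalIntegral.integral_hasDerivWithinAt_right ?_ ?_ (hc x hx)
      · exact (hc.mono (Set.Icc_subset_Icc_right hx.2)).intervalIntegrable_of_Icc hx.1
      · exact hc.stronglyMeasurableAtFilter_nhdsWithin measurableSet_Icc x
    exact (h1.const_add (dw 0)).congr (fun v hv => hI v hv) (hI x hx)
  have const : ∀ f : ℝ → ℂ, (∀ x ∈ Set.Icc 0 Real.pi, HasDerivWithinAt f 0 (Set.Icc 0 Real.pi) x) →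
      f a = 0 → ∀ x ∈ Set.Icc 0 Real.pi, f x = 0 := by
    intro f hf hfa x hx
    have key := (convex_Icc (0 : ℝ) Real.pi).norm_image_sub_le_of_norm_hasDerivWithin_le
      (f := f) (f' := fun _ => 0) (C := 0) hf (by simp) ha hx
    rw [zero_mul] at key
    have := norm_le_zero_iff.1 key
    rw [hfa, sub_zero] at this
    exact this
  have hc' := fun x => ((hasDerivAt_cosK z x).hasDerivWithinAt (s := Set.Icc 0 Real.pi))
  have hs' := fun x => ((hasDerivAt_sinK z x).hasDerivWithinAt (s := Set.Icc 0 Real.pi))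
  have hwa : w a = 0 := by simp [hw, h0]
  have hdwa : dw a = 0 := by simp [hdw, h1]
  -- The difference w vanishes at the frozen point, so it solves w'' = -z w without q. The two
  -- combinations in `f1` and `f2` are the first integrals of this equation, namely w(0) and w'(0);
  -- they vanish at a, hence everywhere.
  have f1 := const (fun x => w x * cosK z x - dw x * sinK z x) (fun x hx => by
    convert! ((hD x hx).mul (hc' x)).sub ((hE x hx).mul (hs' x)) using 1
    ring) (by simp [hwa, hdwa]) x hx
  have f2 := const (fun x => z * w x * sinK z x + dw x * cosK z x) (fun x hx => by
    convert! (((hD x hx).const_mul z).mul (hs' x)).add ((hE x hx).mul (hc' x)) using 1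
    ring) (by simp [hwa, hdwa]) x hx
  have h3 := cosK_sq_add z x
  constructor
  · have : w x = 0 := by
      linear_combination (cosK z x) * f1 + (sinK z x) * f2 - w x * h3
    exact sub_eq_zero.1 this
  · have : dw x = 0 := by
      linear_combination (cosK z x) * f2 - z * (sinK z x) * f1 - dw x * h3
    exact sub_eq_zero.1 this


/-! ### The characteristic function is entire -/

lemma norm_exp_le_of_im (w : ℂ) : ‖Complex.exp (w * Complex.I)‖ ≤ Real.exp |w.im| := by
  rw [Complex.norm_exp]
  gcongr
  simpa using neg_le_abs w.im

lemma norm_cos_le (w : ℂ) : ‖Complex.cos w‖ ≤ Real.exp |w.im| := by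
  rw [Complex.cos, norm_div, Complex.norm_two]
  have h1 := norm_exp_le_of_im w
  have h2 := norm_exp_le_of_im (-w)
  rw [Complex.neg_im, abs_neg] at h2
  have := norm_add_le (Complex.exp (w * Complex.I)) (Complex.exp (-w * Complex.I))
  linarith

lemma norm_sin_le (w : ℂ) : ‖Complex.sin w‖ ≤ Real.exp |w.im| := by
  rw [Complex.sin, norm_div, norm_mul, Complex.norm_two, Complex.norm_I, mul_one]
  have h1 := norm_exp_le_of_im w
  have h2 := norm_exp_le_of_im (-w)
  rw [Complex.neg_im, abs_neg] at h2
  have := norm_sub_le (Complex.exp (-w * Complex.I)) (Complex.exp (w * Complex.I))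
  linarith

lemma abs_im_mul_le {ρ ρ₀ : ℂ} (h : ρ ∈ Metric.ball ρ₀ 1) {t M : ℝ} (ht : |t| ≤ M) :
    |(ρ * t).im| ≤ (‖ρ₀‖ + 1) * M := by
  have h1 : ‖ρ‖ ≤ ‖ρ₀‖ + 1 := by
    have := norm_le_norm_add_norm_sub' ρ ρ₀
    have h2 := mem_ball_iff_norm.1 h
    linarith
  calc |(ρ * t).im| ≤ ‖ρ * t‖ := Complex.abs_im_le_norm _
    _ = ‖ρ‖ * |t| := by rw [norm_mul, Complex.norm_real, Real.norm_eq_abs]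
    _ ≤ _ := by gcongr

/-- Differentiation under the integral sign for the transforms `∫ q(t) g(ρ t) dt`, where `g` is
`sin` or `cos`. -/
lemma hasDerivAt_trig_transform {q : ℝ → ℂ} {u v : ℝ} (hq : IntervalIntegrable q volume u v)
    {g g' : ℂ → ℂ} (hg : ∀ w, HasDerivAt g (g' w) w) (hg' : Continuous g')
    (hb : ∀ w, ‖g' w‖ ≤ Real.exp |w.im|) (ρ₀ : ℂ) :
    HasDerivAt (fun ρ : ℂ => ∫ t in u..v, q t * g (ρ * t))
      (∫ t in u..v, q t * (g' (ρ₀ * t) * t)) ρ₀ := by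
  have hgc : Continuous g := continuous_iff_continuousAt.2 fun w => (hg w).continuousAt
  set M := max |u| |v| with hM
  have hM' : ∀ t ∈ Set.uIoc u v, |t| ≤ M := fun t ht => by
    have h := Set.uIoc_subset_uIcc ht
    rw [Set.mem_uIcc] at h
    rw [hM, le_max_iff, abs_le, abs_le]
    by_cases h0 : 0 ≤ t
    · rcases h with h | h
      · right; rw [abs_of_nonneg (h0.trans h.2)]; constructor <;> linarith
      · left; rw [abs_of_nonneg (h0.trans h.2)]; constructor <;> linarith
    · push Not at h0
      rcases h with h | h
      · left; rw [abs_of_nonpos (h.1.trans h0.le)]; constructor <;> linarith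
      · right; rw [abs_of_nonpos (h.1.trans h0.le)]; constructor <;> linarith
  refine (intervalIntegral.hasDerivAt_integral_of_dominated_loc_of_deriv_le
    (F := fun ρ t => q t * g (ρ * t)) (F' := fun ρ t => q t * (g' (ρ * t) * t))
    (bound := fun t => ‖q t‖ * (Real.exp ((‖ρ₀‖ + 1) * M) * M))
    (Metric.ball_mem_nhds ρ₀ one_pos) ?_ ?_ ?_ ?_ ?_ ?_).2
  · refine Filter.Eventually.of_forall fun ρ => ?_
    exact (hq.mul_continuousOn (by fun_prop : ContinuousOn (fun t : ℝ => g (ρ * t)) _)).aestronglyMeasurable_restrict_uIoc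
  · exact hq.mul_continuousOn (by fun_prop)
  · exact (hq.mul_continuousOn (by fun_prop : ContinuousOn (fun t : ℝ => g' (ρ₀ * t) * t) _)).aestronglyMeasurable_restrict_uIoc
  · refine Filter.Eventually.of_forall fun t ht ρ hρ => ?_
    rw [norm_mul, norm_mul, Complex.norm_real, Real.norm_eq_abs]
    gcongr
    · exact (hb _).trans (Real.exp_le_exp.2 (abs_im_mul_le hρ (hM' t ht)))
    · exact hM' t ht
  · exact hq.norm.mul_const _
  · refine Filter.Eventually.of_forall fun t ht ρ hρ => ?_
    have h1 : HasDerivAt (fun ρ : ℂ => ρ * t) t ρ := by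
      simpa using (hasDerivAt_id' ρ).mul_const (t : ℂ)
    exact ((hg (ρ * t)).comp ρ h1).const_mul (q t)

lemma hasDerivAt_sin_transform {q : ℝ → ℂ} {u v : ℝ} (hq : IntervalIntegrable q volume u v)
    (ρ₀ : ℂ) : HasDerivAt (fun ρ : ℂ => ∫ t in u..v, q t * Complex.sin (ρ * t))
      (∫ t in u..v, q t * (Complex.cos (ρ₀ * t) * t)) ρ₀ :=
  hasDerivAt_trig_transform hq Complex.hasDerivAt_sin Complex.continuous_cos norm_cos_le ρ₀

lemma differentiable_cos_transform {q : ℝ → ℂ} {u v : ℝ} (hq : IntervalIntegrable q volume u v) :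
    Differentiable ℂ (fun ρ : ℂ => ∫ t in u..v, q t * Complex.cos (ρ * t)) := fun ρ =>
  (hasDerivAt_trig_transform hq Complex.hasDerivAt_cos Complex.continuous_sin.neg
    (fun w => by rw [norm_neg]; exact norm_sin_le w) ρ).differentiableAt

lemma differentiable_dslope {f : ℂ → ℂ} (hf : Differentiable ℂ f) (c : ℂ) :
    Differentiable ℂ (dslope f c) :=
  differentiableOn_univ.1 ((Complex.differentiableOn_dslope Filter.univ_mem).2 hf.differentiableOn)

lemma differentiable_int_cosK {q : ℝ → ℂ} {u v : ℝ} (hq : IntervalIntegrable q volume u v) :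
    Differentiable ℂ (fun ρ : ℂ => ∫ t in u..v, q t * cosK (ρ ^ 2) t) := by
  simpa only [cosK_sq] using differentiable_cos_transform hq

/-- The quotient of the sine transform by ρ has a removable singularity at 0, and `dslope` is the
function with the singularity removed. -/
lemma differentiable_int_sinK {q : ℝ → ℂ} {u v : ℝ} (hq : IntervalIntegrable q volume u v) :
    Differentiable ℂ (fun ρ : ℂ => ∫ t in u..v, q t * sinK (ρ ^ 2) t) := by
  have h := hasDerivAt_sin_transform hq
  convert differentiable_dslope (fun ρ => (h ρ).differentiableAt) 0 using 1
  ext ρ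
  by_cases hρ : ρ = 0
  · rw [hρ, dslope_same, (h 0).deriv]
    simp [sinK_zero_left]
  · rw [dslope_of_ne _ hρ, slope_def_field]
    simp only [sinK_sq hρ]
    simp only [zero_mul, Complex.sin_zero, mul_zero, intervalIntegral.integral_zero, sub_zero,
      ← mul_div_assoc, intervalIntegral.integral_div]

lemma differentiable_cosK_sq (x : ℝ) : Differentiable ℂ (fun ρ : ℂ => cosK (ρ ^ 2) x) := by
  simp only [cosK_sq]; fun_prop

lemma differentiable_sinK_sq (x : ℝ) : Differentiable ℂ (fun ρ : ℂ => sinK (ρ ^ 2) x) := by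
  have h : Differentiable ℂ (fun ρ : ℂ => Complex.sin (ρ * x)) := by fun_prop
  convert differentiable_dslope h 0 using 1
  ext ρ
  by_cases hρ : ρ = 0
  · have h1 : HasDerivAt (fun ρ : ℂ => Complex.sin (ρ * x)) (Complex.cos (0 * x) * (1 * x)) 0 :=
      ((hasDerivAt_id' (0 : ℂ)).mul_const (x : ℂ)).csin
    rw [hρ, dslope_same, h1.deriv]
    simp [sinK_zero_left]
  · rw [dslope_of_ne _ hρ, slope_def_field, sinK_sq hρ]
    simp

/-- If `ρ ↦ g (ρ²)` is entire then so is `g`. -/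
lemma differentiable_of_comp_sq {g : ℂ → ℂ} (h : Differentiable ℂ (fun ρ => g (ρ ^ 2))) :
    Differentiable ℂ g := by
  have key : ∀ z, z ≠ 0 → DifferentiableAt ℂ g z := by
    intro z₀ hz₀
    set r := sqrtC z₀
    -- The root is taken of z / z₀, which is near 1, so the branch cut is avoided for every nonzero
    -- z₀.
    have e : g =ᶠ[nhds z₀] fun z => (fun ρ => g (ρ ^ 2)) (r * (z / z₀) ^ (1 / 2 : ℂ)) := by
      refine Filter.Eventually.of_forall fun z => ?_
      have : (r * (z / z₀) ^ (1 / 2 : ℂ)) ^ 2 = z := by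
        rw [mul_pow, sqrtC_sq, ← sqrtC, sqrtC_sq]; field_simp
      simp only [this]
    refine DifferentiableAt.congr_of_eventuallyEq ?_ e
    refine DifferentiableAt.comp (f := fun z => r * (z / z₀) ^ (1 / 2 : ℂ)) z₀ (h _) ?_
    refine DifferentiableAt.const_mul ?_ _
    refine DifferentiableAt.cpow_const (by fun_prop) ?_
    rw [div_self hz₀]; exact Complex.one_mem_slitPlane
  -- No branch of the root is analytic at 0, but |√z| = √|z| gives continuity there, and the
  -- isolated singularity is removable.
  have hc : ContinuousAt g 0 := by
    have h0 : Filter.Tendsto sqrtC (nhds 0) (nhds 0) := by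
      rw [tendsto_zero_iff_norm_tendsto_zero]
      have e : (fun z => ‖sqrtC z‖) = fun z => Real.sqrt ‖z‖ := by
        ext z
        rw [← sqrtC_sq z, norm_pow, Real.sqrt_sq (norm_nonneg _), sqrtC_sq]
      rw [e]
      have : Continuous fun z : ℂ => Real.sqrt ‖z‖ := by fun_prop
      simpa using this.tendsto 0
    have h1 := (h.continuous.tendsto 0).comp h0
    have e : (fun ρ => g (ρ ^ 2)) ∘ sqrtC = g := by ext z; simp [sqrtC_sq]
    rw [e] at h1
    simpa [ContinuousAt] using h1
  intro z
  by_cases hz : z = 0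
  · subst hz
    exact (Complex.analyticAt_of_differentiable_on_punctured_nhds_of_continuousAt
      (eventually_nhdsWithin_of_forall fun w hw => key w hw) hc).differentiableAt
  · exact key z hz

/-- The characteristic function, expressed through the explicit solutions. -/
noncomputable def charFn (k α β : ℕ) (q : ℝ → ℂ) (z : ℂ) : ℂ :=
  derivOrder α (solC q (pt k) z) (dsolC q (pt k) z) 0 *
      derivOrder β (fun x => sinK z (x - pt k)) (fun x => cosK z (x - pt k)) Real.pi -
    derivOrder α (fun x => sinK z (x - pt k)) (fun x => cosK z (x - pt k)) 0 *
      derivOrder β (solC q (pt k) z) (dsolC q (pt k) z) Real.pi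

lemma pt_pos {k : ℕ} (hk : 1 < k) : 0 < pt k := by
  unfold pt; have : (0 : ℝ) < k := by exact_mod_cast (by omega : 0 < k)
  have := Real.pi_pos; positivity

lemma two_pt_le {k : ℕ} (hk : 1 < k) : 2 * pt k ≤ Real.pi := by
  unfold pt
  have h2 : (2 : ℝ) ≤ k := by exact_mod_cast hk
  rw [← mul_div_assoc, div_le_iff₀ (by linarith)]
  nlinarith [Real.pi_pos]

lemma pt_mem {k : ℕ} (hk : 1 < k) : pt k ∈ Set.Icc 0 Real.pi :=
  ⟨(pt_pos hk).le, by linarith [pt_pos hk, two_pt_le hk]⟩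

lemma intervalIntegrable_coe {c : ℝ} (hc : 0 ≤ c) (q : L2 c) :
    IntervalIntegrable q volume 0 c := by
  rw [intervalIntegrable_iff_integrableOn_Ioo_of_le hc]
  exact (Lp.memLp q).integrable (by norm_num)

lemma derivOrder_congr {j : ℕ} {y dy u du : ℝ → ℂ} {x : ℝ} (h : y x = u x ∧ dy x = du x) :
    derivOrder j y dy x = derivOrder j u du x := by
  simp [derivOrder, h.1, h.2]

/-- The Cauchy data at a determine C and S on all of [0, π], so the existential definition reduces
to one formula. -/
lemma isCharacteristicFunction_iff {k : ℕ} (hk : 1 < k) (α β : ℕ) (q : L2 Real.pi) (Δ : ℂ → ℂ) :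
    IsCharacteristicFunction k α β q Δ ↔ Δ = charFn k α β q := by
  have hq := intervalIntegrable_coe Real.pi_pos.le q
  have ha := pt_mem hk
  have h0 : (0 : ℝ) ∈ Set.Icc 0 Real.pi := ⟨le_rfl, Real.pi_pos.le⟩
  have hπ : Real.pi ∈ Set.Icc 0 Real.pi := ⟨Real.pi_pos.le, le_rfl⟩
  constructor
  · rintro ⟨C, dC, S, dS, H⟩
    ext z
    obtain ⟨hC, c1, c2, hS, s1, s2, e⟩ := H z
    have uC := fun x hx => hC.unique hq ha (isSolution_solC hq ha z)
      (c1.trans (solC_self _ _ _).symm) (c2.trans (dsolC_self _ _ _).symm) (x := x) hx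
    have uS := fun x hx => hS.unique hq ha (isSolution_sinK q (pt k) z)
      (by simp [s1, sinK_zero]) (by simp [s2, cosK_zero]) (x := x) hx
    have eC : ∀ j, ∀ x ∈ Set.Icc 0 Real.pi, derivOrder j (C z) (dC z) x =
        derivOrder j (solC q (pt k) z) (dsolC q (pt k) z) x :=
      fun j x hx => derivOrder_congr (uC x hx)
    have eS : ∀ j, ∀ x ∈ Set.Icc 0 Real.pi, derivOrder j (S z) (dS z) x =
        derivOrder j (fun x => sinK z (x - pt k)) (fun x => cosK z (x - pt k)) x :=
      fun j x hx => derivOrder_congr (uS x hx)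
    rw [e, Matrix.det_fin_two_of, eC _ _ h0, eC _ _ hπ, eS _ _ h0, eS _ _ hπ]
    rfl
  · rintro rfl
    refine ⟨solC q (pt k), dsolC q (pt k), fun z x => sinK z (x - pt k),
      fun z x => cosK z (x - pt k), fun z => ⟨isSolution_solC hq ha z, solC_self _ _ _,
        dsolC_self _ _ _, isSolution_sinK _ _ _, by simp [sinK_zero], by simp [cosK_zero], ?_⟩⟩
    rw [Matrix.det_fin_two_of]; rfl

lemma isSpectrum_iff {k : ℕ} (hk : 1 < k) (α β : ℕ) (q : L2 Real.pi) (lam : ℕ → ℂ) :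
    IsSpectrum k α β q lam ↔
      ∀ z, {n : ℕ | 1 ≤ n ∧ lam n = z}.encard = analyticOrderAt (charFn k α β q) z := by
  simp [IsSpectrum, isCharacteristicFunction_iff hk]

lemma differentiable_charFn {k : ℕ} (hk : 1 < k) (α β : ℕ) {q : ℝ → ℂ}
    (hq : IntervalIntegrable q volume 0 Real.pi) : Differentiable ℂ (charFn k α β q) := by
  have ha := pt_mem hk
  have hu : Set.uIcc 0 Real.pi = Set.Icc 0 Real.pi := Set.uIcc_of_le Real.pi_pos.le
  have h1 : IntervalIntegrable q volume (pt k) 0 :=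
    hq.mono_set (Set.uIcc_subset_uIcc (hu ▸ ha) (by simp))
  have h2 : IntervalIntegrable q volume (pt k) Real.pi :=
    hq.mono_set (Set.uIcc_subset_uIcc (hu ▸ ha) (by simp))
  apply differentiable_of_comp_sq
  have c1 := differentiable_int_cosK h1
  have c2 := differentiable_int_cosK h2
  have s1 := differentiable_int_sinK h1
  have s2 := differentiable_int_sinK h2
  have c := differentiable_cosK_sq
  have s := differentiable_sinK_sq
  have hC : ∀ x, Differentiable ℂ (fun ρ => ∫ t in pt k..x, q t * cosK (ρ ^ 2) t) →
      Differentiable ℂ (fun ρ => ∫ t in pt k..x, q t * sinK (ρ ^ 2) t) →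
      ∀ j, Differentiable ℂ (fun ρ : ℂ =>
        derivOrder j (solC q (pt k) (ρ ^ 2)) (dsolC q (pt k) (ρ ^ 2)) x) := by
    intro x h h' j
    unfold derivOrder solC dsolC
    split_ifs
    · exact (c _).add (((s _).mul h).sub ((c _).mul h'))
    · exact (((differentiable_pow 2).neg).mul (s _)).add
        (((c _).mul h).add (((differentiable_pow 2).mul (s _)).mul h'))
  have hS : ∀ x : ℝ, ∀ j, Differentiable ℂ (fun ρ : ℂ =>
      derivOrder j (fun x => sinK (ρ ^ 2) (x - pt k)) (fun x => cosK (ρ ^ 2) (x - pt k)) x) := by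
    intro x j
    unfold derivOrder
    split_ifs
    · exact s _
    · exact c _
  exact ((hC 0 c1 s1 α).mul (hS Real.pi β)).sub ((hS 0 α).mul (hC Real.pi c2 s2 β))


/-! ### The function W and the integral representation of the characteristic function -/

/-- Extension of a function on `(0, π)` by zero. -/
noncomputable def ext0 (q : ℝ → ℂ) : ℝ → ℂ := (Set.Ioo 0 Real.pi).indicator q

lemma ext0_of_mem {q : ℝ → ℂ} {x : ℝ} (h0 : 0 < x) (h1 : x < Real.pi) : ext0 q x = q x :=
  Set.indicator_of_mem (show x ∈ Set.Ioo 0 Real.pi from ⟨h0, h1⟩) q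

lemma ext0_of_nonpos {q : ℝ → ℂ} {x : ℝ} (h : x ≤ 0) : ext0 q x = 0 :=
  Set.indicator_of_notMem (fun hx => absurd hx.1 (not_lt.2 h)) q

lemma ext0_of_ge {q : ℝ → ℂ} {x : ℝ} (h : Real.pi ≤ x) : ext0 q x = 0 :=
  Set.indicator_of_notMem (fun hx => absurd hx.2 (not_lt.2 h)) q

lemma memLp_ext0 {q : ℝ → ℂ} (hq : MemLp q 2 (volume.restrict (Set.Ioo 0 Real.pi))) :
    MemLp (ext0 q) 2 volume :=
  (memLp_indicator_iff_restrict measurableSet_Ioo).2 hq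

lemma integrable_ext0 {q : ℝ → ℂ} (hq : MemLp q 2 (volume.restrict (Set.Ioo 0 Real.pi))) :
    Integrable (ext0 q) volume :=
  (integrable_indicator_iff measurableSet_Ioo).2 (hq.integrable (by norm_num))

/-- The function `W` of the main equation. -/
noncomputable def mainW (k α β : ℕ) (q : ℝ → ℂ) (s : ℝ) : ℂ :=
  (1 / 2) * (-ext0 q (s - (Real.pi - pt k)) + (-1) ^ α * ext0 q ((Real.pi - pt k) - s)
    - ext0 q ((Real.pi + pt k) - s) + (-1) ^ β * ext0 q (s + (Real.pi - pt k)))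

lemma memLp_mainW (k α β : ℕ) {q : ℝ → ℂ} (hq : MemLp q 2 (volume.restrict (Set.Ioo 0 Real.pi))) :
    MemLp (mainW k α β q) 2 (volume.restrict (Set.Ioo 0 Real.pi)) := by
  have h := memLp_ext0 hq
  have h1 : MemLp (fun s => ext0 q (s - (Real.pi - pt k))) 2 volume :=
    h.comp_measurePreserving (measurePreserving_sub_right volume (Real.pi - pt k))
  have h2 : MemLp (fun s => ext0 q ((Real.pi - pt k) - s)) 2 volume :=
    h.comp_measurePreserving (Measure.measurePreserving_sub_left volume (Real.pi - pt k))
  have h3 : MemLp (fun s => ext0 q ((Real.pi + pt k) - s)) 2 volume :=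
    h.comp_measurePreserving (Measure.measurePreserving_sub_left volume (Real.pi + pt k))
  have h4 : MemLp (fun s => ext0 q (s + (Real.pi - pt k))) 2 volume :=
    h.comp_measurePreserving (measurePreserving_add_right volume (Real.pi - pt k))
  exact ((((h1.neg.add (h2.const_mul _)).sub h3).add (h4.const_mul _)).const_mul _).restrict _

section integrals
variable {q : ℝ → ℂ}

lemma integral_ext0_of_mem {u v : ℝ} (h0 : 0 ≤ u) (huv : u ≤ v) (hv : v ≤ Real.pi) (g : ℝ → ℂ) :
    ∫ t in u..v, ext0 q t * g t = ∫ t in u..v, q t * g t := by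
  refine intervalIntegral.integral_congr_ae ?_
  filter_upwards [compl_mem_ae_iff.2 (measure_singleton Real.pi)] with t ht h
  rw [Set.uIoc_of_le huv] at h
  rw [ext0_of_mem (h0.trans_lt h.1) (lt_of_le_of_ne (h.2.trans hv) ht)]

lemma integral_ext0_of_nonpos {u v : ℝ} (huv : u ≤ v) (hv : v ≤ 0) (g : ℝ → ℂ) :
    ∫ t in u..v, ext0 q t * g t = 0 := by
  refine intervalIntegral.integral_zero_ae (Filter.Eventually.of_forall fun t h => ?_)
  rw [Set.uIoc_of_le huv] at h
  rw [ext0_of_nonpos (h.2.trans hv), zero_mul]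

lemma integral_ext0_of_ge {u v : ℝ} (huv : u ≤ v) (hu : Real.pi ≤ u) (g : ℝ → ℂ) :
    ∫ t in u..v, ext0 q t * g t = 0 := by
  refine intervalIntegral.integral_zero_ae (Filter.Eventually.of_forall fun t h => ?_)
  rw [Set.uIoc_of_le huv] at h
  rw [ext0_of_ge (hu.trans h.1.le), zero_mul]

variable (hq : MemLp q 2 (volume.restrict (Set.Ioo 0 Real.pi)))
include hq

lemma intervalIntegrable_ext0_mul {g : ℝ → ℂ} (hg : Continuous g) (u v : ℝ) :
    IntervalIntegrable (fun t => ext0 q t * g t) volume u v :=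
  (integrable_ext0 hq).intervalIntegrable.mul_continuousOn hg.continuousOn

/-- A change of variables moves the shifts and reflections from q to φ. The hypothesis `h` says that
φ is even if α = β mod 2 and odd otherwise, as the cosine and sine kernels are in the respective
cases. The right side is split at a, where the integrals in `solC` start. -/
lemma integral_mainW {k : ℕ} (hk : 1 < k) {α β : ℕ} {φ : ℝ → ℂ} (hφ : Continuous φ)
    (h : ∀ x, (-1) ^ β * φ x = (-1) ^ α * φ (-x)) :
    ∫ s in (0 : ℝ)..Real.pi, mainW k α β q s * φ s =
      (1 / 2) * (-(∫ t in (0 : ℝ)..pt k, q t * φ (t + (Real.pi - pt k)))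
        + (-1) ^ α * ((∫ t in (0 : ℝ)..pt k, q t * φ ((Real.pi - pt k) - t)) +
          ∫ t in pt k..Real.pi, q t * φ ((Real.pi - pt k) - t))
        - ∫ t in pt k..Real.pi, q t * φ ((Real.pi + pt k) - t)) := by
  have ha := pt_pos hk
  have h2a := two_pt_le hk
  set a := pt k
  set b := Real.pi - a with hb
  have hb0 : 0 ≤ b := by linarith
  have i := integrable_ext0 hq
  have I : ∀ {g : ℝ → ℂ} (_ : Continuous g) (u v : ℝ),
    IntervalIntegrable (fun t => ext0 q t * g t) volume u v := intervalIntegrable_ext0_mul hq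
  have j1 : IntervalIntegrable (fun s => ext0 q (s - b) * φ s) volume 0 Real.pi :=
    (i.comp_sub_right b).intervalIntegrable.mul_continuousOn hφ.continuousOn
  have j2 : IntervalIntegrable (fun s => ext0 q (b - s) * φ s) volume 0 Real.pi :=
    (i.comp_sub_left b).intervalIntegrable.mul_continuousOn hφ.continuousOn
  have j3 : IntervalIntegrable (fun s => ext0 q ((Real.pi + a) - s) * φ s) volume 0 Real.pi :=
    (i.comp_sub_left (Real.pi + a)).intervalIntegrable.mul_continuousOn hφ.continuousOn
  have j4 : IntervalIntegrable (fun s => ext0 q (s + b) * φ s) volume 0 Real.pi :=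
    (i.comp_add_right b).intervalIntegrable.mul_continuousOn hφ.continuousOn
  have e1 : ∫ s in (0 : ℝ)..Real.pi, ext0 q (s - b) * φ s = ∫ t in (0 : ℝ)..a, q t * φ (t + b) := by
    have c : Continuous fun t => φ (t + b) := by fun_prop
    have := intervalIntegral.integral_comp_sub_right (a := 0) (b := Real.pi)
      (fun t => ext0 q t * φ (t + b)) b
    simp only [sub_add_cancel] at this
    rw [this, ← intervalIntegral.integral_add_adjacent_intervals (I c _ 0) (I c 0 _),
      integral_ext0_of_nonpos (by linarith) le_rfl, zero_add,
      integral_ext0_of_mem le_rfl (by linarith) (by linarith)]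
    congr 1; linarith
  have e2 : ∫ s in (0 : ℝ)..Real.pi, ext0 q (b - s) * φ s = ∫ t in (0 : ℝ)..b, q t * φ (b - t) := by
    have c : Continuous fun t => φ (b - t) := by fun_prop
    have := intervalIntegral.integral_comp_sub_left (a := 0) (b := Real.pi)
      (fun t => ext0 q t * φ (b - t)) b
    simp only [sub_sub_cancel] at this
    rw [this, ← intervalIntegral.integral_add_adjacent_intervals (I c _ 0) (I c 0 _),
      integral_ext0_of_nonpos (by linarith) le_rfl, zero_add, sub_zero,
      integral_ext0_of_mem le_rfl (by linarith) (by linarith)]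
  have e3 : ∫ s in (0 : ℝ)..Real.pi, ext0 q ((Real.pi + a) - s) * φ s =
      ∫ t in a..Real.pi, q t * φ ((Real.pi + a) - t) := by
    have c : Continuous fun t => φ ((Real.pi + a) - t) := by fun_prop
    have := intervalIntegral.integral_comp_sub_left (a := 0) (b := Real.pi)
      (fun t => ext0 q t * φ ((Real.pi + a) - t)) (Real.pi + a)
    simp only [sub_sub_cancel] at this
    rw [this, ← intervalIntegral.integral_add_adjacent_intervals (I c _ Real.pi) (I c Real.pi _),
      integral_ext0_of_ge (by linarith) le_rfl, add_zero,
      integral_ext0_of_mem (by linarith) (by linarith) (by linarith)]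
    congr 1; linarith
  have e4 : ∫ s in (0 : ℝ)..Real.pi, ext0 q (s + b) * φ s = ∫ t in b..Real.pi, q t * φ (t - b) := by
    have c : Continuous fun t => φ (t - b) := by fun_prop
    have := intervalIntegral.integral_comp_add_right (a := 0) (b := Real.pi)
      (fun t => ext0 q t * φ (t - b)) b
    simp only [add_sub_cancel_right] at this
    rw [this, ← intervalIntegral.integral_add_adjacent_intervals (I c _ Real.pi) (I c Real.pi _),
      integral_ext0_of_ge (by linarith) le_rfl, add_zero, zero_add,
      integral_ext0_of_mem (by linarith) (by linarith) (by linarith)]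
  -- By parity the fourth term of `mainW` supplies the part over (b, π) that the second one lacks,
  -- and together they give a single integral over (0, π).
  have e5 : (-1) ^ β * ∫ t in b..Real.pi, q t * φ (t - b) =
      (-1) ^ α * ∫ t in b..Real.pi, q t * φ (b - t) := by
    rw [← intervalIntegral.integral_const_mul, ← intervalIntegral.integral_const_mul]
    refine intervalIntegral.integral_congr fun t _ => ?_
    have := h (t - b)
    rw [neg_sub] at this
    linear_combination (q t) * this
  have qi : ∀ {u v : ℝ}, 0 ≤ u → u ≤ v → v ≤ Real.pi →
      IntervalIntegrable (fun t => q t * φ (b - t)) volume u v := by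
    intro u v h0 huv hv
    have hqi : IntervalIntegrable q volume 0 Real.pi := by
      rw [intervalIntegrable_iff_integrableOn_Ioo_of_le Real.pi_pos.le]
      exact hq.integrable (by norm_num)
    have := hqi.mul_continuousOn (by fun_prop : ContinuousOn (fun t => φ (b - t)) _)
    refine this.mono_set ?_
    rw [Set.uIcc_of_le huv, Set.uIcc_of_le Real.pi_pos.le]
    exact Set.Icc_subset_Icc h0 hv
  have e6 : (∫ t in (0 : ℝ)..a, q t * φ (b - t)) + (∫ t in a..Real.pi, q t * φ (b - t)) =
      (∫ t in (0 : ℝ)..b, q t * φ (b - t)) + ∫ t in b..Real.pi, q t * φ (b - t) := by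
    rw [intervalIntegral.integral_add_adjacent_intervals (qi le_rfl (by linarith) (by linarith))
      (qi (by linarith) (by linarith) le_rfl), intervalIntegral.integral_add_adjacent_intervals
      (qi le_rfl (by linarith) (by linarith)) (qi (by linarith) (by linarith) le_rfl)]
  have e : ∀ s, mainW k α β q s * φ s = (1 / 2) * (-(ext0 q (s - b) * φ s)
      + (-1) ^ α * (ext0 q (b - s) * φ s) - ext0 q ((Real.pi + a) - s) * φ s
      + (-1) ^ β * (ext0 q (s + b) * φ s)) := fun s => by
    simp only [mainW]; ring
  simp only [e]
  have j1 : IntervalIntegrable (fun s => -(ext0 q (s - b) * φ s)) volume 0 Real.pi := j1.neg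
  rw [intervalIntegral.integral_const_mul, intervalIntegral.integral_add
    ((j1.add (j2.const_mul _)).sub j3) (j4.const_mul _), intervalIntegral.integral_sub
    (j1.add (j2.const_mul _)) j3, intervalIntegral.integral_add j1 (j2.const_mul _),
    intervalIntegral.integral_neg, intervalIntegral.integral_const_mul,
    intervalIntegral.integral_const_mul, e1, e2, e3, e4, e5, e6]
  ring

end integrals

lemma integral_cosK_sub {q : ℝ → ℂ} {u v : ℝ} (hq : IntervalIntegrable q volume u v) (z : ℂ)
    (x : ℝ) : ∫ t in u..v, q t * cosK z (x - t) =
      cosK z x * (∫ t in u..v, q t * cosK z t) + z * sinK z x * ∫ t in u..v, q t * sinK z t := by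
  rw [← intervalIntegral.integral_const_mul, ← intervalIntegral.integral_const_mul,
    ← intervalIntegral.integral_add]
  · refine intervalIntegral.integral_congr fun t _ => ?_
    simp only [cosK_sub]; ring
  · exact (hq.mul_continuousOn (continuous_cosK z).continuousOn).const_mul _
  · exact (hq.mul_continuousOn (continuous_sinK z).continuousOn).const_mul _

lemma integral_sinK_sub {q : ℝ → ℂ} {u v : ℝ} (hq : IntervalIntegrable q volume u v) (z : ℂ)
    (x : ℝ) : ∫ t in u..v, q t * sinK z (x - t) =
      sinK z x * (∫ t in u..v, q t * cosK z t) - cosK z x * ∫ t in u..v, q t * sinK z t := by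
  rw [← intervalIntegral.integral_const_mul, ← intervalIntegral.integral_const_mul,
    ← intervalIntegral.integral_sub]
  · refine intervalIntegral.integral_congr fun t _ => ?_
    simp only [sinK_sub]; ring
  · exact (hq.mul_continuousOn (continuous_cosK z).continuousOn).const_mul _
  · exact (hq.mul_continuousOn (continuous_sinK z).continuousOn).const_mul _

lemma integral_cosK_add {q : ℝ → ℂ} {u v : ℝ} (hq : IntervalIntegrable q volume u v) (z : ℂ)
    (x : ℝ) : ∫ t in u..v, q t * cosK z (t + x) =
      cosK z x * (∫ t in u..v, q t * cosK z t) - z * sinK z x * ∫ t in u..v, q t * sinK z t := by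
  have := integral_cosK_sub hq z (-x)
  simp only [cosK_neg, sinK_neg] at this
  rw [sub_eq_add_neg, ← neg_mul, ← mul_neg, ← this]
  refine intervalIntegral.integral_congr fun t _ => ?_
  rw [← cosK_neg]; congr 2; ring

lemma integral_sinK_add {q : ℝ → ℂ} {u v : ℝ} (hq : IntervalIntegrable q volume u v) (z : ℂ)
    (x : ℝ) : ∫ t in u..v, q t * sinK z (t + x) =
      sinK z x * (∫ t in u..v, q t * cosK z t) + cosK z x * ∫ t in u..v, q t * sinK z t := by
  have := integral_sinK_sub hq z (-x)
  simp only [cosK_neg, sinK_neg] at this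
  have e : ∫ t in u..v, q t * sinK z (t + x) = -∫ t in u..v, q t * sinK z (-x - t) := by
    rw [← intervalIntegral.integral_neg]
    refine intervalIntegral.integral_congr fun t _ => ?_
    rw [← mul_neg, ← sinK_neg]; congr 2; ring
  rw [e, this]; ring

section charFn
variable {k : ℕ} (hk : 1 < k) {q : ℝ → ℂ}
  (hq : MemLp q 2 (volume.restrict (Set.Ioo 0 Real.pi)))
include hk hq

lemma intervalIntegrable_parts :
    IntervalIntegrable q volume 0 (pt k) ∧ IntervalIntegrable q volume (pt k) Real.pi := by
  have hqi : IntervalIntegrable q volume 0 Real.pi := by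
    rw [intervalIntegrable_iff_integrableOn_Ioo_of_le Real.pi_pos.le]
    exact hq.integrable (by norm_num)
  have ha := pt_mem hk
  have hu : Set.uIcc 0 Real.pi = Set.Icc 0 Real.pi := Set.uIcc_of_le Real.pi_pos.le
  exact ⟨hqi.mono_set (Set.uIcc_subset_uIcc (by simp) (hu ▸ ha)),
    hqi.mono_set (Set.uIcc_subset_uIcc (hu ▸ ha) (by simp))⟩

/-- After expansion both sides are affine in the integrals of q against `cosK` and `sinK` over (0,
a) and (a, π), with equal coefficients; the part free of q collapses by `cosK_sq_add` at a. The
factor z stands for the ρ² in the denominator of the representation. The other two boundary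
conditions work alike without it. -/
lemma charFn_zero_zero (z : ℂ) : z * charFn k 0 0 q z = z * sinK z Real.pi +
    ∫ t in (0 : ℝ)..Real.pi, mainW k 0 0 q t * cosK z t := by
  obtain ⟨i1, i2⟩ := intervalIntegrable_parts hk hq
  rw [integral_mainW hq hk (continuous_cosK z) (by simp [cosK_neg]), integral_cosK_add i1,
    integral_cosK_sub i1, integral_cosK_sub i2, integral_cosK_sub i2]
  simp only [charFn, derivOrder, solC, if_true, zero_sub, sinK_neg, cosK_neg, sinK_zero, cosK_zero,
    intervalIntegral.integral_symm 0 (pt k)]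
  have e1 : cosK z (Real.pi + pt k) = cosK z Real.pi * cosK z (pt k)
      - z * sinK z Real.pi * sinK z (pt k) := by
    rw [← sub_neg_eq_add, cosK_sub, cosK_neg, sinK_neg]; ring
  have e2 : sinK z (Real.pi + pt k) = sinK z Real.pi * cosK z (pt k)
      + cosK z Real.pi * sinK z (pt k) := by
    rw [← sub_neg_eq_add, sinK_sub, cosK_neg, sinK_neg]; ring
  rw [e1, e2, cosK_sub, sinK_sub]
  linear_combination z * sinK z Real.pi * cosK_sq_add z (pt k)

lemma charFn_one_one (z : ℂ) : charFn k 1 1 q z = z * sinK z Real.pi +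
    ∫ t in (0 : ℝ)..Real.pi, mainW k 1 1 q t * cosK z t := by
  obtain ⟨i1, i2⟩ := intervalIntegrable_parts hk hq
  rw [integral_mainW hq hk (continuous_cosK z) (by simp [cosK_neg]), integral_cosK_add i1,
    integral_cosK_sub i1, integral_cosK_sub i2, integral_cosK_sub i2]
  simp only [charFn, derivOrder, dsolC, one_ne_zero, if_false, zero_sub, sinK_neg, cosK_neg,
    sinK_zero, cosK_zero, intervalIntegral.integral_symm 0 (pt k)]
  have e1 : cosK z (Real.pi + pt k) = cosK z Real.pi * cosK z (pt k)
      - z * sinK z Real.pi * sinK z (pt k) := by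
    rw [← sub_neg_eq_add, cosK_sub, cosK_neg, sinK_neg]; ring
  have e2 : sinK z (Real.pi + pt k) = sinK z Real.pi * cosK z (pt k)
      + cosK z Real.pi * sinK z (pt k) := by
    rw [← sub_neg_eq_add, sinK_sub, cosK_neg, sinK_neg]; ring
  rw [e1, e2, cosK_sub, sinK_sub]
  linear_combination z * sinK z Real.pi * cosK_sq_add z (pt k)

lemma charFn_one_zero (z : ℂ) : charFn k 1 0 q z = -cosK z Real.pi +
    ∫ t in (0 : ℝ)..Real.pi, mainW k 1 0 q t * sinK z t := by
  obtain ⟨i1, i2⟩ := intervalIntegrable_parts hk hq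
  rw [integral_mainW hq hk (continuous_sinK z) (by simp [sinK_neg]), integral_sinK_add i1,
    integral_sinK_sub i1, integral_sinK_sub i2, integral_sinK_sub i2]
  simp only [charFn, derivOrder, dsolC, solC, one_ne_zero, if_false, if_true, zero_sub, sinK_neg,
    cosK_neg, sinK_zero, cosK_zero, intervalIntegral.integral_symm 0 (pt k)]
  have e1 : cosK z (Real.pi + pt k) = cosK z Real.pi * cosK z (pt k)
      - z * sinK z Real.pi * sinK z (pt k) := by
    rw [← sub_neg_eq_add, cosK_sub, cosK_neg, sinK_neg]; ring
  have e2 : sinK z (Real.pi + pt k) = sinK z Real.pi * cosK z (pt k)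
      + cosK z Real.pi * sinK z (pt k) := by
    rw [← sub_neg_eq_add, sinK_sub, cosK_neg, sinK_neg]; ring
  rw [e1, e2, cosK_sub, sinK_sub]
  linear_combination -cosK z Real.pi * cosK_sq_add z (pt k)

end charFn


/-! ### Injectivity of the transforms: Δ determines W -/

lemma intervalIntegrable_mul_of_continuous {f : ℝ → ℂ} {u v : ℝ}
    (hf : IntervalIntegrable f volume u v) {g : ℝ → ℂ} (hg : Continuous g) :
    IntervalIntegrable (fun t => f t * g t) volume u v :=
  hf.mul_continuousOn hg.continuousOn

/-- A function on `(0, π)` orthogonal to all powers of the cosine vanishes. -/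
lemma ae_eq_zero_of_integral_cos_pow {f : ℝ → ℂ} (hf : IntervalIntegrable f volume 0 Real.pi)
    (h : ∀ n : ℕ, ∫ t in (0 : ℝ)..Real.pi, f t * (Real.cos t : ℂ) ^ n = 0) :
    ∀ᵐ t, t ∈ Set.Ioo 0 Real.pi → f t = 0 := by
  have hpoly : ∀ p : Polynomial ℝ,
      ∫ t in (0 : ℝ)..Real.pi, f t * ((p.eval (Real.cos t) : ℝ) : ℂ) = 0 := by
    intro p
    induction p using Polynomial.induction_on' with
    | add p r hp hr =>
      simp only [Polynomial.eval_add, Complex.ofReal_add, mul_add]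
      rw [intervalIntegral.integral_add, hp, hr, add_zero] <;>
      exact intervalIntegrable_mul_of_continuous hf (by fun_prop)
    | monomial n c =>
      simp only [Polynomial.eval_monomial, Complex.ofReal_mul, Complex.ofReal_pow]
      have e : ∀ t : ℝ, f t * ((c : ℂ) * (Real.cos t : ℂ) ^ n) = c * (f t * (Real.cos t : ℂ) ^ n) :=
        fun t => by ring
      simp only [e, intervalIntegral.integral_const_mul, h, mul_zero]
  refine isOpen_Ioo.ae_eq_zero_of_integral_contDiff_smul_eq_zero ?_ ?_
  · refine IntegrableOn.locallyIntegrableOn ?_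
    exact (intervalIntegrable_iff_integrableOn_Ioo_of_le Real.pi_pos.le).1 hf
  · intro g hg _ hsupp
    have hgc : Continuous g := hg.continuous
    have e0 : ∫ t, g t • f t = ∫ t in (0 : ℝ)..Real.pi, f t * (g t : ℂ) := by
      rw [intervalIntegral.integral_of_le Real.pi_pos.le, integral_Ioc_eq_integral_Ioo,
        setIntegral_eq_integral_of_forall_compl_eq_zero]
      · refine integral_congr_ae (Filter.Eventually.of_forall fun t => ?_)
        simp [mul_comm]
      · intro t ht
        have : g t = 0 := image_eq_zero_of_notMem_tsupport fun h => ht (hsupp h)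
        simp [this]
    rw [e0, ← norm_le_zero_iff]
    refine le_of_forall_pos_le_add fun ε hε => ?_
    set A := ∫ t in (0 : ℝ)..Real.pi, ‖f t‖ with hA
    have hA0 : 0 ≤ A := intervalIntegral.integral_nonneg Real.pi_pos.le fun _ _ => norm_nonneg _
    -- Since t = arccos (cos t) on [0, π], a polynomial close to g ∘ arccos on [-1, 1] gives p(cos
    -- t) close to g(t).
    obtain ⟨p, hp⟩ := exists_polynomial_near_of_continuousOn (-1) 1 (fun x => g (Real.arccos x))
      (hgc.comp Real.continuous_arccos).continuousOn (ε / (A + 1)) (by positivity)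
    have e1 : ∫ t in (0 : ℝ)..Real.pi, f t * (g t : ℂ) =
        ∫ t in (0 : ℝ)..Real.pi, f t * ((g t - p.eval (Real.cos t) : ℝ) : ℂ) := by
      simp only [Complex.ofReal_sub, mul_sub]
      rw [intervalIntegral.integral_sub, hpoly, sub_zero] <;>
      exact intervalIntegrable_mul_of_continuous hf (by fun_prop)
    rw [e1, zero_add]
    have hle : ‖∫ t in (0 : ℝ)..Real.pi, f t * ((g t - p.eval (Real.cos t) : ℝ) : ℂ)‖ ≤
        ∫ t in (0 : ℝ)..Real.pi, ‖f t‖ * (ε / (A + 1)) := by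
      refine intervalIntegral.norm_integral_le_of_norm_le Real.pi_pos.le ?_ (hf.norm.mul_const _)
      refine Filter.Eventually.of_forall fun t ht => ?_
      rw [norm_mul, Complex.norm_real, Real.norm_eq_abs, abs_sub_comm]
      gcongr
      have := hp (Real.cos t) ⟨Real.neg_one_le_cos t, Real.cos_le_one t⟩
      rw [Real.arccos_cos ht.1.le ht.2] at this
      exact this.le
    refine hle.trans ?_
    rw [intervalIntegral.integral_mul_const, ← hA, mul_div_assoc', div_le_iff₀ (by positivity)]
    nlinarith

/-- Multiplying by cos t replaces the frequency r by r ± 1, so vanishing at all real frequencies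
survives every power of the cosine. The frequency must stay general in the induction; later only r =
0 (cosine) and r = 1 (sine) are used. -/
lemma integral_trig_mul_cos_pow {f : ℝ → ℂ} (hf : IntervalIntegrable f volume 0 Real.pi)
    {g : ℝ → ℂ} (hg : Continuous g)
    (hadd : ∀ x y : ℝ, 2 * ((Real.cos y : ℂ) * g x) = g (x + y) + g (x - y))
    (h : ∀ r : ℝ, ∫ t in (0 : ℝ)..Real.pi, f t * g (r * t) = 0) (n : ℕ) (r : ℝ) :
    ∫ t in (0 : ℝ)..Real.pi, f t * ((Real.cos t : ℂ) ^ n * g (r * t)) = 0 := by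
  induction n generalizing r with
  | zero => simpa using h r
  | succ n ih =>
    have e : ∀ t : ℝ, f t * ((Real.cos t : ℂ) ^ (n + 1) * g (r * t)) =
        (1 / 2) * (f t * ((Real.cos t : ℂ) ^ n * g ((r + 1) * t)) +
          f t * ((Real.cos t : ℂ) ^ n * g ((r - 1) * t))) := fun t => by
      have := hadd (r * t) t
      rw [add_one_mul, sub_one_mul]
      linear_combination (1 / 2) * f t * (Real.cos t : ℂ) ^ n * this
    simp only [e]
    rw [intervalIntegral.integral_const_mul, intervalIntegral.integral_add, ih, ih]
    · simp
    all_goals exact intervalIntegrable_mul_of_continuous hf (by fun_prop)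

lemma ae_eq_zero_of_cos_transform {f : ℝ → ℂ} (hf : IntervalIntegrable f volume 0 Real.pi)
    (h : ∀ r : ℝ, ∫ t in (0 : ℝ)..Real.pi, f t * Complex.cos (r * t) = 0) :
    ∀ᵐ t, t ∈ Set.Ioo 0 Real.pi → f t = 0 := by
  refine ae_eq_zero_of_integral_cos_pow hf fun n => ?_
  have := integral_trig_mul_cos_pow hf (g := fun x => (Real.cos x : ℂ)) (by fun_prop) (fun x y => by
    rw [Real.cos_add, Real.cos_sub]; push_cast; ring) (fun r => by simpa using h r) n 0
  simpa using this

lemma ae_eq_zero_of_sin_transform {f : ℝ → ℂ} (hf : IntervalIntegrable f volume 0 Real.pi)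
    (h : ∀ r : ℝ, ∫ t in (0 : ℝ)..Real.pi, f t * Complex.sin (r * t) = 0) :
    ∀ᵐ t, t ∈ Set.Ioo 0 Real.pi → f t = 0 := by
  have key := ae_eq_zero_of_integral_cos_pow (f := fun t => f t * (Real.sin t : ℂ))
    (intervalIntegrable_mul_of_continuous hf (by fun_prop)) fun n => by
    have := integral_trig_mul_cos_pow hf (g := fun x => (Real.sin x : ℂ)) (by fun_prop)
      (fun x y => by rw [Real.sin_add, Real.sin_sub]; push_cast; ring)
      (fun r => by simpa using h r) n 1
    rw [← this]
    refine intervalIntegral.integral_congr fun t _ => ?_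
    simp only [one_mul]; ring
  filter_upwards [key] with t ht hmem
  have hs : (Real.sin t : ℂ) ≠ 0 := by
    exact_mod_cast (Real.sin_pos_of_mem_Ioo hmem).ne'
  exact (mul_eq_zero.1 (ht hmem)).resolve_right hs

/-- `W` is determined by the function it represents. -/
lemma Represents.unique {α β : ℕ} {W₁ W₂ : L2 Real.pi} {Δ : ℂ → ℂ}
    (h₁ : Represents α β W₁ Δ) (h₂ : Represents α β W₂ Δ) : W₁ = W₂ := by
  have i1 := intervalIntegrable_coe Real.pi_pos.le W₁
  have i2 := intervalIntegrable_coe Real.pi_pos.le W₂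
  suffices h : ∀ᵐ t, t ∈ Set.Ioo 0 Real.pi → W₁ t - W₂ t = 0 by
    refine Lp.ext ?_
    rw [Filter.EventuallyEq, ae_restrict_iff' measurableSet_Ioo]
    filter_upwards [h] with t ht hm using sub_eq_zero.1 (ht hm)
  by_cases hαβ : α = β
  · have hne : ∀ ρ : ℂ, ρ ≠ 0 →
        ∫ t in (0 : ℝ)..Real.pi, (W₁ t - W₂ t) * Complex.cos (ρ * t) = 0 := by
      intro ρ hρ
      have e := (h₁.1 hαβ ρ hρ).symm.trans (h₂.1 hαβ ρ hρ)
      have e := add_left_cancel (mul_left_cancel₀ (pow_ne_zero _ hρ) e)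
      simp only [← mul_div_assoc, intervalIntegral.integral_div] at e
      have e := (div_left_inj' (pow_ne_zero 2 hρ)).1 e
      simp only [sub_mul]
      rw [intervalIntegral.integral_sub, e, sub_self] <;>
      exact intervalIntegrable_mul_of_continuous ‹_› (by fun_prop)
    -- The representation says nothing about the transform at ρ = 0; that value follows by
    -- continuity.
    refine ae_eq_zero_of_cos_transform (i1.sub i2) fun r => ?_
    by_cases hr : (r : ℂ) = 0
    · rw [hr]
      have hc := (differentiable_cos_transform (i1.sub i2)).continuous
      have := hc.tendsto 0
      have h0 : Filter.Tendsto (fun ρ : ℂ => ∫ t in (0 : ℝ)..Real.pi,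
          (W₁ t - W₂ t) * Complex.cos (ρ * t)) (nhdsWithin 0 {0}ᶜ) (nhds 0) :=
        tendsto_const_nhds.congr' (eventually_nhdsWithin_of_forall fun ρ hρ => (hne ρ hρ).symm)
      exact tendsto_nhds_unique (this.mono_left nhdsWithin_le_nhds) h0
    · exact hne _ hr
  · refine ae_eq_zero_of_sin_transform (i1.sub i2) fun r => ?_
    by_cases hr : (r : ℂ) = 0
    · simp [hr]
    · have e := (h₁.2.2 hαβ r hr).symm.trans (h₂.2.2 hαβ r hr)
      have e := add_left_cancel e
      simp only [← mul_div_assoc, intervalIntegral.integral_div] at e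
      have e := (div_left_inj' hr).1 e
      simp only [sub_mul]
      rw [intervalIntegral.integral_sub, e, sub_self] <;>
      exact intervalIntegrable_mul_of_continuous ‹_› (by fun_prop)

/-- `W` for the potential `q`, as an element of `L₂(0, π)`. -/
noncomputable def mainWLp (k α β : ℕ) (q : L2 Real.pi) : L2 Real.pi :=
  (memLp_mainW k α β (Lp.memLp q)).toLp _

lemma mainWLp_coe (k α β : ℕ) (q : L2 Real.pi) :
    ∀ᵐ t, t ∈ Set.Ioo 0 Real.pi → mainWLp k α β q t = mainW k α β q t :=
  (ae_restrict_iff' measurableSet_Ioo).1 (MemLp.coeFn_toLp _)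

lemma integral_mainWLp (k α β : ℕ) (q : L2 Real.pi) (g : ℝ → ℂ) :
    ∫ t in (0 : ℝ)..Real.pi, mainWLp k α β q t * g t =
      ∫ t in (0 : ℝ)..Real.pi, mainW k α β q t * g t := by
  refine intervalIntegral.integral_congr_ae ?_
  filter_upwards [mainWLp_coe k α β q, compl_mem_ae_iff.2 (measure_singleton Real.pi)]
    with t ht hne hm
  rw [Set.uIoc_of_le Real.pi_pos.le] at hm
  rw [ht ⟨hm.1, lt_of_le_of_ne hm.2 hne⟩]

/-- The pairs `(α, β)` for which the degenerate case occurs. -/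
def DegenerateOrders (α β : ℕ) : Prop :=
  (α = 0 ∧ β = 0) ∨ (α = 1 ∧ β = 0) ∨ (α = 1 ∧ β = 1)

lemma represents_charFn {k : ℕ} (hk : 1 < k) {α β : ℕ} (h : DegenerateOrders α β)
    (q : L2 Real.pi) : Represents α β (mainWLp k α β q) (charFn k α β q) := by
  rcases h with ⟨rfl, rfl⟩ | ⟨rfl, rfl⟩ | ⟨rfl, rfl⟩
  · refine ⟨fun _ ρ hρ => ?_, fun _ _ => ?_, fun h => absurd rfl h⟩
    · have e := charFn_zero_zero hk (Lp.memLp q) (ρ ^ 2)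
      have h2 := pow_ne_zero 2 hρ
      simp only [cosK_sq, sinK_sq hρ] at e
      simp only [← mul_div_assoc, intervalIntegral.integral_div, integral_mainWLp]
      field_simp at e ⊢
      simpa using e
    -- The factor z on the left of `charFn_zero_zero` forces the mean value of W to vanish.
    · have e := charFn_zero_zero hk (Lp.memLp q) 0
      have := integral_mainWLp k 0 0 q fun _ => 1
      simp only [mul_one] at this
      simpa [cosK_zero_left, this] using e.symm
  · refine ⟨fun h => absurd h (by norm_num), fun h => absurd h (by norm_num), fun _ ρ hρ => ?_⟩
    have e := charFn_one_zero hk (Lp.memLp q) (ρ ^ 2)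
    simp only [cosK_sq, sinK_sq hρ] at e
    simpa [integral_mainWLp] using e
  · refine ⟨fun _ ρ hρ => ?_, fun h => absurd h (by norm_num), fun h => absurd rfl h⟩
    have e := charFn_one_one hk (Lp.memLp q) (ρ ^ 2)
    have h2 := pow_ne_zero 2 hρ
    simp only [cosK_sq, sinK_sq hρ] at e
    simp only [← mul_div_assoc, intervalIntegral.integral_div, integral_mainWLp]
    rw [e]; field_simp; ring


/-! ### The degenerate case and the parity of k -/

/-- The row equations of `mainMatrix` for a kernel vector, with indices in `ℕ`. -/
lemma exists_kernel_sequence {k α β : ℕ} (hk : 1 < k) (hdeg : Degenerate k α β) :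
    ∃ u : ℕ → ℤ, (∃ i < k, u i ≠ 0) ∧ u 0 + (-1) ^ (α + β) * u 1 = 0 ∧
      (∀ i, i + 2 < k → (-1) ^ (1 + β) * u i + (-1) ^ (α + β) * u (i + 2) = 0) ∧
      u (k - 2) + u (k - 1) = 0 := by
  obtain ⟨v, hv, hM⟩ := Matrix.exists_mulVec_eq_zero_iff.2 hdeg
  have row := fun i : Fin k => congrFun hM i
  simp only [Matrix.mulVec, dotProduct, Pi.zero_apply] at row
  -- Each row has at most two nonzero entries, so its equation relates two unknowns.
  have two : ∀ i p q : Fin k, p ≠ q → (∀ j, j ≠ p ∧ j ≠ q → mainMatrix k α β i j = 0) →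
      mainMatrix k α β i p * v p + mainMatrix k α β i q * v q = 0 := by
    intro i p q hpq h
    rw [← row i, Fintype.sum_eq_add p q hpq fun j hj => by rw [h j hj, zero_mul]]
  refine ⟨fun i => if h : i < k then v ⟨i, h⟩ else 0, ?_, ?_, ?_, ?_⟩
  · obtain ⟨i, hi⟩ := Function.ne_iff.1 hv
    exact ⟨i, i.2, by simpa using hi⟩
  · have := two ⟨0, by omega⟩ ⟨0, by omega⟩ ⟨1, hk⟩ (by simp [Fin.ext_iff]) (fun j hj => by
      simp only [ne_eq, Fin.ext_iff] at hj
      simp only [mainMatrix, Matrix.of_apply]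
      rw [if_neg (by omega), if_neg (by omega), if_neg (by omega), if_neg (by omega)])
    have hk0 : 0 < k := by omega
    have hk1 : 1 ≠ k := by omega
    simpa [mainMatrix, hk, hk0, hk1] using this
  · intro i hi
    have := two ⟨i + 1, by omega⟩ ⟨i, by omega⟩ ⟨i + 2, hi⟩ (by simp [Fin.ext_iff]) (fun j hj => by
      simp only [ne_eq, Fin.ext_iff] at hj
      simp only [mainMatrix, Matrix.of_apply]
      rw [if_neg (by omega), if_neg (by omega), if_neg (by omega), if_neg (by omega)])
    simp only [mainMatrix, Matrix.of_apply] at this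
    rw [if_neg (by omega), if_neg (by omega), if_neg (by omega), if_pos trivial,
      if_neg (by omega), if_neg (by omega), if_pos trivial] at this
    simpa [hi, (by omega : i < k)] using this
  · have := two ⟨k - 1, by omega⟩ ⟨k - 2, by omega⟩ ⟨k - 1, by omega⟩
      (by simp only [ne_eq, Fin.ext_iff]; omega) (fun j hj => by
      simp only [ne_eq, Fin.ext_iff] at hj
      simp only [mainMatrix, Matrix.of_apply]
      rw [if_neg (by omega), if_neg (by omega), if_neg (by omega), if_neg (by omega)])
    simp only [mainMatrix, Matrix.of_apply] at this
    rw [if_neg (by omega), if_neg (by omega), if_neg (by omega), if_pos (by omega),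
      if_neg (by omega), if_pos (by omega), ← mul_add] at this
    have h1 : ((-1 : ℤ) ^ (1 + β)) ≠ 0 := by positivity
    simpa [(by omega : k - 1 < k), (by omega : k - 2 < k)] using (mul_eq_zero.1 this).resolve_left h1

lemma two_step_recursion {k : ℕ} {u : ℕ → ℤ} {d : ℤ}
    (h : ∀ i, i + 2 < k → u (i + 2) = d * u i) (j : ℕ) :
    (2 * j < k → u (2 * j) = d ^ j * u 0) ∧ (2 * j + 1 < k → u (2 * j + 1) = d ^ j * u 1) := by
  induction j with
  | zero => simp
  | succ j ih =>
    refine ⟨fun hj => ?_, fun hj => ?_⟩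
    · rw [show 2 * (j + 1) = 2 * j + 2 by ring, h _ (by omega), ih.1 (by omega)]; ring
    · rw [show 2 * (j + 1) + 1 = 2 * j + 1 + 2 by ring, h _ (by omega), ih.2 (by omega)]; ring

/-- The degenerate case in terms of the parity of `k`. -/
lemma degenerate_cases {k α β : ℕ} (hk : 1 < k) (hα : α ≤ 1) (hβ : β ≤ 1)
    (hdeg : Degenerate k α β) :
    (α = 0 ∧ β = 0) ∨ (α = 1 ∧ β = 0 ∧ Odd k) ∨ (α = 1 ∧ β = 1 ∧ Even k) := by
  obtain ⟨u, ⟨i, hi, hne⟩, h0, hs, hl⟩ := exists_kernel_sequence hk hdeg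
  have all0 : ∀ d : ℤ, (∀ i, i + 2 < k → u (i + 2) = d * u i) → u 0 = 0 → u 1 = 0 → False := by
    intro d hd z0 z1
    rcases Nat.even_or_odd' i with ⟨j, rfl | rfl⟩
    · exact hne (by rw [(two_step_recursion hd j).1 hi, z0, mul_zero])
    · exact hne (by rw [(two_step_recursion hd j).2 hi, z1, mul_zero])
  by_contra hcon
  have hp : ∀ j : ℕ, ((-1 : ℤ)) ^ j ≠ 0 := fun j => by positivity
  interval_cases α <;> interval_cases β
  · simp at hcon
  · norm_num at h0 hs hl
    -- Here u has period 2 and u 0 = u 1, so the last row reads 2 u 0 = 0 for either parity of k,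
    -- and the kernel is trivial.
    have hd : ∀ i, i + 2 < k → u (i + 2) = 1 * u i := fun i hi => by linarith [hs i hi]
    have z : u 0 = 0 := by
      rcases Nat.even_or_odd' k with ⟨m, rfl | rfl⟩
      · have e1 := (two_step_recursion hd (m - 1)).1 (by omega)
        have e2 := (two_step_recursion hd (m - 1)).2 (by omega)
        rw [show 2 * m - 2 = 2 * (m - 1) by omega, show 2 * m - 1 = 2 * (m - 1) + 1 by omega] at hl
        rw [one_pow] at e1 e2
        omega
      · have e1 := (two_step_recursion hd m).1 (by omega)
        have e2 := (two_step_recursion hd (m - 1)).2 (by omega)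
        rw [show 2 * m + 1 - 2 = 2 * (m - 1) + 1 by omega, show 2 * m + 1 - 1 = 2 * m by omega] at hl
        rw [one_pow] at e1 e2
        omega
    exact all0 1 hd z (by omega)
  · norm_num at h0 hs hl hcon
    have hd : ∀ i, i + 2 < k → u (i + 2) = -1 * u i := fun i hi => by linarith [hs i hi]
    obtain ⟨m, hm⟩ := hcon
    -- For even k the last row becomes ±(u 0 + u 1) = 0, while the first gives u 0 = u 1.
    have e1 := (two_step_recursion hd (m - 1)).1 (by omega)
    have e2 := (two_step_recursion hd (m - 1)).2 (by omega)
    rw [show k - 2 = 2 * (m - 1) by omega, show k - 1 = 2 * (m - 1) + 1 by omega, e1, e2,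
      ← mul_add] at hl
    have := (mul_eq_zero.1 hl).resolve_left (hp _)
    exact all0 _ hd (by omega) (by omega)
  · norm_num at h0 hs hl hcon
    have hd : ∀ i, i + 2 < k → u (i + 2) = -1 * u i := fun i hi => by linarith [hs i hi]
    obtain ⟨m, hm⟩ := hcon
    -- For odd k the last row becomes ±(u 1 - u 0) = 0, while the first gives u 0 + u 1 = 0.
    have e1 := (two_step_recursion hd m).1 (by omega)
    have e2 := (two_step_recursion hd (m - 1)).2 (by omega)
    have hmm : (-1 : ℤ) ^ m = (-1) ^ (m - 1) * (-1) := by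
      rw [← pow_succ]; congr 1; omega
    rw [show k - 2 = 2 * (m - 1) + 1 by omega, show k - 1 = 2 * m by omega, e1, e2, hmm, mul_assoc,
      ← mul_add] at hl
    have := (mul_eq_zero.1 hl).resolve_left (hp _)
    exact all0 _ hd (by omega) (by omega)

/-- This sign identity is the only form in which degeneracy enters the construction: it makes the
relation on (0, a) a consequence of the others. -/
lemma pow_sign_of_cases {k α β : ℕ} (hk : 1 < k)
    (h : (α = 0 ∧ β = 0) ∨ (α = 1 ∧ β = 0 ∧ Odd k) ∨ (α = 1 ∧ β = 1 ∧ Even k)) :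
    (-1 : ℂ) ^ α = (-1) ^ β * ((-1) ^ α) ^ (k - 2) := by
  rcases h with ⟨rfl, rfl⟩ | ⟨rfl, rfl, h⟩ | ⟨rfl, rfl, h⟩
  · simp
  · have : Odd (k - 2) := by obtain ⟨m, hm⟩ := h; exact ⟨m - 1, by omega⟩
    simp [this.neg_one_pow]
  · have : Even (k - 2) := by obtain ⟨m, hm⟩ := h; exact ⟨m - 1, by omega⟩
    simp [this.neg_one_pow]


/-! ### The relations between W and q, and their homogeneous solutions -/

lemma ae_const_sub {P : ℝ → Prop} (h : ∀ᵐ x, P x) (c : ℝ) : ∀ᵐ x, P (c - x) :=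
  (Measure.measurePreserving_sub_left volume c).quasiMeasurePreserving.ae h

lemma ae_const_add {P : ℝ → Prop} (h : ∀ᵐ x, P x) (c : ℝ) : ∀ᵐ x, P (c + x) :=
  (measurePreserving_add_left volume c).quasiMeasurePreserving.ae h

section relations
variable {k : ℕ} (hk : 1 < k) {α β : ℕ} (q : ℝ → ℂ)
include hk

lemma natCast_mul_pt : (k : ℝ) * pt k = Real.pi := by
  have : (k : ℝ) ≠ 0 := by exact_mod_cast (by omega : k ≠ 0)
  unfold pt; field_simp

/-- On each of the ranges (π - a, π), (a, π - a) and (0, a) of the argument of W two of the four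
terms of `mainW` vanish, their arguments lying outside (0, π). This lemma and the next two treat
these ranges. -/
lemma mainW_right {x : ℝ} (hx : x ∈ Set.Ioo 0 (pt k)) :
    -2 * mainW k α β q (Real.pi - x) = q (pt k + x) + q (pt k - x) := by
  obtain ⟨h0, h1⟩ := hx
  have h2 := two_pt_le hk
  unfold mainW
  rw [ext0_of_nonpos (x := Real.pi - pt k - (Real.pi - x)) (by linarith),
    ext0_of_ge (x := Real.pi - x + (Real.pi - pt k)) (by linarith),
    show Real.pi - x - (Real.pi - pt k) = pt k - x by ring,
    show Real.pi + pt k - (Real.pi - x) = pt k + x by ring,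
    ext0_of_mem (by linarith) (by linarith)]
  by_cases h : pt k + x < Real.pi
  · rw [ext0_of_mem (by linarith) h]; ring
  · exact absurd (by linarith) h

lemma mainW_middle {x : ℝ} (h0 : 2 * pt k < x) (h1 : x < Real.pi) :
    -2 * mainW k α β q (Real.pi + pt k - x) = q x - (-1) ^ α * q (x - 2 * pt k) := by
  have ha := pt_pos hk
  unfold mainW
  rw [ext0_of_nonpos (x := Real.pi + pt k - x - (Real.pi - pt k)) (by linarith),
    ext0_of_ge (x := Real.pi + pt k - x + (Real.pi - pt k)) (by linarith),
    show Real.pi - pt k - (Real.pi + pt k - x) = x - 2 * pt k by ring,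
    show Real.pi + pt k - (Real.pi + pt k - x) = x by ring,
    ext0_of_mem (by linarith) (by linarith), ext0_of_mem (by linarith) (by linarith)]
  ring

lemma mainW_left {x : ℝ} (hx : x ∈ Set.Ioo 0 (pt k)) :
    2 * mainW k α β q x =
      (-1) ^ α * q (Real.pi - pt k - x) + (-1) ^ β * q (Real.pi - pt k + x) := by
  obtain ⟨h0, h1⟩ := hx
  have h2 := two_pt_le hk
  unfold mainW
  rw [ext0_of_nonpos (x := x - (Real.pi - pt k)) (by linarith),
    ext0_of_ge (x := Real.pi + pt k - x) (by linarith),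
    ext0_of_mem (by linarith) (by linarith), ext0_of_mem (by linarith) (by linarith), add_comm x]
  ring

end relations

/-- The homogeneous relations between the values of a potential in neighbouring intervals. -/
def IsHomogeneous (k α : ℕ) (r : ℝ → ℂ) : Prop :=
  (∀ᵐ x, x ∈ Set.Ioo 0 (pt k) → r (pt k + x) + r (pt k - x) = 0) ∧
  (∀ j : ℕ, 2 ≤ j → j ≤ k - 1 → ∀ᵐ x, x ∈ Set.Ioo (j * pt k) ((j + 1) * pt k) →
    r x = (-1) ^ α * r (x - 2 * pt k))

/-- A homogeneous potential is odd or even about each of the points `j π / k`. -/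
lemma IsHomogeneous.reflect {k α : ℕ} {r : ℝ → ℂ} (h : IsHomogeneous k α r) (i : ℕ)
    (hi : i + 1 ≤ k - 1) : ∀ᵐ x, x ∈ Set.Ioo 0 (pt k) →
      r ((i + 1) * pt k + x) = -((-1) ^ α) ^ i * r ((i + 1) * pt k - x) := by
  induction i with
  | zero =>
    filter_upwards [h.1] with x hx hm
    have := hx hm
    simp only [Nat.cast_zero, zero_add, one_mul, pow_zero]
    linear_combination this
  | succ i ih =>
    -- The shift relation carries a point right of (i + 2)a back by 2a, and the reflection about (i
    -- + 1)a, applied at a - x, carries it to the point left of (i + 2)a.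
    have h2 := ae_const_add (h.2 (i + 2) (by omega) hi) ((i + 2) * pt k)
    have h1 := ae_const_sub (ih (by omega)) (pt k)
    filter_upwards [h1, h2] with x h1 h2 hm
    have h1 := h1 ⟨by linarith [hm.2], by linarith [hm.1]⟩
    have h2 := h2 ⟨by push_cast; linarith [hm.1], by push_cast; linarith [hm.2]⟩
    rw [show ((i : ℝ) + 1) * pt k + (pt k - x) = (((i + 1 : ℕ) : ℝ) + 1) * pt k - x by
      push_cast; ring] at h1
    rw [show ((i : ℝ) + 2) * pt k + x = (((i + 1 : ℕ) : ℝ) + 1) * pt k + x by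
      push_cast; ring] at h2
    rw [h2, h1, show (((i + 1 : ℕ) : ℝ) + 1) * pt k + x - 2 * pt k =
      ((i : ℝ) + 1) * pt k - (pt k - x) by push_cast; ring]
    have hd : (((-1 : ℂ) ^ α) ^ i) * (((-1 : ℂ) ^ α) ^ i) = 1 := by
      rw [← mul_pow, ← mul_pow]; simp
    rw [pow_succ]
    linear_combination (-(-1) ^ α * r ((i + 1) * pt k - (pt k - x))) * hd

/-- The open interval `(0, π)` is, up to a null set, the union of the intervals
`(j π / k, (j + 1) π / k)`. -/
lemma ae_exists_mem_Ioo {k : ℕ} (hk : 1 < k) : ∀ᵐ x, x ∈ Set.Ioo 0 Real.pi →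
    ∃ j < k, x ∈ Set.Ioo (j * pt k) ((j + 1) * pt k) := by
  have ha := pt_pos hk
  have hc : ∀ᵐ x : ℝ, ∀ j : ℕ, x ≠ j * pt k :=
    ae_all_iff.2 fun j => compl_mem_ae_iff.2 (measure_singleton _)
  filter_upwards [hc] with x hx hm
  have h0 : 0 ≤ x / pt k := div_nonneg hm.1.le ha.le
  refine ⟨⌊x / pt k⌋₊, ?_, ?_, ?_⟩
  · rw [Nat.floor_lt h0, div_lt_iff₀ ha, natCast_mul_pt hk]; exact hm.2
  · exact lt_of_le_of_ne ((le_div_iff₀ ha).1 (Nat.floor_le h0)) (hx _).symm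
  · exact (div_lt_iff₀ ha).1 (Nat.lt_floor_add_one _)

lemma isHomogeneous_of_mainW {k α : ℕ} {W q₀ q : ℝ → ℂ}
    (h1 : ∀ᵐ x, x ∈ Set.Ioo 0 (pt k) → q (pt k - x) = -2 * W (Real.pi - x) - q (pt k + x))
    (h2 : ∀ j : ℕ, 2 ≤ j → j ≤ k - 1 → ∀ᵐ x, x ∈ Set.Ioo (j * pt k) ((j + 1) * pt k) →
      q x = -2 * W (Real.pi + pt k - x) + (-1) ^ α * q (x - 2 * pt k))
    (h1' : ∀ᵐ x, x ∈ Set.Ioo 0 (pt k) → q₀ (pt k - x) = -2 * W (Real.pi - x) - q₀ (pt k + x))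
    (h2' : ∀ j : ℕ, 2 ≤ j → j ≤ k - 1 → ∀ᵐ x, x ∈ Set.Ioo (j * pt k) ((j + 1) * pt k) →
      q₀ x = -2 * W (Real.pi + pt k - x) + (-1) ^ α * q₀ (x - 2 * pt k)) :
    IsHomogeneous k α (fun x => q x - q₀ x) := by
  constructor
  · filter_upwards [h1, h1'] with x h h' hm
    linear_combination h hm - h' hm
  · intro j hj hj'
    filter_upwards [h2 j hj hj', h2' j hj hj'] with x h h' hm
    linear_combination h hm - h' hm

/-- Potentials that differ by a homogeneous one have the same `W`. -/
lemma mainW_ae_eq_of_isHomogeneous {k α β : ℕ} (hk : 1 < k)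
    (hs : (-1 : ℂ) ^ α = (-1) ^ β * ((-1) ^ α) ^ (k - 2)) {q q₀ : ℝ → ℂ}
    (h : IsHomogeneous k α (fun x => q x - q₀ x)) :
    ∀ᵐ x, x ∈ Set.Ioo 0 Real.pi → mainW k α β q x = mainW k α β q₀ x := by
  have ha := pt_pos hk
  have hπ := natCast_mul_pt hk
  have hr := ae_const_sub h.1 Real.pi
  have hm := ae_const_sub (ae_all_iff.2 fun j => Filter.eventually_imp_distrib_left.2 fun hj =>
    Filter.eventually_imp_distrib_left.2 fun hj' => h.2 j hj hj') (Real.pi + pt k)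
  -- The reflection with this index is centred at (k - 1)a = π - a. With `hs` it yields the relation
  -- on (0, a), which is not part of `IsHomogeneous`.
  have hl := h.reflect (k - 2) (by omega)
  have hcov := ae_const_sub (ae_exists_mem_Ioo hk) (Real.pi + pt k)
  have hne1 : ∀ᵐ x : ℝ, x ≠ pt k := compl_mem_ae_iff.2 (measure_singleton _)
  have hne2 : ∀ᵐ x : ℝ, x ≠ Real.pi - pt k := compl_mem_ae_iff.2 (measure_singleton _)
  have hk2 : ((k - 2 : ℕ) : ℝ) + 1 = k - 1 := by
    rw [Nat.cast_sub (by omega)]; push_cast; ring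
  rw [hk2, sub_one_mul, hπ] at hl
  filter_upwards [hr, hm, hl, hcov, hne1, hne2] with x hr hm hl hcov hne1 hne2 hx
  rcases lt_or_gt_of_ne hne1 with hxa | hxa
  · have hl := hl ⟨hx.1, hxa⟩
    have e1 := mainW_left (α := α) (β := β) hk q ⟨hx.1, hxa⟩
    have e2 := mainW_left (α := α) (β := β) hk q₀ ⟨hx.1, hxa⟩
    linear_combination (1 / 2) * e1 - (1 / 2) * e2 + (1 / 2) * (-1) ^ β * hl +
      (1 / 2) * (q (Real.pi - pt k - x) - q₀ (Real.pi - pt k - x)) * hs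
  · rcases lt_or_gt_of_ne hne2 with hxb | hxb
    · obtain ⟨j, hj, hmem⟩ := hcov ⟨by linarith [hx.2], by linarith⟩
      have hj2 : 2 ≤ j := by
        by_contra hcon
        have : (j : ℝ) ≤ 1 := by exact_mod_cast (by omega : j ≤ 1)
        nlinarith [hmem.2]
      have e := hm j hj2 (by omega) hmem
      have e1 := mainW_middle (x := Real.pi + pt k - x) (α := α) (β := β) hk q
        (by linarith) (by linarith)
      have e2 := mainW_middle (x := Real.pi + pt k - x) (α := α) (β := β) hk q₀
        (by linarith) (by linarith)
      rw [sub_sub_cancel] at e1 e2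
      linear_combination (-1 / 2) * e1 + (1 / 2) * e2 - (1 / 2) * e
    · have hmem : Real.pi - x ∈ Set.Ioo 0 (pt k) := ⟨by linarith [hx.2], by linarith⟩
      have e := hr hmem
      have e1 := mainW_right (α := α) (β := β) hk q hmem
      have e2 := mainW_right (α := α) (β := β) hk q₀ hmem
      rw [sub_sub_cancel] at e1 e2
      linear_combination (-1 / 2) * e1 + (1 / 2) * e2 - (1 / 2) * e

lemma mainWLp_eq_of_isHomogeneous {k α β : ℕ} (hk : 1 < k)
    (hs : (-1 : ℂ) ^ α = (-1) ^ β * ((-1) ^ α) ^ (k - 2)) {q q₀ : L2 Real.pi}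
    (h : IsHomogeneous k α (fun x => q x - q₀ x)) : mainWLp k α β q = mainWLp k α β q₀ := by
  refine Lp.ext ?_
  rw [Filter.EventuallyEq, ae_restrict_iff' measurableSet_Ioo]
  filter_upwards [mainW_ae_eq_of_isHomogeneous hk hs h, mainWLp_coe k α β q, mainWLp_coe k α β q₀]
    with x h1 h2 h3 hm
  rw [h2 hm, h3 hm, h1 hm]

/-- Every potential satisfies the relations of the algorithm with its own `W`. -/
lemma mainWLp_right {k : ℕ} (hk : 1 < k) (α β : ℕ) (q : L2 Real.pi) :
    ∀ᵐ x, x ∈ Set.Ioo 0 (pt k) →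
      q (pt k - x) = -2 * mainWLp k α β q (Real.pi - x) - q (pt k + x) := by
  filter_upwards [ae_const_sub (mainWLp_coe k α β q) Real.pi] with x h hm
  have h2 := two_pt_le hk
  rw [h ⟨by linarith [hm.2, pt_pos hk], by linarith [hm.1]⟩, mainW_right hk _ hm]; ring

lemma mainWLp_middle {k : ℕ} (hk : 1 < k) (α β : ℕ) (q : L2 Real.pi) (j : ℕ) (hj : 2 ≤ j)
    (hj' : j ≤ k - 1) : ∀ᵐ x, x ∈ Set.Ioo (j * pt k) ((j + 1) * pt k) →
      q x = -2 * mainWLp k α β q (Real.pi + pt k - x) + (-1) ^ α * q (x - 2 * pt k) := by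
  filter_upwards [ae_const_sub (mainWLp_coe k α β q) (Real.pi + pt k)] with x h hm
  have ha := pt_pos hk
  have h1 : 2 * pt k < x := lt_of_le_of_lt (by gcongr; exact_mod_cast hj) hm.1
  have h2 : x < Real.pi := hm.2.trans_le (by
    rw [← natCast_mul_pt hk]; gcongr; exact_mod_cast (by omega : j + 1 ≤ k))
  rw [h ⟨by linarith, by linarith⟩, mainW_middle hk _ h1 h2]; ring

lemma memLp_comp_pt_add {k : ℕ} (q : L2 Real.pi) :
    MemLp (fun x => ext0 q (pt k + x)) 2 (volume.restrict (Set.Ioo 0 (pt k))) :=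
  ((memLp_ext0 (Lp.memLp q)).comp_measurePreserving
    (measurePreserving_add_left volume (pt k))).restrict _

lemma memLp_comp_pt_sub {k : ℕ} (q : L2 Real.pi) :
    MemLp (fun x => ext0 q (pt k - x)) 2 (volume.restrict (Set.Ioo 0 (pt k))) :=
  ((memLp_ext0 (Lp.memLp q)).comp_measurePreserving
    (Measure.measurePreserving_sub_left volume (pt k))).restrict _

/-- A constant operator prescribes the potential on `(0, π / k)`. -/
lemma isConstructed_constOp_iff {k : ℕ} (hk : 1 < k) (α : ℕ) (p : L2 (pt k)) (W q : L2 Real.pi) :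
    IsConstructed k α (constOp k p) W q ↔
      (∀ᵐ x, x ∈ Set.Ioo 0 (pt k) → q (pt k - x) = p x) ∧
      (∀ᵐ x, x ∈ Set.Ioo 0 (pt k) → q (pt k - x) = -2 * W (Real.pi - x) - q (pt k + x)) ∧
      (∀ j : ℕ, 2 ≤ j → j ≤ k - 1 → ∀ᵐ x, x ∈ Set.Ioo (j * pt k) ((j + 1) * pt k) →
        q x = -2 * W (Real.pi + pt k - x) + (-1) ^ α * q (x - 2 * pt k)) := by
  simp only [IsConstructed, constOp, ae_restrict_iff' measurableSet_Ioo]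
  refine ⟨fun ⟨⟨f, hf, hq⟩, h1, h2⟩ => ⟨?_, h1, h2⟩, fun ⟨hp, h1, h2⟩ => ⟨?_, h1, h2⟩⟩
  -- The function f is -2W(π - ·) - p and equals q(a + ·), so the values left for q(a - ·) are those
  -- of p.
  · filter_upwards [hf, hq, h1, (ae_restrict_iff' measurableSet_Ioo).1 (Lp.coeFn_add f p)]
      with x hf hq h1 hadd hm
    have e := hf hm
    rw [hadd hm, Pi.add_apply] at e
    rw [h1 hm, hq hm]
    linear_combination -e
  · have hc := (ae_restrict_iff' measurableSet_Ioo).1 (memLp_comp_pt_add (k := k) q).coeFn_toLp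
    have e : ∀ x ∈ Set.Ioo 0 (pt k), ext0 q (pt k + x) = q (pt k + x) := fun x hx =>
      ext0_of_mem (by linarith [hx.1, pt_pos hk]) (by linarith [hx.2, two_pt_le hk])
    refine ⟨(memLp_comp_pt_add q).toLp _, ?_, ?_⟩
    · filter_upwards [hp, h1, hc, (ae_restrict_iff' measurableSet_Ioo).1
        (Lp.coeFn_add ((memLp_comp_pt_add (k := k) q).toLp _) p)] with x hp h1 hc hadd hm
      rw [hadd hm, Pi.add_apply, hc hm, e x hm]
      linear_combination h1 hm - hp hm
    · filter_upwards [hc] with x hc hm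
      rw [hc hm, e x hm]

/-- Two homogeneous potentials that agree on `(0, π / k)` are equal. -/
lemma IsHomogeneous.ae_eq_zero {k α : ℕ} (hk : 1 < k) {r : ℝ → ℂ} (h : IsHomogeneous k α r)
    (h0 : ∀ᵐ x, x ∈ Set.Ioo 0 (pt k) → r (pt k - x) = 0) :
    ∀ᵐ x, x ∈ Set.Ioo 0 Real.pi → r x = 0 := by
  have key : ∀ j : ℕ, j < k → ∀ᵐ x, x ∈ Set.Ioo (j * pt k) ((j + 1) * pt k) → r x = 0 := by
    intro j
    induction j using Nat.strong_induction_on with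
    | _ j ih =>
      intro hj
      rcases Nat.lt_or_ge j 2 with hj2 | hj2
      · interval_cases j
        · filter_upwards [ae_const_sub h0 (pt k)] with x hx hm
          norm_num at hm
          simpa using hx ⟨by linarith, by linarith⟩
        · filter_upwards [ae_const_add h0 (-pt k), ae_const_add h.1 (-pt k)] with x hx hx' hm
          norm_num at hm
          have e1 := hx ⟨by linarith, by linarith⟩
          have e2 := hx' ⟨by linarith, by linarith⟩
          rw [e1, add_zero] at e2
          simpa using e2
      · filter_upwards [h.2 j hj2 (by omega), ae_const_add (ih (j - 2) (by omega) (by omega))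
          (-(2 * pt k))] with x hx hx' hm
        rw [Nat.cast_sub hj2] at hx'
        rw [hx hm, show x - 2 * pt k = -(2 * pt k) + x by ring, hx', mul_zero]
        constructor <;> push_cast <;> linarith [hm.1, hm.2]
  have hall : ∀ᵐ x, ∀ j : ℕ, j < k → x ∈ Set.Ioo (j * pt k) ((j + 1) * pt k) → r x = 0 :=
    ae_all_iff.2 fun j => Filter.eventually_imp_distrib_left.2 fun hj => key j hj
  filter_upwards [hall, ae_exists_mem_Ioo hk] with x h1 h2 hm
  obtain ⟨j, hj, hmem⟩ := h2 hm
  exact h1 j hj hmem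

/-- A homogeneous potential with given values on `(0, π / k)`. -/
lemma exists_isHomogeneous {k : ℕ} (hk : 1 < k) (α : ℕ) {h : ℝ → ℂ}
    (hh : MemLp h 2 (volume.restrict (Set.Ioo 0 (pt k)))) :
    ∃ r : ℝ → ℂ, MemLp r 2 volume ∧ IsHomogeneous k α r ∧
      ∀ x ∈ Set.Ioo 0 (pt k), r x = h x := by
  have ha := pt_pos hk
  have hπ := natCast_mul_pt hk
  set H : ℝ → ℂ := (Set.Ioo 0 (pt k)).indicator h with hH
  have hHm : MemLp H 2 volume := (memLp_indicator_iff_restrict measurableSet_Ioo).2 hh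
  have H0 : ∀ x, x ≤ 0 → H x = 0 := fun x hx =>
    Set.indicator_of_notMem (fun hm => absurd hm.1 (not_lt.2 hx)) h
  have H1 : ∀ x, pt k ≤ x → H x = 0 := fun x hx =>
    Set.indicator_of_notMem (fun hm => absurd hm.2 (not_lt.2 hx)) h
  -- The given function is continued to (0, 2a) as an odd function about a.
  set G : ℝ → ℂ := fun x => H x - H (2 * pt k - x) with hG
  have hGm : MemLp G 2 volume :=
    hHm.sub (hHm.comp_measurePreserving (Measure.measurePreserving_sub_left volume (2 * pt k)))
  have G0 : ∀ x, x ≤ 0 → G x = 0 := fun x hx => by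
    simp only [hG]; rw [H0 x hx, H1 _ (by linarith), sub_zero]
  have G1 : ∀ x, 2 * pt k ≤ x → G x = 0 := fun x hx => by
    simp only [hG]; rw [H1 x (by linarith), H0 _ (by linarith), sub_zero]
  -- Repeating G with period 2a up to the sign (-1)^α solves the shift relations; k copies more than
  -- cover (0, π).
  set r : ℝ → ℂ := fun x => ∑ i ∈ Finset.range k, ((-1) ^ α) ^ i * G (x - i * (2 * pt k)) with hr
  have rG : ∀ x, x ≤ 2 * pt k → r x = G x := fun x hx => by
    simp only [hr]
    rw [Finset.sum_eq_single_of_mem 0 (Finset.mem_range.2 (by omega))]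
    · simp
    · intro i _ hi
      have : (1 : ℝ) ≤ i := by exact_mod_cast Nat.one_le_iff_ne_zero.2 hi
      rw [G0 _ (by nlinarith), mul_zero]
  refine ⟨r, ?_, ⟨?_, ?_⟩, ?_⟩
  · refine memLp_finsetSum _ fun i _ => MemLp.const_mul ?_ _
    exact hGm.comp_measurePreserving (measurePreserving_sub_right volume (i * (2 * pt k)))
  · refine Filter.Eventually.of_forall fun x hx => ?_
    rw [rG _ (by linarith [hx.2]), rG _ (by linarith [hx.1])]
    simp only [hG]
    rw [show 2 * pt k - (pt k + x) = pt k - x by ring, show 2 * pt k - (pt k - x) = pt k + x by ring]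
    ring
  · intro j hj hj'
    refine Filter.Eventually.of_forall fun x hx => ?_
    have h2 : 2 * pt k ≤ x := (lt_of_le_of_lt (by gcongr; exact_mod_cast hj) hx.1).le
    have h3 : x < k * pt k := hx.2.trans_le (by
      gcongr; exact_mod_cast (by omega : j + 1 ≤ k))
    obtain ⟨m, rfl⟩ : ∃ m, k = m + 1 := ⟨k - 1, by omega⟩
    simp only [hr]
    -- The two sums agree after an index shift, up to the first term of one and the last of the
    -- other; both vanish because G is supported in [0, 2a].
    rw [Finset.sum_range_succ', Finset.sum_range_succ]
    have z1 : G (x - ((0 : ℕ) : ℝ) * (2 * pt (m + 1))) = 0 := G1 _ (by simpa using h2)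
    have z2 : G (x - 2 * pt (m + 1) - (m : ℝ) * (2 * pt (m + 1))) = 0 := by
      refine G0 _ ?_
      push_cast at h3
      nlinarith [(Nat.cast_nonneg m : (0 : ℝ) ≤ m)]
    rw [z1, z2, mul_zero, mul_zero, add_zero, add_zero, Finset.mul_sum]
    refine Finset.sum_congr rfl fun i _ => ?_
    rw [show x - ((i + 1 : ℕ) : ℝ) * (2 * pt (m + 1)) =
      x - 2 * pt (m + 1) - (i : ℝ) * (2 * pt (m + 1)) by push_cast; ring, pow_succ]
    ring
  · intro x hx
    rw [rG x (by linarith [hx.2])]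
    simp only [hG]
    rw [H1 (2 * pt k - x) (by linarith [hx.2]), sub_zero, hH, Set.indicator_of_mem hx]


/-! ### Division by zeros, the argument principle and Rouché's theorem -/

lemma analyticOrderAt_const_sub (c w : ℂ) :
    analyticOrderAt (fun z => c - z) w = if c = w then 1 else 0 := by
  have ha : AnalyticAt ℂ (fun z : ℂ => c - z) w := by fun_prop
  split_ifs with h
  · have : ((1 : ℕ) : ℕ∞) = 1 := rfl
    rw [← this, ha.analyticOrderAt_eq_natCast]
    refine ⟨fun _ => -1, analyticAt_const, by simp, Filter.Eventually.of_forall fun z => ?_⟩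
    simp [h]
  · rw [ha.analyticOrderAt_eq_zero]
    exact sub_ne_zero.2 h

lemma analyticOrderAt_prod_const_sub {ι : Type*} [DecidableEq ι] (S : Finset ι) (a : ι → ℂ) (w : ℂ) :
    analyticOrderAt (fun z => ∏ i ∈ S, (a i - z)) w = ((S.filter fun i => a i = w).card : ℕ∞) := by
  induction S using Finset.induction_on with
  | empty => simp [AnalyticAt.analyticOrderAt_eq_zero analyticAt_const]
  | insert i S hi ih =>
    have h1 : AnalyticAt ℂ (fun z : ℂ => a i - z) w := by fun_prop
    have h2 : AnalyticAt ℂ (fun z : ℂ => ∏ i ∈ S, (a i - z)) w := by fun_prop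
    have e : (fun z => ∏ j ∈ insert i S, (a j - z)) =
        (fun z => a i - z) * fun z => ∏ j ∈ S, (a j - z) := by
      ext z; simp [Finset.prod_insert hi]
    rw [e, analyticOrderAt_mul h1 h2, ih, analyticOrderAt_const_sub, Finset.filter_insert]
    split_ifs with h
    · rw [Finset.card_insert_of_notMem (by simp [hi])]; push_cast; ring
    · simp

/-- An entire function can be divided by linear factors at its zeros. -/
lemma exists_eq_prod_mul {ι : Type*} [DecidableEq ι] {D : ℂ → ℂ} (hD : Differentiable ℂ D)
    (S : Finset ι) (a : ι → ℂ)
    (h : ∀ w, ((S.filter fun i => a i = w).card : ℕ∞) ≤ analyticOrderAt D w) :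
    ∃ H : ℂ → ℂ, Differentiable ℂ H ∧ ∀ z, D z = (∏ i ∈ S, (a i - z)) * H z := by
  induction S using Finset.induction_on with
  | empty => exact ⟨D, hD, by simp⟩
  | insert i S hi ih =>
    obtain ⟨H, hH, e⟩ := ih fun w => le_trans (by
      exact_mod_cast Finset.card_le_card (Finset.filter_subset_filter _ (Finset.subset_insert _ _)))
      (h w)
    -- Otherwise the order of D at `a i` would be the count over S alone, one less than required.
    have h0 : H (a i) = 0 := by
      by_contra hne
      have h1 := h (a i)
      have e' : D = (fun z => ∏ j ∈ S, (a j - z)) * H := by ext z; simp [e]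
      rw [e', analyticOrderAt_mul (by fun_prop) (hH.analyticAt _), analyticOrderAt_prod_const_sub,
        (hH.analyticAt (a i)).analyticOrderAt_eq_zero.2 hne, add_zero, Finset.filter_insert,
        if_pos rfl, Finset.card_insert_of_notMem (by simp [hi])] at h1
      have := Nat.cast_le.1 h1
      omega
    refine ⟨fun z => -dslope H (a i) z, (differentiable_dslope hH _).neg, fun z => ?_⟩
    have h1 := sub_smul_dslope H (a i) z
    rw [h0, sub_zero, smul_eq_mul] at h1
    rw [Finset.prod_insert hi, e, ← h1]
    ring

/-- The zeros of `D` in the set `U` are `a i`, `i ∈ S`, with multiplicities. -/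
lemma exists_eq_prod_mul_ne_zero {ι : Type*} [DecidableEq ι] {D : ℂ → ℂ} (hD : Differentiable ℂ D)
    {S : Finset ι} {a : ι → ℂ} {U : Set ℂ} (hS : ∀ i ∈ S, a i ∈ U)
    (h : ∀ w ∈ U, ((S.filter fun i => a i = w).card : ℕ∞) = analyticOrderAt D w) :
    ∃ H : ℂ → ℂ, Differentiable ℂ H ∧ (∀ z, D z = (∏ i ∈ S, (a i - z)) * H z) ∧
      ∀ w ∈ U, H w ≠ 0 := by
  obtain ⟨H, hH, e⟩ := exists_eq_prod_mul hD S a fun w => by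
    by_cases hw : w ∈ U
    · exact (h w hw).le
    · rw [Finset.filter_false_of_mem fun i hi (hiw : a i = w) => hw (hiw ▸ hS i hi)]; simp
  refine ⟨H, hH, e, fun w hw => ?_⟩
  have e' : D = (fun z => ∏ j ∈ S, (a j - z)) * H := by ext z; simp [e]
  have h1 := h w hw
  rw [e', analyticOrderAt_mul (by fun_prop) (hH.analyticAt _), analyticOrderAt_prod_const_sub] at h1
  rw [← (hH.analyticAt w).analyticOrderAt_eq_zero]
  -- Cancellation in `ℕ∞` is allowed because the common summand is finite.
  have h2 : (((S.filter fun i => a i = w).card : ℕ) : ℕ∞) + 0 =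
    ((S.filter fun i => a i = w).card : ℕ) + analyticOrderAt H w := by rw [add_zero]; exact h1
  exact ((ENat.addLECancellable_natCast _).inj.1 h2).symm

lemma logDeriv_prod_const_sub_mul {ι : Type*} {S : Finset ι} {a : ι → ℂ} {F : ℂ → ℂ}
    (hF : Differentiable ℂ F) {z : ℂ} (hz : ∀ i ∈ S, a i ≠ z) (hFz : F z ≠ 0) :
    logDeriv (fun z => (∏ i ∈ S, (a i - z)) * F z) z =
      ∑ i ∈ S, (z - a i)⁻¹ + logDeriv F z := by
  have hne : ∀ i ∈ S, a i - z ≠ 0 := fun i hi => sub_ne_zero.2 (hz i hi)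
  rw [logDeriv_mul z (Finset.prod_ne_zero_iff.2 hne) hFz (by fun_prop) (hF z),
    logDeriv_prod hne (fun i _ => by fun_prop)]
  congr 1
  refine Finset.sum_congr rfl fun i hi => ?_
  rw [logDeriv_apply, deriv_const_sub, deriv_id'', ← neg_sub z, inv_eq_one_div]
  rw [neg_div_neg_eq]

/-- Each linear factor contributes 2πi, and the logarithmic derivative of the zero-free factor is
holomorphic on the closed disc, so its integral vanishes. -/
lemma circleIntegral_logDeriv_prod {ι : Type*} {S : Finset ι} {a : ι → ℂ} {F : ℂ → ℂ}
    (hF : Differentiable ℂ F) {R : ℝ} (hR : 0 < R) (ha : ∀ i ∈ S, a i ∈ Metric.ball (0 : ℂ) R)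
    (hF0 : ∀ z ∈ Metric.closedBall (0 : ℂ) R, F z ≠ 0) :
    CircleIntegrable (logDeriv fun z => (∏ i ∈ S, (a i - z)) * F z) 0 R ∧
    ∮ z in C(0, R), logDeriv (fun z => (∏ i ∈ S, (a i - z)) * F z) z =
      S.card * (2 * Real.pi * Complex.I) := by
  have hne : ∀ i ∈ S, ∀ z ∈ Metric.sphere (0 : ℂ) R, a i ≠ z := fun i hi z hz h => by
    have h1 := mem_ball_zero_iff.1 (ha i hi)
    rw [h, mem_sphere_zero_iff_norm.1 hz] at h1
    exact lt_irrefl _ h1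
  have hFd : DifferentiableOn ℂ (logDeriv F) (Metric.closedBall 0 R) := by
    intro z hz
    have h1 : DifferentiableAt ℂ (deriv F) z := (hF.analyticAt z).deriv.differentiableAt
    exact (h1.div (hF z) (hF0 z hz)).differentiableWithinAt
  have hFc : ContinuousOn (logDeriv F) (Metric.closedBall 0 R) := hFd.continuousOn
  have i1 : CircleIntegrable (logDeriv F) 0 R :=
    (hFc.mono Metric.sphere_subset_closedBall).circleIntegrable hR.le
  have i2 : ∀ i ∈ S, CircleIntegrable (fun z => (z - a i)⁻¹) 0 R := fun i hi => by
    refine ContinuousOn.circleIntegrable hR.le fun z hz => ContinuousAt.continuousWithinAt ?_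
    exact ContinuousAt.inv₀ (by fun_prop) (sub_ne_zero.2 (hne i hi z hz).symm)
  have i3 : CircleIntegrable (fun z => ∑ i ∈ S, (z - a i)⁻¹) 0 R := CircleIntegrable.fun_sum S i2
  have e : Set.EqOn (logDeriv fun z => (∏ i ∈ S, (a i - z)) * F z)
      (fun z => (∑ i ∈ S, (z - a i)⁻¹) + logDeriv F z) (Metric.sphere 0 R) := fun z hz =>
    logDeriv_prod_const_sub_mul hF (fun i hi => hne i hi z hz)
      (hF0 z (Metric.sphere_subset_closedBall hz))
  have hz : ∮ z in C(0, R), logDeriv F z = 0 := by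
    refine Complex.circleIntegral_eq_zero_of_differentiable_on_off_countable hR.le
      Set.countable_empty hFc fun z hz => ?_
    have hz := Metric.ball_subset_closedBall hz.1
    have h1 : DifferentiableAt ℂ (deriv F) z := (hF.analyticAt z).deriv.differentiableAt
    exact h1.div (hF z) (hF0 z hz)
  refine ⟨?_, ?_⟩
  · exact (circleIntegrable_congr (by rwa [abs_of_pos hR])).2 (i3.add i1)
  · rw [circleIntegral.integral_congr hR.le e, circleIntegral.integral_add i3 i1, hz, add_zero,
      circleIntegral.integral_fun_sum i2, Finset.sum_congr rfl fun i hi =>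
        circleIntegral.integral_sub_inv_of_mem_ball (ha i hi)]
    simp

lemma prod_const_sub_ne_zero {ι : Type*} {S : Finset ι} {a : ι → ℂ} {R : ℝ}
    (ha : ∀ i ∈ S, a i ∈ Metric.ball (0 : ℂ) R) {z : ℂ} (hz : z ∈ Metric.sphere (0 : ℂ) R) :
    ∏ i ∈ S, (a i - z) ≠ 0 :=
  Finset.prod_ne_zero_iff.2 fun i hi h => by
    have h1 := mem_ball_zero_iff.1 (ha i hi)
    rw [sub_eq_zero.1 h, mem_sphere_zero_iff_norm.1 hz] at h1
    exact lt_irrefl _ h1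

/-- Rouché's theorem for two entire functions with given factorizations in a disc. -/
lemma card_eq_of_norm_div_sub_one_lt {ι κ : Type*} {S : Finset ι} {T : Finset κ} {a : ι → ℂ}
    {b : κ → ℂ} {F G : ℂ → ℂ} (hF : Differentiable ℂ F) (hG : Differentiable ℂ G) {R : ℝ}
    (hR : 0 < R) (ha : ∀ i ∈ S, a i ∈ Metric.ball (0 : ℂ) R)
    (hb : ∀ i ∈ T, b i ∈ Metric.ball (0 : ℂ) R)
    (hF0 : ∀ z ∈ Metric.closedBall (0 : ℂ) R, F z ≠ 0)
    (hG0 : ∀ z ∈ Metric.closedBall (0 : ℂ) R, G z ≠ 0)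
    (h : ∀ z ∈ Metric.sphere (0 : ℂ) R,
      ‖(∏ i ∈ S, (a i - z)) * F z / ((∏ i ∈ T, (b i - z)) * G z) - 1‖ < 1) :
    S.card = T.card := by
  obtain ⟨iF, eF⟩ := circleIntegral_logDeriv_prod hF hR ha hF0
  obtain ⟨iG, eG⟩ := circleIntegral_logDeriv_prod hG hR hb hG0
  set f : ℂ → ℂ := fun z => (∏ i ∈ S, (a i - z)) * F z with hf
  set g : ℂ → ℂ := fun z => (∏ i ∈ T, (b i - z)) * G z with hg
  have hfd : Differentiable ℂ f := by fun_prop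
  have hgd : Differentiable ℂ g := by fun_prop
  -- On the circle f/g stays within distance 1 of 1, hence in the slit plane, and log (f/g) is a
  -- single-valued primitive of the integrand.
  have key : ∮ z in C(0, R), (logDeriv f z - logDeriv g z) = 0 := by
    refine circleIntegral.integral_eq_zero_of_hasDerivWithinAt (f := fun z => Complex.log (f z / g z))
      hR.le fun z hz => ?_
    have hz' := Metric.sphere_subset_closedBall hz
    have hfz : f z ≠ 0 := mul_ne_zero (prod_const_sub_ne_zero ha hz) (hF0 z hz')
    have hgz : g z ≠ 0 := mul_ne_zero (prod_const_sub_ne_zero hb hz) (hG0 z hz')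
    have hs : f z / g z ∈ Complex.slitPlane := by
      have := Complex.mem_slitPlane_of_norm_lt_one (h z hz)
      simpa using this
    have hd : HasDerivAt (fun z => f z / g z) ((deriv f z * g z - f z * deriv g z) / g z ^ 2) z :=
      (hfd z).hasDerivAt.div (hgd z).hasDerivAt hgz
    refine HasDerivAt.hasDerivWithinAt ?_
    convert! hd.clog hs using 1
    rw [logDeriv_apply, logDeriv_apply]
    field_simp
  rw [circleIntegral.integral_sub iF iG, eF, eG, ← sub_mul, mul_eq_zero] at key
  have := key.resolve_right Complex.two_pi_I_ne_zero
  exact_mod_cast sub_eq_zero.1 this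

/-- An entire function with a nonzero value has finitely many listed zeros in a disc. -/
lemma finite_zeros {D : ℂ → ℂ} (hD : Differentiable ℂ D) {w₀ : ℂ} (h0 : D w₀ ≠ 0) {lam : ℕ → ℂ}
    (hlam : ∀ z, {n : ℕ | 1 ≤ n ∧ lam n = z}.encard = analyticOrderAt D z) (R : ℝ) :
    {n : ℕ | 1 ≤ n ∧ ‖lam n‖ < R}.Finite := by
  have han : AnalyticOnNhd ℂ D Set.univ := fun z _ => hD.analyticAt z
  have hloc : ∀ w, ¬ ∀ᶠ z in nhds w, D z = 0 := fun w hw => by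
    have := han.eq_of_eventuallyEq (g := fun _ => 0) (fun z _ => analyticAt_const) hw
    exact h0 (congrFun this w₀)
  have hfib : ∀ z, {n : ℕ | 1 ≤ n ∧ lam n = z}.Finite := fun z => by
    rw [← Set.encard_ne_top_iff, hlam, Ne, analyticOrderAt_eq_top]
    exact hloc z
  -- Zeros are isolated, so finitely many neighbourhoods, each with at most one zero, cover the
  -- disc; each zero is listed finitely often.
  have hnb : ∀ w ∈ Metric.closedBall (0 : ℂ) R, {z | D z ≠ 0 ∨ z = w} ∈ nhds w := fun w _ => by
    have := ((hD.analyticAt w).eventually_eq_zero_or_eventually_ne_zero).resolve_left (hloc w)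
    rw [eventually_nhdsWithin_iff] at this
    filter_upwards [this] with z hz
    by_cases h : z = w
    · exact Or.inr h
    · exact Or.inl (hz h)
  obtain ⟨t, _, ht⟩ := (isCompact_closedBall (0 : ℂ) R).elim_nhds_subcover _ hnb
  refine (t.finite_toSet.biUnion fun z _ => hfib z).subset fun n hn => ?_
  have hmem : lam n ∈ Metric.closedBall (0 : ℂ) R := mem_closedBall_zero_iff.2 hn.2.le
  obtain ⟨w, hw, hw'⟩ := Set.mem_iUnion₂.1 (ht hmem)
  have hz : D (lam n) = 0 := by
    by_contra hne
    have h1 := hlam (lam n)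
    rw [(hD.analyticAt _).analyticOrderAt_eq_zero.2 hne, Set.encard_eq_zero] at h1
    have : n ∈ (∅ : Set ℕ) := h1 ▸ ⟨hn.1, rfl⟩
    exact this
  exact Set.mem_iUnion₂.2 ⟨w, hw, hn.1, (hw'.resolve_left fun h => h hz)⟩

lemma eq_zero_of_listed {D : ℂ → ℂ} (hD : Differentiable ℂ D) {lam : ℕ → ℂ}
    (hlam : ∀ z, {n : ℕ | 1 ≤ n ∧ lam n = z}.encard = analyticOrderAt D z) {n : ℕ} (hn : 1 ≤ n) :
    D (lam n) = 0 := by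
  by_contra hne
  have h1 := hlam (lam n)
  rw [(hD.analyticAt _).analyticOrderAt_eq_zero.2 hne, Set.encard_eq_zero] at h1
  have : n ∈ (∅ : Set ℕ) := h1 ▸ ⟨hn, rfl⟩
  exact this


/-! ### Lower bounds for the sine -/

lemma norm_sq_sin (w : ℂ) : ‖Complex.sin w‖ ^ 2 = Real.sin w.re ^ 2 + Real.sinh w.im ^ 2 := by
  rw [← Complex.normSq_eq_norm_sq, Complex.normSq_apply]
  have e : Complex.sin w = (Real.sin w.re * Real.cosh w.im : ℝ) +
      (Real.cos w.re * Real.sinh w.im : ℝ) * Complex.I := by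
    conv_lhs => rw [← Complex.re_add_im w]
    rw [Complex.sin_add_mul_I]
    push_cast; ring
  rw [e]
  simp only [Complex.add_re, Complex.ofReal_re, Complex.mul_re, Complex.I_re, mul_zero,
    Complex.ofReal_im, Complex.I_im, mul_one, sub_self, add_zero, Complex.add_im, Complex.mul_im,
    zero_add]
  have h1 := Real.sin_sq_add_cos_sq w.re
  have h2 := Real.cosh_sq w.im
  rw [← h1] at h2
  nlinarith [h1, h2, Real.cosh_sq w.im]

lemma exp_le_two_cosh (u : ℝ) : Real.exp |u| ≤ 2 * Real.cosh u := by
  rw [← Real.cosh_abs, Real.cosh_eq]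
  have := Real.exp_pos (-|u|)
  linarith

/-- With Y = min 1 y, π > 3 gives exp(2πy) ≥ 1 + 6Y. The constant comes from (1 - 6Y/7)(1 + 6Y) ≥ 1
on [0, 1], an equality at both ends. -/
lemma min_mul_exp_le_sinh {y : ℝ} (hy : 0 ≤ y) :
    (3 / 7) * min 1 y * Real.exp (Real.pi * y) ≤ Real.sinh (Real.pi * y) := by
  have hπ := Real.pi_gt_three
  set Y := min 1 y
  have hY0 : 0 ≤ Y := le_min zero_le_one hy
  have hY1 : Y ≤ 1 := min_le_left _ _
  have hYy : Y ≤ y := min_le_right _ _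
  have hE := Real.exp_pos (Real.pi * y)
  have h1 : 1 + 6 * Y ≤ Real.exp (Real.pi * y) * Real.exp (Real.pi * y) := by
    rw [← Real.exp_add]
    have := Real.add_one_le_exp (Real.pi * y + Real.pi * y)
    nlinarith
  rw [Real.sinh_eq, Real.exp_neg]
  have h2 : Real.exp (Real.pi * y) * (Real.exp (Real.pi * y))⁻¹ = 1 := mul_inv_cancel₀ hE.ne'
  have h3 : 1 ≤ (1 - 6 / 7 * Y) * (Real.exp (Real.pi * y) * Real.exp (Real.pi * y)) := by
    have : 1 ≤ (1 - 6 / 7 * Y) * (1 + 6 * Y) := by nlinarith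
    exact this.trans (by gcongr; nlinarith)
  have h4 : (Real.exp (Real.pi * y))⁻¹ ≤ (1 - 6 / 7 * Y) * Real.exp (Real.pi * y) := by
    rw [inv_le_iff_one_le_mul₀ hE]; linarith
  linarith

/-- Lower bound for the sine away from its zeros. -/
lemma le_norm_sin_pi_mul {w : ℂ} {δ : ℝ} (hδ0 : 0 ≤ δ) (hδ1 : δ ≤ 1)
    (h : ∀ m : ℤ, δ ≤ ‖w - m‖) :
    (1 / 5) * δ * Real.exp (Real.pi * |w.im|) ≤ ‖Complex.sin (Real.pi * w)‖ := by
  have hπ := Real.pi_pos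
  have hsq := norm_sq_sin (Real.pi * w)
  have ere : (Real.pi * w : ℂ).re = Real.pi * w.re := by simp
  have eim : (Real.pi * w : ℂ).im = Real.pi * w.im := by simp
  rw [ere, eim] at hsq
  set E := Real.exp (Real.pi * |w.im|) with hE
  have hE0 : 0 < E := Real.exp_pos _
  set m := round w.re
  set X := w.re - m with hX
  have hX2 : |X| ≤ 1 / 2 := abs_sub_round w.re
  have hsin : (2 * |X|) ^ 2 ≤ Real.sin (Real.pi * w.re) ^ 2 := by
    have e : Real.sin (Real.pi * X) = (-1) ^ m * Real.sin (Real.pi * w.re) := by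
      rw [hX, mul_sub, mul_comm Real.pi (m : ℝ), Real.sin_sub_int_mul_pi]
    have e2 : Real.sin (Real.pi * w.re) ^ 2 = Real.sin (Real.pi * |X|) ^ 2 := by
      have h1 : Real.sin (Real.pi * |X|) ^ 2 = Real.sin (Real.pi * X) ^ 2 := by
        rcases abs_choice X with h | h <;> rw [h]
        rw [mul_neg, Real.sin_neg, neg_sq]
      have h2 : ((-1 : ℝ) ^ m) ^ 2 = 1 := by
        rw [← zpow_natCast ((-1 : ℝ) ^ m), ← zpow_mul, mul_comm, zpow_mul]; simp
      rw [h1, e, mul_pow, h2, one_mul]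
    rw [e2]
    have := Real.mul_le_sin (x := Real.pi * |X|) (by positivity) (by nlinarith)
    have h3 : 2 / Real.pi * (Real.pi * |X|) = 2 * |X| := by field_simp
    rw [h3] at this
    gcongr
  have hcosh : E ≤ 2 * Real.cosh (Real.pi * w.im) := by
    have := exp_le_two_cosh (Real.pi * w.im)
    rwa [abs_mul, abs_of_pos hπ] at this
  have hsinh : ((3 / 7) * min 1 |w.im| * E) ^ 2 ≤ Real.sinh (Real.pi * w.im) ^ 2 := by
    have h1 := min_mul_exp_le_sinh (abs_nonneg w.im)
    have h2 : Real.sinh (Real.pi * w.im) ^ 2 = Real.sinh (Real.pi * |w.im|) ^ 2 := by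
      rcases abs_choice w.im with h | h <;> rw [h]
      rw [mul_neg, Real.sinh_neg, neg_sq]
    rw [h2]
    have : 0 ≤ min 1 |w.im| := le_min zero_le_one (abs_nonneg _)
    gcongr
  -- As sin² ≤ 1, |sin w|² = sin² + sinh² is at least sin² cosh²; Jordan's inequality bounds the
  -- sine and E/2 bounds the hyperbolic cosine.
  have b1 : |X| * E ≤ ‖Complex.sin (Real.pi * w)‖ := by
    refine le_of_sq_le_sq ?_ (norm_nonneg _)
    rw [hsq]
    have h1 : (E / 2) ^ 2 ≤ Real.cosh (Real.pi * w.im) ^ 2 := by gcongr; linarith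
    rw [Real.cosh_sq] at h1
    have h2 := Real.sin_sq_le_one (Real.pi * w.re)
    have h3 : (2 * |X|) ^ 2 * (E / 2) ^ 2 ≤ Real.sin (Real.pi * w.re) ^ 2 *
      (Real.sinh (Real.pi * w.im) ^ 2 + 1) := by gcongr
    nlinarith [sq_nonneg (Real.sinh (Real.pi * w.im))]
  have b2 : (3 / 7) * min 1 |w.im| * E ≤ ‖Complex.sin (Real.pi * w)‖ := by
    refine le_of_sq_le_sq ?_ (norm_nonneg _)
    rw [hsq]; nlinarith [sq_nonneg (Real.sin (Real.pi * w.re))]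
  have hd : δ ≤ |X| + |w.im| := by
    refine (h m).trans ((Complex.norm_le_abs_re_add_abs_im _).trans (le_of_eq ?_))
    simp [hX]
  -- If |Im w| < 1, one of |X|, |Im w| is at least δ/2, which costs a factor 1/2 or (3/7)(1/2) =
  -- 3/14; both exceed 1/5.
  rcases le_total 1 |w.im| with h1 | h1
  · rw [min_eq_left h1] at b2
    nlinarith
  · rw [min_eq_right h1] at b2
    rcases le_total (δ / 2) |X| with h2 | h2
    · have : δ / 2 * E ≤ |X| * E := by gcongr
      nlinarith [mul_nonneg hδ0 hE0.le]
    · have h3 : δ / 2 ≤ |w.im| := by linarith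
      have : δ / 2 * E ≤ |w.im| * E := by gcongr
      nlinarith [mul_nonneg hδ0 hE0.le]


/-! ### Counting and locating the zeros -/

/-- `D(ρ²)` and `M(ρ²)` have the common form `μ(ρ) (sin π(ρ + t/2) + J(ρ)/ρ)`, where `J = 0` for
`M`, and `J` is of exponential type `π` for `D`. -/
structure IsSinePerturbation (t : ℕ) (D M μ J : ℂ → ℂ) (B : ℝ) : Prop where
  le_two : t ≤ 2
  pos : 0 < B
  diff_left : Differentiable ℂ D
  diff_right : Differentiable ℂ M
  factor_ne_zero : ∀ ρ, ρ ≠ 0 → μ ρ ≠ 0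
  left_eq : ∀ ρ, ρ ≠ 0 → D (ρ ^ 2) = μ ρ * (Complex.sin (Real.pi * (ρ + t / 2)) + J ρ / ρ)
  right_eq : ∀ ρ, ρ ≠ 0 → M (ρ ^ 2) = μ ρ * Complex.sin (Real.pi * (ρ + t / 2))
  norm_le : ∀ ρ, ‖J ρ‖ ≤ B * Real.exp (Real.pi * |ρ.im|)

/-- The zeros of the unperturbed function. -/
noncomputable def modelZero (t n : ℕ) : ℂ := ((n : ℂ) - t / 2) ^ 2

/-- The zeros of the function with the listing `lam`, with multiplicities. -/
def Lists (lam : ℕ → ℂ) (D : ℂ → ℂ) : Prop :=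
  ∀ z, {n : ℕ | 1 ≤ n ∧ lam n = z}.encard = analyticOrderAt D z

/-- The square root of the radius of a circle separating `modelZero t N`, `modelZero t (N + 1)`. -/
noncomputable def rad (t N : ℕ) : ℝ := N + 1 / 2 - t / 2

lemma rad_lower {t N : ℕ} (ht : t ≤ 2) : (N : ℝ) - 1 / 2 ≤ rad t N := by
  have : (t : ℝ) ≤ 2 := by exact_mod_cast ht
  unfold rad; linarith

lemma rad_pos {t N : ℕ} (ht : t ≤ 2) (hN : 1 ≤ N) : 0 < rad t N := by
  have : (1 : ℝ) ≤ N := by exact_mod_cast hN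
  linarith [rad_lower (N := N) ht]

lemma rad_succ (t N : ℕ) : rad t (N + 1) = rad t N + 1 := by
  unfold rad; push_cast; ring

lemma tendsto_rad (t : ℕ) : Filter.Tendsto (rad t) Filter.atTop Filter.atTop := by
  have : rad t = fun N : ℕ => (N : ℝ) + (1 / 2 - t / 2) := by ext N; unfold rad; ring
  rw [this]
  exact Filter.tendsto_atTop_add_const_right _ _ tendsto_natCast_atTop_atTop

lemma norm_modelZero (t n : ℕ) : ‖modelZero t n‖ = ((n : ℝ) - t / 2) ^ 2 := by
  have : modelZero t n = (((n : ℝ) - t / 2 : ℝ) : ℂ) ^ 2 := by unfold modelZero; push_cast; rfl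
  rw [this, norm_pow, Complex.norm_real, Real.norm_eq_abs, sq_abs]

lemma half_le_abs_int_add_half (m : ℤ) : (1 / 2 : ℝ) ≤ |(m : ℝ) + 1 / 2| := by
  rcases le_or_gt 0 m with h | h
  · have : (0 : ℝ) ≤ m := by exact_mod_cast h
    rw [abs_of_nonneg (by linarith)]; linarith
  · have : (m : ℝ) ≤ -1 := by exact_mod_cast (by omega : m ≤ -1)
    rw [abs_of_nonpos (by linarith)]; linarith

/-- On the separating circles the shifted square root stays away from the integers. -/
lemma half_le_norm_sub_int {t N : ℕ} {ρ : ℂ} (hρ : ‖ρ‖ = rad t N) (m : ℤ) :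
    1 / 2 ≤ ‖ρ + t / 2 - m‖ := by
  have e : ρ + t / 2 - m = ρ - (((m : ℝ) - t / 2 : ℝ) : ℂ) := by push_cast; ring
  have h1 := abs_norm_sub_norm_le ρ (((m : ℝ) - t / 2 : ℝ) : ℂ)
  rw [e]
  refine le_trans ?_ h1
  rw [hρ, Complex.norm_real, Real.norm_eq_abs]
  unfold rad
  -- For either sign the difference of the moduli is an integer plus 1/2; for the minus sign this
  -- uses that t, not t/2, is subtracted.
  rcases abs_choice ((m : ℝ) - t / 2) with h | h <;> rw [h]
  · have := half_le_abs_int_add_half (N - m)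
    push_cast at this
    rwa [show (N : ℝ) + 1 / 2 - t / 2 - (m - t / 2) = N - m + 1 / 2 by ring]
  · have := half_le_abs_int_add_half (N + m - t)
    push_cast at this
    rwa [show (N : ℝ) + 1 / 2 - t / 2 - -(m - t / 2) = N + m - t + 1 / 2 by ring]

lemma exists_sq_eq_of_norm {z : ℂ} {r : ℝ} (hr : 0 < r) (hz : ‖z‖ = r ^ 2) :
    ∃ ρ : ℂ, ρ ^ 2 = z ∧ ‖ρ‖ = r ∧ ρ ≠ 0 := by
  have h : ‖sqrtC z‖ = r := by
    rw [← sqrtC_sq z, norm_pow] at hz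
    exact (pow_left_inj₀ (norm_nonneg _) hr.le two_ne_zero).1 hz
  exact ⟨sqrtC z, sqrtC_sq z, h, norm_pos_iff.1 (h ▸ hr)⟩

namespace IsSinePerturbation
variable {t : ℕ} {D M μ J : ℂ → ℂ} {B : ℝ} (h : IsSinePerturbation t D M μ J B)
include h

/-- The factor μ cancels and the deviation is J/(ρ sin). Distance 1/2 from the integers bounds the
sine below by exp(π|Im ρ|)/10, which matches the growth of J. -/
lemma norm_div_sub_one_le {N : ℕ} (hN : 1 ≤ N) {z : ℂ} (hz : ‖z‖ = rad t N ^ 2) :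
    M z ≠ 0 ∧ ‖D z / M z - 1‖ ≤ 10 * B / rad t N := by
  have hr := rad_pos h.le_two hN
  obtain ⟨ρ, rfl, hρ, hρ0⟩ := exists_sq_eq_of_norm hr hz
  have hs := le_norm_sin_pi_mul (w := ρ + t / 2) (δ := 1 / 2) (by norm_num) (by norm_num)
    (half_le_norm_sub_int hρ)
  have him : (ρ + t / 2 : ℂ).im = ρ.im := by
    have : (t / 2 : ℂ) = ((t / 2 : ℝ) : ℂ) := by push_cast; rfl
    rw [this, Complex.add_im, Complex.ofReal_im, add_zero]
  rw [him] at hs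
  have hE := Real.exp_pos (Real.pi * |ρ.im|)
  have hspos : 0 < ‖Complex.sin (Real.pi * (ρ + t / 2))‖ := lt_of_lt_of_le (by positivity) hs
  have hs0 := norm_pos_iff.1 hspos
  have hμ := h.factor_ne_zero ρ hρ0
  rw [h.right_eq ρ hρ0, h.left_eq ρ hρ0]
  refine ⟨mul_ne_zero hμ hs0, ?_⟩
  have e : μ ρ * (Complex.sin (Real.pi * (ρ + t / 2)) + J ρ / ρ) /
      (μ ρ * Complex.sin (Real.pi * (ρ + t / 2))) - 1 =
      J ρ / (ρ * Complex.sin (Real.pi * (ρ + t / 2))) := by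
    generalize Complex.sin (Real.pi * (ρ + t / 2)) = σ at hs0
    field_simp; ring
  rw [e, norm_div, norm_mul, hρ, div_le_div_iff₀ (by positivity) hr]
  have h1 := h.norm_le ρ
  have h2 : B * Real.exp (Real.pi * |ρ.im|) ≤
      10 * B * ‖Complex.sin (Real.pi * (ρ + t / 2))‖ := by nlinarith [h.pos]
  nlinarith

lemma eventually_small : ∃ N₀, 1 ≤ N₀ ∧ ∀ N ≥ N₀, 10 * B / rad t N < 1 := by
  have h1 := (tendsto_rad t).eventually_gt_atTop (10 * B)
  obtain ⟨N₀, hN₀⟩ := Filter.eventually_atTop.1 h1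
  refine ⟨max 1 N₀, le_max_left _ _, fun N hN => ?_⟩
  have hr := rad_pos h.le_two ((le_max_left 1 N₀).trans hN)
  rw [div_lt_one hr]
  exact hN₀ N ((le_max_right _ _).trans hN)

lemma left_ne_zero {N : ℕ} (hN : 1 ≤ N) (hs : 10 * B / rad t N < 1) {z : ℂ}
    (hz : ‖z‖ = rad t N ^ 2) : D z ≠ 0 := by
  obtain ⟨hM, hD⟩ := h.norm_div_sub_one_le hN hz
  intro h0
  rw [h0, zero_div, zero_sub, norm_neg, norm_one] at hD
  linarith

lemma modelZero_lt_iff {n N : ℕ} (hn : 1 ≤ n) (hN : 1 ≤ N) :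
    ‖modelZero t n‖ < rad t N ^ 2 ↔ n ≤ N := by
  have ht : (t : ℝ) ≤ 2 := by exact_mod_cast h.le_two
  have hn' : (1 : ℝ) ≤ n := by exact_mod_cast hn
  have hr := rad_pos h.le_two hN
  rw [norm_modelZero, pow_lt_pow_iff_left₀ (by linarith) hr.le two_ne_zero]
  unfold rad
  constructor
  · intro hlt
    by_contra hcon
    have : (N : ℝ) + 1 ≤ n := by exact_mod_cast (by omega : N + 1 ≤ n)
    linarith
  · intro hle
    have : (n : ℝ) ≤ N := by exact_mod_cast hle
    linarith

/-- Factorizations of both functions in the disc `|z| ≤ rad t N ^ 2`, for any finite set that lists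
the zeros of `D` there. -/
lemma exists_factorization {lam : ℕ → ℂ} (hlam : Lists lam D) (hM : Lists (modelZero t) M)
    {N : ℕ} (hN : 1 ≤ N) (hs : 10 * B / rad t N < 1) {S : Finset ℕ}
    (hS : ∀ n, n ∈ S ↔ 1 ≤ n ∧ ‖lam n‖ < rad t N ^ 2) :
    ∃ F G : ℂ → ℂ, Differentiable ℂ F ∧ Differentiable ℂ G ∧
      (∀ z, D z = (∏ i ∈ S, (lam i - z)) * F z) ∧
      (∀ z, M z = (∏ i ∈ Finset.Icc 1 N, (modelZero t i - z)) * G z) ∧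
      (∀ z ∈ Metric.closedBall (0 : ℂ) (rad t N ^ 2), F z ≠ 0 ∧ G z ≠ 0) := by
  have hT : ∀ n, n ∈ Finset.Icc 1 N ↔ 1 ≤ n ∧ ‖modelZero t n‖ < rad t N ^ 2 := fun n => by
    rw [Finset.mem_Icc]
    exact and_congr_right fun hn => (h.modelZero_lt_iff hn hN).symm
  have key : ∀ {Q : ℂ → ℂ} (_ : Differentiable ℂ Q) {a : ℕ → ℂ} (_ : Lists a Q) {S : Finset ℕ}
      (_ : ∀ n, n ∈ S ↔ 1 ≤ n ∧ ‖a n‖ < rad t N ^ 2),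
      (∀ z, ‖z‖ = rad t N ^ 2 → Q z ≠ 0) → ∃ F : ℂ → ℂ, Differentiable ℂ F ∧
      (∀ z, Q z = (∏ i ∈ S, (a i - z)) * F z) ∧
      ∀ z ∈ Metric.closedBall (0 : ℂ) (rad t N ^ 2), F z ≠ 0 := by
    intro Q hQ a ha S hS hne
    obtain ⟨F, hF, e, hF0⟩ := exists_eq_prod_mul_ne_zero hQ (S := S) (a := a)
      (U := Metric.ball 0 (rad t N ^ 2)) (fun i hi => mem_ball_zero_iff.2 ((hS i).1 hi).2)
      (fun w hw => by
        rw [← ha w, ← Set.encard_coe_eq_coe_finsetCard]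
        congr 1
        ext n
        simp only [Finset.coe_filter, Set.mem_ofPred_eq, hS]
        constructor
        · rintro ⟨⟨h1, _⟩, h2⟩; exact ⟨h1, h2⟩
        · rintro ⟨h1, h2⟩; exact ⟨⟨h1, by rw [h2]; exact mem_ball_zero_iff.1 hw⟩, h2⟩)
    refine ⟨F, hF, e, fun z hz => ?_⟩
    rcases (mem_closedBall_zero_iff.1 hz).lt_or_eq with hlt | heq
    · exact hF0 z (mem_ball_zero_iff.2 hlt)
    · intro h0
      exact hne z heq (by rw [e, h0, mul_zero])
  obtain ⟨F, hF, eF, F0⟩ := key h.diff_left hlam hS fun z hz => h.left_ne_zero hN hs hz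
  obtain ⟨G, hG, eG, G0⟩ := key h.diff_right hM hT fun z hz => (h.norm_div_sub_one_le hN hz).1
  exact ⟨F, G, hF, hG, eF, eG, fun z hz => ⟨F0 z hz, G0 z hz⟩⟩

/-- For large `N` exactly `N` of the listed zeros lie in the disc `|z| < rad t N ^ 2`. -/
lemma exists_card {lam : ℕ → ℂ} (hlam : Lists lam D) (hM : Lists (modelZero t) M)
    {N : ℕ} (hN : 1 ≤ N) (hs : 10 * B / rad t N < 1) :
    ∃ S : Finset ℕ, (∀ n, n ∈ S ↔ 1 ≤ n ∧ ‖lam n‖ < rad t N ^ 2) ∧ S.card = N := by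
  have hr := rad_pos h.le_two hN
  have hfin : {n : ℕ | 1 ≤ n ∧ ‖lam n‖ < rad t N ^ 2}.Finite := by
    refine finite_zeros h.diff_left (w₀ := ((rad t N ^ 2 : ℝ) : ℂ))
      (h.left_ne_zero hN hs ?_) hlam _
    rw [Complex.norm_real, Real.norm_eq_abs, abs_of_pos (by positivity)]
  have hS : ∀ n, n ∈ hfin.toFinset ↔ 1 ≤ n ∧ ‖lam n‖ < rad t N ^ 2 := fun n => by simp
  refine ⟨hfin.toFinset, hS, ?_⟩
  obtain ⟨F, G, hF, hG, eF, eG, hFG⟩ := h.exists_factorization hlam hM hN hs hS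
  have := card_eq_of_norm_div_sub_one_lt hF hG (R := rad t N ^ 2) (by positivity)
    (fun i hi => mem_ball_zero_iff.2 ((hS i).1 hi).2)
    (b := modelZero t) (T := Finset.Icc 1 N) (fun i hi => by
      rw [Finset.mem_Icc] at hi
      exact mem_ball_zero_iff.2 ((h.modelZero_lt_iff hi.1 hN).2 hi.2))
    (fun z hz => (hFG z hz).1) (fun z hz => (hFG z hz).2) (fun z hz => by
      rw [← eF, ← eG]
      exact (h.norm_div_sub_one_le hN (mem_sphere_zero_iff_norm.1 hz)).2.trans_lt hs)
  rw [this]; simp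

/-- With the moduli eventually nondecreasing, the `N` zeros in the `N`-th disc are the first
ones of the listing. -/
lemma exists_norm_lt_iff {lam : ℕ → ℂ} (hlam : Lists lam D) (hM : Lists (modelZero t) M)
    (hnum : ∃ N : ℕ, ∀ n ≥ N, ‖lam n‖ ≤ ‖lam (n + 1)‖) :
    ∃ N₁, 1 ≤ N₁ ∧ ∀ N ≥ N₁, 10 * B / rad t N < 1 ∧
      ∀ n, 1 ≤ n → (‖lam n‖ < rad t N ^ 2 ↔ n ≤ N) := by
  obtain ⟨N₀, hN₀, hsmall⟩ := h.eventually_small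
  obtain ⟨K, hK⟩ := hnum
  have hmono : ∀ m n, K ≤ m → m ≤ n → ‖lam m‖ ≤ ‖lam n‖ := fun m n hm hmn => by
    induction n, hmn using Nat.le_induction with
    | base => exact le_rfl
    | succ n hmn ih => exact ih.trans (hK n (hm.trans hmn))
  have hbd : ∃ C : ℝ, ∀ n ≤ K, ‖lam n‖ ≤ C :=
    ⟨∑ i ∈ Finset.range (K + 1), ‖lam i‖, fun n hn =>
      Finset.single_le_sum (f := fun i => ‖lam i‖) (fun _ _ => norm_nonneg _)
        (Finset.mem_range.2 (Nat.lt_succ_of_le hn))⟩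
  obtain ⟨C, hC⟩ := hbd
  have hev : ∀ᶠ N in Filter.atTop, C < rad t N ^ 2 :=
    ((Filter.tendsto_pow_atTop two_ne_zero).comp (tendsto_rad t)).eventually_gt_atTop C
  obtain ⟨N₂, hN₂⟩ := Filter.eventually_atTop.1 hev
  refine ⟨max N₀ N₂, hN₀.trans (le_max_left _ _), fun N hN => ?_⟩
  have hs := hsmall N ((le_max_left _ _).trans hN)
  have hN1 : 1 ≤ N := hN₀.trans ((le_max_left _ _).trans hN)
  refine ⟨hs, ?_⟩
  obtain ⟨S, hS, hcard⟩ := h.exists_card hlam hM hN1 hs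
  -- The set of indices is an initial segment: up to K the zeros lie in the disc because it is
  -- large, beyond K by monotonicity. Having N elements, it is {1, …, N}.
  have hdown : ∀ n ∈ S, ∀ m, 1 ≤ m → m ≤ n → m ∈ S := fun n hn m hm hmn => by
    rw [hS] at hn ⊢
    refine ⟨hm, ?_⟩
    rcases le_total m K with hmK | hmK
    · exact (hC m hmK).trans_lt (hN₂ N ((le_max_right _ _).trans hN))
    · exact (hmono m n hmK hmn).trans_lt hn.2
  have hsub : S ⊆ Finset.Icc 1 N := fun n hn => by
    have h1 : Finset.Icc 1 n ⊆ S := fun m hm => by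
      rw [Finset.mem_Icc] at hm; exact hdown n hn m hm.1 hm.2
    have h2 := Finset.card_le_card h1
    rw [Nat.card_Icc, hcard] at h2
    exact Finset.mem_Icc.2 ⟨((hS n).1 hn).1, by omega⟩
  have heq : S = Finset.Icc 1 N := Finset.eq_of_subset_of_card_le hsub (by simp [hcard])
  intro n hn
  have := hS n
  rw [heq, Finset.mem_Icc] at this
  constructor
  · exact fun hlt => (this.2 ⟨hn, hlt⟩).2
  · exact fun hle => (this.1 ⟨hn, hle⟩).2

/-- A zero in the `n`-th annulus is close to the `n`-th zero of the unperturbed function. -/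
lemma norm_sub_modelZero_le {z : ℂ} (hz : D z = 0) {n : ℕ} (hn : 2 ≤ n)
    (h1 : rad t (n - 1) ^ 2 ≤ ‖z‖) (h2 : ‖z‖ < rad t n ^ 2)
    (hs : 12 * B < rad t (n - 1)) : ‖z - modelZero t n‖ ≤ 12 * B + 1 := by
  have hB := h.pos
  have hr := rad_pos h.le_two (N := n) (by omega)
  have hr' := rad_pos h.le_two (N := n - 1) (by omega)
  have hrr : rad t n = rad t (n - 1) + 1 := by
    rw [← rad_succ]; congr 1; omega
  set ρ := sqrtC z with hρ
  have hρz : ρ ^ 2 = z := sqrtC_sq z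
  rw [← hρz, norm_pow] at h1 h2
  have h1 := (pow_le_pow_iff_left₀ hr'.le (norm_nonneg _) two_ne_zero).1 h1
  have h2 := (pow_lt_pow_iff_left₀ (norm_nonneg _) hr.le two_ne_zero).1 h2
  have hρpos : 0 < ‖ρ‖ := hr'.trans_le h1
  have hρ0 : ρ ≠ 0 := norm_pos_iff.1 hρpos
  -- Chosen so that the lower bound δ/5 for the sine exceeds the size B/|ρ| of the perturbation
  -- (both up to the exponential), while δ < 1/2.
  set δ := 6 * B / ‖ρ‖ with hδ
  have hδ0 : 0 < δ := by positivity
  have hδ1 : δ < 1 / 2 := by rw [hδ, div_lt_iff₀ hρpos]; linarith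
  obtain ⟨m, hm⟩ : ∃ m : ℤ, ‖ρ + t / 2 - m‖ < δ := by
    by_contra hcon
    push Not at hcon
    have hsin := le_norm_sin_pi_mul hδ0.le (by linarith) hcon
    have him : (ρ + t / 2 : ℂ).im = ρ.im := by
      have : (t / 2 : ℂ) = ((t / 2 : ℝ) : ℂ) := by push_cast; rfl
      rw [this, Complex.add_im, Complex.ofReal_im, add_zero]
    rw [him] at hsin
    have h0 := h.left_eq ρ hρ0
    rw [hρz, hz, eq_comm, mul_eq_zero] at h0
    have h0 := h0.resolve_left (h.factor_ne_zero ρ hρ0)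
    rw [eq_neg_of_add_eq_zero_left h0, norm_neg, norm_div] at hsin
    have hJ := h.norm_le ρ
    have h4 : ‖J ρ‖ / ‖ρ‖ ≤ B * Real.exp (Real.pi * |ρ.im|) / ‖ρ‖ := by gcongr
    have h5 : 1 / 5 * δ * Real.exp (Real.pi * |ρ.im|) =
        6 / 5 * (B * Real.exp (Real.pi * |ρ.im|) / ‖ρ‖) := by rw [hδ]; ring
    have h6 : 0 < B * Real.exp (Real.pi * |ρ.im|) / ‖ρ‖ := by positivity
    linarith
  have e : ρ + t / 2 - m = ρ - (((m : ℝ) - t / 2 : ℝ) : ℂ) := by push_cast; ring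
  rw [e] at hm
  have hm' := (abs_norm_sub_norm_le ρ (((m : ℝ) - t / 2 : ℝ) : ℂ)).trans_lt hm
  rw [Complex.norm_real, Real.norm_eq_abs, abs_lt] at hm'
  -- |m - t/2| is within 1/2 of |ρ|, and ρ lies in the n-th annulus, so m - t/2 is n - t/2 up to
  -- sign; the minus sign means m = t - n.
  have hsq : ((m : ℝ) - t / 2) ^ 2 = ((n : ℝ) - t / 2) ^ 2 := by
    unfold rad at h1 h2
    have hnc : ((n - 1 : ℕ) : ℝ) = n - 1 := by rw [Nat.cast_sub (by omega)]; simp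
    rw [hnc] at h1
    rcases abs_choice ((m : ℝ) - t / 2) with ha | ha <;> rw [ha] at hm'
    · have c1 : (m : ℝ) < n + 1 := by linarith
      have c2 : (n : ℝ) < m + 1 := by linarith
      have c1 : m < n + 1 := by exact_mod_cast c1
      have c2 : (n : ℤ) < m + 1 := by exact_mod_cast c2
      have : m = n := by omega
      rw [this]; simp
    · have c1 : (t : ℝ) - m < n + 1 := by linarith
      have c2 : (n : ℝ) < t - m + 1 := by linarith
      have c1 : (t : ℤ) - m < n + 1 := by exact_mod_cast c1
      have c2 : (n : ℤ) < t - m + 1 := by exact_mod_cast c2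
      have : m = t - n := by omega
      rw [this]; push_cast; ring
  have es : modelZero t n = ((((m : ℝ) - t / 2 : ℝ) : ℂ)) ^ 2 := by
    rw [← Complex.ofReal_pow, hsq]; unfold modelZero; push_cast; rfl
  -- One factor is below δ = 6B/|ρ| and the other is about 2|ρ|, so the product is bounded
  -- independently of n.
  rw [es, ← hρz, sq_sub_sq, norm_mul]
  set c : ℂ := (((m : ℝ) - t / 2 : ℝ) : ℂ)
  have h7 : ‖ρ + c‖ ≤ 2 * ‖ρ‖ + δ := by
    have : ρ + c = 2 * ρ - (ρ - c) := by ring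
    rw [this]
    refine (norm_sub_le _ _).trans ?_
    rw [norm_mul, Complex.norm_two]
    linarith
  calc ‖ρ + c‖ * ‖ρ - c‖ ≤ (2 * ‖ρ‖ + δ) * δ := by gcongr
    _ = 12 * B + δ ^ 2 := by rw [hδ]; field_simp; ring
    _ ≤ 12 * B + 1 := by nlinarith

/-- For large n, counting in two consecutive discs puts the n-th listed zero into the n-th annulus;
the finitely many others are absorbed into the constant. -/
lemma exists_norm_sub_le {lam : ℕ → ℂ} (hlam : Lists lam D) (hM : Lists (modelZero t) M)
    (hnum : ∃ N : ℕ, ∀ n ≥ N, ‖lam n‖ ≤ ‖lam (n + 1)‖) :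
    ∃ C, 0 < C ∧ ∀ n, 1 ≤ n → ‖lam n - modelZero t n‖ ≤ C := by
  obtain ⟨N₁, hN₁, H⟩ := h.exists_norm_lt_iff hlam hM hnum
  obtain ⟨N₂, hN₂⟩ := Filter.eventually_atTop.1 ((tendsto_rad t).eventually_gt_atTop (12 * B))
  set N₃ := max N₁ N₂ + 1 with hN₃
  have hB := h.pos
  have hnn : 0 ≤ ∑ i ∈ Finset.range N₃, ‖lam i - modelZero t i‖ :=
    Finset.sum_nonneg fun _ _ => norm_nonneg _
  refine ⟨12 * B + 1 + ∑ i ∈ Finset.range N₃, ‖lam i - modelZero t i‖, by positivity,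
    fun n hn => ?_⟩
  rcases lt_or_ge n N₃ with hlt | hge
  · have := Finset.single_le_sum (f := fun i => ‖lam i - modelZero t i‖)
      (fun _ _ => norm_nonneg _) (Finset.mem_range.2 hlt)
    linarith
  · have g1 : N₁ ≤ n - 1 := by omega
    have g2 : N₂ ≤ n - 1 := by omega
    have := h.norm_sub_modelZero_le (eq_zero_of_listed h.diff_left hlam hn) (n := n) (by omega)
      (not_lt.1 fun hlt => by
        have := ((H (n - 1) g1).2 n hn).1 hlt
        omega) (((H n (by omega)).2 n hn).2 le_rfl) (hN₂ (n - 1) g2)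
    linarith

end IsSinePerturbation


/-! ### Quotients of finite products over the zeros -/

/-- The sum of the deviations of the N factors on the N-th circle is controlled by this Cesàro mean
of a null sequence. -/
lemma tendsto_average_inv : Filter.Tendsto
    (fun N : ℕ => (N : ℝ)⁻¹ * ∑ j ∈ Finset.range N, ((j : ℝ) + 1 / 2)⁻¹) Filter.atTop (nhds 0) := by
  refine Filter.Tendsto.cesaro ?_
  exact tendsto_inv_atTop_zero.comp
    (Filter.tendsto_atTop_add_const_right _ _ tendsto_natCast_atTop_atTop)

lemma prod_Icc_one_eq_prod_range {R : Type*} [CommMonoid R] (f : ℕ → R) (N : ℕ) :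
    ∏ i ∈ Finset.Icc 1 N, f i = ∏ i ∈ Finset.range N, f (i + 1) := by
  rw [Finset.range_eq_Ico, Finset.prod_Ico_add' f 0 N 1]
  rfl

lemma sum_Icc_reflect (N : ℕ) : ∑ m ∈ Finset.Icc 1 N, ((N : ℝ) - m + 1 / 2)⁻¹ =
    ∑ j ∈ Finset.range N, ((j : ℝ) + 1 / 2)⁻¹ := by
  rw [← Finset.sum_range_reflect]
  have e : Finset.Icc 1 N = (Finset.range N).image (· + 1) := by
    ext i; simp only [Finset.mem_Icc, Finset.mem_image, Finset.mem_range]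
    constructor
    · rintro ⟨h1, h2⟩; exact ⟨i - 1, by omega, by omega⟩
    · rintro ⟨j, h1, rfl⟩; omega
  rw [e, Finset.sum_image (fun _ _ _ _ h => by simpa using h)]
  refine Finset.sum_congr rfl fun i hi => ?_
  have hi := Finset.mem_range.1 hi
  rw [Nat.sub_sub, Nat.cast_sub (by omega)]
  push_cast; congr 1; ring

namespace IsSinePerturbation
variable {t : ℕ} {D M μ J : ℂ → ℂ} {B : ℝ} (h : IsSinePerturbation t D M μ J B)
include h

/-- Factoring a difference of squares, the m-th model zero is at distance at least X = (N - m + 1/2)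
`rad t N` from the circle. As 2C ≤ X, moving it by C leaves at least X/2. -/
lemma norm_ratio_sub_one_le {lam : ℕ → ℂ} {C : ℝ} (hC0 : 0 < C)
    (hC : ∀ n, 1 ≤ n → ‖lam n - modelZero t n‖ ≤ C) {N m : ℕ} (hm : 1 ≤ m) (hmN : m ≤ N)
    (hr : 4 * C ≤ rad t N) {z : ℂ} (hz : ‖z‖ = rad t N ^ 2) :
    lam m - z ≠ 0 ∧ ‖(modelZero t m - z) / (lam m - z) - 1‖ ≤
      2 * C / rad t N * ((N : ℝ) - m + 1 / 2)⁻¹ := by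
  have ht : (t : ℝ) ≤ 2 := by exact_mod_cast h.le_two
  have hm' : (1 : ℝ) ≤ m := by exact_mod_cast hm
  have hmN' : (m : ℝ) ≤ N := by exact_mod_cast hmN
  have hr0 : 0 < rad t N := by linarith
  have hX : ((N : ℝ) - m + 1 / 2) * rad t N ≤ ‖z‖ - ‖modelZero t m‖ := by
    rw [hz, norm_modelZero]
    have e : rad t N ^ 2 - ((m : ℝ) - t / 2) ^ 2 =
      ((N : ℝ) - m + 1 / 2) * (rad t N + (m - t / 2)) := by unfold rad; ring
    rw [e]
    gcongr
    linarith
  set X := ((N : ℝ) - m + 1 / 2) * rad t N with hXdef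
  have hX2 : 2 * C ≤ X := by rw [hXdef]; nlinarith
  have hlow : X / 2 ≤ ‖lam m - z‖ := by
    have h1 := norm_sub_norm_le z (lam m)
    have h2 := norm_sub_norm_le (lam m) (modelZero t m)
    have h3 := hC m hm
    rw [norm_sub_rev] at h1
    linarith
  have hne : lam m - z ≠ 0 := norm_pos_iff.1 (by linarith)
  refine ⟨hne, ?_⟩
  have e : (modelZero t m - z) / (lam m - z) - 1 = (modelZero t m - lam m) / (lam m - z) := by
    field_simp; ring
  rw [e, norm_div, norm_sub_rev]
  have hNm : 0 < (N : ℝ) - m + 1 / 2 := by linarith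
  calc ‖lam m - modelZero t m‖ / ‖lam m - z‖ ≤ C / (X / 2) := by
        gcongr
        exact hC m hm
    _ = _ := by rw [hXdef]; field_simp

/-- The ratio of the two functions is the limit of the ratios of the products over their zeros. -/
lemma tendsto_prod_ratio {lam : ℕ → ℂ} (hlam : Lists lam D) (hM : Lists (modelZero t) M)
    (hnum : ∃ N : ℕ, ∀ n ≥ N, ‖lam n‖ ≤ ‖lam (n + 1)‖) {z : ℂ} (hz : M z ≠ 0) :
    Filter.Tendsto (fun N => ∏ m ∈ Finset.range N,
      (lam (m + 1) - z) / (modelZero t (m + 1) - z)) Filter.atTop (nhds (D z / M z)) := by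
  obtain ⟨C, hC0, hC⟩ := h.exists_norm_sub_le hlam hM hnum
  obtain ⟨N₁, hN₁, H⟩ := h.exists_norm_lt_iff hlam hM hnum
  set avg : ℕ → ℝ := fun N => (N : ℝ)⁻¹ * ∑ j ∈ Finset.range N, ((j : ℝ) + 1 / 2)⁻¹ with havg
  set b : ℕ → ℝ := fun N => Real.exp (4 * C * avg N) - 1 with hb
  set ε : ℕ → ℝ := fun N => 10 * B / rad t N + b N + 10 * B / rad t N * b N with hε
  have hb0 : Filter.Tendsto b Filter.atTop (nhds 0) := by
    have h1 := (tendsto_average_inv.const_mul (4 * C)).rexp.sub_const 1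
    rwa [mul_zero, Real.exp_zero, sub_self] at h1
  have hr0 : Filter.Tendsto (fun N => 10 * B / rad t N) Filter.atTop (nhds 0) :=
    (tendsto_rad t).const_div_atTop _
  have hε0 : Filter.Tendsto ε Filter.atTop (nhds 0) := by
    simpa using (hr0.add hb0).add (hr0.mul hb0)
  have key : ∀ᶠ N in Filter.atTop, ∃ g : ℂ, ‖g - 1‖ ≤ ε N ∧
      D z / M z = (∏ m ∈ Finset.range N, (lam (m + 1) - z) / (modelZero t (m + 1) - z)) * g := by
    have hev2 : ∀ᶠ N in Filter.atTop, ‖z‖ < rad t N ^ 2 :=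
      ((Filter.tendsto_pow_atTop two_ne_zero).comp (tendsto_rad t)).eventually_gt_atTop ‖z‖
    filter_upwards [Filter.eventually_ge_atTop N₁, (tendsto_rad t).eventually_ge_atTop (4 * C), hev2]
      with N hN hrC hzN
    have hN1 : 1 ≤ N := hN₁.trans hN
    have hr := rad_pos h.le_two hN1
    obtain ⟨hs, hlt⟩ := H N hN
    have hS : ∀ n, n ∈ Finset.Icc 1 N ↔ 1 ≤ n ∧ ‖lam n‖ < rad t N ^ 2 := fun n => by
      rw [Finset.mem_Icc]
      exact and_congr_right fun hn => (hlt n hn).symm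
    obtain ⟨F, G, hF, hG, eF, eG, hFG⟩ := h.exists_factorization hlam hM hN1 hs hS
    -- On the circle F/G is the product of D/M and P, both close to 1; `ε N` collects their
    -- deviations.
    have hbound : ∀ w, ‖w‖ = rad t N ^ 2 → ‖F w / G w - 1‖ ≤ ε N := by
      intro w hw
      obtain ⟨hMw, hDw⟩ := h.norm_div_sub_one_le hN1 hw
      have hrat := fun m (hm : m ∈ Finset.Icc 1 N) => h.norm_ratio_sub_one_le hC0 hC
        (Finset.mem_Icc.1 hm).1 (Finset.mem_Icc.1 hm).2 hrC hw
      have hne : ∏ i ∈ Finset.Icc 1 N, (lam i - w) ≠ 0 :=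
        Finset.prod_ne_zero_iff.2 fun i hi => (hrat i hi).1
      have hne' : ∏ i ∈ Finset.Icc 1 N, (modelZero t i - w) ≠ 0 := by
        intro h0; rw [eG, h0, zero_mul] at hMw; exact hMw rfl
      have hGw := (hFG w (mem_closedBall_zero_iff.2 hw.le)).2
      set P := ∏ i ∈ Finset.Icc 1 N, (modelZero t i - w) / (lam i - w) with hP
      have hPb : ‖P - 1‖ ≤ b N := by
        have h1 := Finset.norm_prod_one_add_sub_one_le (Finset.Icc 1 N)
          (fun i => (modelZero t i - w) / (lam i - w) - 1)
        simp only [add_sub_cancel] at h1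
        refine h1.trans (sub_le_sub_right (Real.exp_le_exp.2 ?_) 1)
        refine (Finset.sum_le_sum fun i hi => (hrat i hi).2).trans ?_
        rw [← Finset.mul_sum, sum_Icc_reflect, havg]
        have hN' : (1 : ℝ) ≤ N := by exact_mod_cast hN1
        have hrN : (N : ℝ) / 2 ≤ rad t N := by linarith [rad_lower (N := N) h.le_two]
        have h2 : 2 * C / rad t N ≤ 4 * C * (N : ℝ)⁻¹ := by
          rw [div_le_iff₀ hr, ← div_eq_mul_inv, div_mul_eq_mul_div, le_div_iff₀ (by linarith)]
          nlinarith
        rw [← mul_assoc]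
        gcongr
      have e : F w / G w = (D w / M w) * P := by
        rw [eF, eG, hP, Finset.prod_div_distrib]
        field_simp
      have e2 : F w / G w - 1 = (D w / M w - 1) + (P - 1) + (D w / M w - 1) * (P - 1) := by
        rw [e]; ring
      rw [e2]
      refine (norm_add_le _ _).trans (add_le_add ((norm_add_le _ _).trans (add_le_add hDw hPb)) ?_)
      rw [norm_mul]
      have hBr : 0 ≤ 10 * B / rad t N := (norm_nonneg _).trans hDw
      gcongr
    refine ⟨F z / G z, ?_, ?_⟩
    -- F and G have no zeros in the closed disc, so the maximum principle brings the bound to the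
    -- fixed z.
    · have hd : DiffContOnCl ℂ (fun w => F w / G w - 1) (Metric.ball 0 (rad t N ^ 2)) := by
        refine DifferentiableOn.diffContOnCl fun w hw => ?_
        have hw := Metric.closure_ball_subset_closedBall hw
        exact (((hF w).div (hG w) (hFG w hw).2).sub_const 1).differentiableWithinAt
      refine Complex.norm_le_of_forall_mem_frontier_norm_le Metric.isBounded_ball hd
        (fun w hw => hbound w ?_) (subset_closure (mem_ball_zero_iff.2 hzN))
      rw [frontier_ball (0 : ℂ) (by positivity)] at hw
      exact mem_sphere_zero_iff_norm.1 hw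
    · rw [← prod_Icc_one_eq_prod_range (fun i => (lam i - z) / (modelZero t i - z)),
        Finset.prod_div_distrib, eF, eG]
      rw [eG] at hz
      have h1 := left_ne_zero_of_mul hz
      have h2 := right_ne_zero_of_mul hz
      field_simp
  -- D/M equals the N-th finite quotient times an error `g N` tending to 1; dividing by the error
  -- gives the limit.
  obtain ⟨g, hg'⟩ := key.choice
  have hg1 : Filter.Tendsto g Filter.atTop (nhds 1) := by
    rw [tendsto_iff_norm_sub_tendsto_zero]
    exact squeeze_zero' (Filter.Eventually.of_forall fun _ => norm_nonneg _)
      (hg'.mono fun N hN => hN.1) hε0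
  have hlim : Filter.Tendsto (fun N => D z / M z / g N) Filter.atTop (nhds (D z / M z / 1)) :=
    tendsto_const_nhds.div hg1 one_ne_zero
  rw [div_one] at hlim
  refine hlim.congr' ?_
  filter_upwards [hg', hg1.eventually_ne one_ne_zero] with N hN hne
  rw [hN.2, mul_div_cancel_right₀ _ hne]

end IsSinePerturbation


/-! ### Zeros and Euler products of the free functions; the infinite product -/

lemma modelZero_injOn {t n m : ℕ} (ht : t ≤ 2) (hn : 1 ≤ n) (hm : 1 ≤ m)
    (h : modelZero t n = modelZero t m) : n = m := by
  have h1 := congrArg norm h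
  rw [norm_modelZero, norm_modelZero] at h1
  have ht' : (t : ℝ) ≤ 2 := by exact_mod_cast ht
  have hn' : (1 : ℝ) ≤ n := by exact_mod_cast hn
  have hm' : (1 : ℝ) ≤ m := by exact_mod_cast hm
  have h2 := (pow_left_inj₀ (by linarith) (by linarith) two_ne_zero).1 h1
  have h3 : (n : ℝ) = m := by linarith
  exact_mod_cast h3

lemma sin_modelZero_eq_zero_iff {t : ℕ} (ht : t ≤ 2) {ρ : ℂ} (hρ : ρ ≠ 0) :
    Complex.sin (Real.pi * (ρ + t / 2)) = 0 ↔ ∃ n, 1 ≤ n ∧ modelZero t n = ρ ^ 2 := by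
  have hpi : (Real.pi : ℂ) ≠ 0 := Complex.ofReal_ne_zero.2 Real.pi_ne_zero
  rw [Complex.sin_eq_zero_iff]
  constructor
  · rintro ⟨n, hn⟩
    have e : ρ = n - t / 2 := by
      rw [mul_comm] at hn
      rw [← mul_right_cancel₀ hpi hn]; ring
    by_cases h1 : 1 ≤ n
    · lift n to ℕ using by omega
      exact ⟨n, by omega, by rw [modelZero, e]; push_cast; ring⟩
    -- For n ≤ 0 the index t - n gives -ρ, with the same square; it is at least 1 because ρ ≠ 0
    -- rules out n = t = 0.
    · have h2 : n ≠ 0 ∨ t ≠ 0 := by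
        by_contra! h0
        exact hρ (by rw [e, h0.1, h0.2]; simp)
      refine ⟨(t - n).toNat, by omega, ?_⟩
      have h3 : (((t - n : ℤ).toNat : ℤ) : ℂ) = ((t - n : ℤ) : ℂ) := by
        rw [Int.toNat_of_nonneg (by omega)]
      rw [modelZero, e, ← Int.cast_natCast (t - n : ℤ).toNat, h3]
      push_cast; ring
  · rintro ⟨n, -, hn⟩
    rcases sq_eq_sq_iff_eq_or_eq_neg.1 hn with h | h
    · exact ⟨n, by rw [← h]; push_cast; ring⟩
    · exact ⟨t - n, by rw [← neg_eq_iff_eq_neg.2 h]; push_cast; ring⟩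

/-- The zeros `modelZero t n` of a function of the form `μ(ρ) sin π(ρ + t/2)`, `z = ρ²`, are
simple. -/
lemma lists_modelZero {t : ℕ} {M μ : ℂ → ℂ} (ht : t ≤ 2) (hM : Differentiable ℂ M)
    (hμ : ∀ ρ, ρ ≠ 0 → μ ρ ≠ 0) (hd : ∀ ρ, ρ ≠ 0 → DifferentiableAt ℂ μ ρ)
    (e : ∀ ρ, ρ ≠ 0 → M (ρ ^ 2) = μ ρ * Complex.sin (Real.pi * (ρ + t / 2)))
    (h0 : t < 2 → M 0 ≠ 0) (h2 : t = 2 → M 0 = 0 ∧ deriv M 0 ≠ 0) : Lists (modelZero t) M := by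
  have hzero : ∀ z, M z = 0 ↔ ∃ n, 1 ≤ n ∧ modelZero t n = z := by
    intro z
    rcases eq_or_ne z 0 with rfl | hz
    · rcases ht.lt_or_eq with h | h
      · refine iff_of_false (h0 h) ?_
        rintro ⟨n, hn, h'⟩
        have h1 := congrArg norm h'
        rw [norm_modelZero, norm_zero] at h1
        have h3 := pow_eq_zero_iff two_ne_zero |>.1 h1
        have h4 : (2 * n : ℝ) = t := by linarith
        have h5 : 2 * n = t := by exact_mod_cast h4
        omega
      · exact iff_of_true (h2 h).1 ⟨1, le_rfl, by rw [modelZero, h]; norm_num⟩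
    · have hr := sqrtC_ne_zero hz
      have h3 := e _ hr
      have h4 := sin_modelZero_eq_zero_iff ht hr
      rw [sqrtC_sq] at h3 h4
      rw [← h4, h3, mul_eq_zero, or_iff_right (hμ _ hr)]
  have hderiv : ∀ z, M z = 0 → deriv M z ≠ 0 := by
    intro z hMz
    rcases eq_or_ne z 0 with rfl | hz
    · rcases ht.lt_or_eq with h | h
      · exact absurd hMz (h0 h)
      · exact (h2 h).2
    · have hr := sqrtC_ne_zero hz
      have hz2 := sqrtC_sq z
      generalize sqrtC z = ρ at *
      subst hz2
      have hs : Complex.sin (Real.pi * (ρ + t / 2)) = 0 := by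
        have := e _ hr
        rw [hMz] at this
        exact (mul_eq_zero.1 this.symm).resolve_left (hμ _ hr)
      have hc : Complex.cos (Real.pi * (ρ + t / 2)) ≠ 0 := by
        intro hc
        have := Complex.sin_sq_add_cos_sq (Real.pi * (ρ + t / 2))
        rw [hs, hc] at this; norm_num at this
      -- Differentiating M(ρ²) in two ways at a zero gives 2ρ M'(ρ²) = π μ cos ≠ 0, so the zero is
      -- simple.
      have d1 : HasDerivAt (fun w : ℂ => M (w ^ 2)) (deriv M (ρ ^ 2) * (2 * ρ)) ρ := by
        have := (hM (ρ ^ 2)).hasDerivAt.comp ρ (hasDerivAt_pow 2 ρ)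
        convert! this using 1
        simp
      have d2 : HasDerivAt (fun w : ℂ => μ w * Complex.sin (Real.pi * (w + t / 2)))
          (deriv μ ρ * Complex.sin (Real.pi * (ρ + t / 2)) +
            μ ρ * (Complex.cos (Real.pi * (ρ + t / 2)) * (Real.pi * 1))) ρ :=
        (hd ρ hr).hasDerivAt.mul (((hasDerivAt_id' ρ).add_const _).const_mul _).csin
      have d3 := d2.congr_of_eventuallyEq (f₁ := fun w : ℂ => M (w ^ 2)) (by
        filter_upwards [eventually_ne_nhds hr] with w hw using e w hw)
      intro hcon
      have := d1.unique d3
      rw [hcon, hs] at this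
      simp [hμ _ hr, hc] at this
  intro z
  by_cases hz : M z = 0
  · obtain ⟨n, hn, rfl⟩ := (hzero z).1 hz
    have es : {m : ℕ | 1 ≤ m ∧ modelZero t m = modelZero t n} = {n} := by
      ext m
      simp only [Set.mem_ofPred_eq, Set.mem_singleton_iff]
      exact ⟨fun h => modelZero_injOn ht h.1 hn h.2, fun h => by rw [h]; exact ⟨hn, rfl⟩⟩
    rw [es, Set.encard_singleton,
      (hM.analyticAt _).analyticOrderAt_eq_one_of_zero_deriv_ne_zero hz (hderiv _ hz)]
  · rw [(hM.analyticAt z).analyticOrderAt_eq_zero.2 hz, Set.encard_eq_zero]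
    exact Set.eq_empty_of_forall_notMem fun n hn => hz ((hzero z).2 ⟨n, hn⟩)

/-- The squares of the integers; off them `sin √z π` does not vanish. -/
def squares : Set ℂ := Set.range fun n : ℕ => (n : ℂ) ^ 2

lemma sin_pi_mul_ne_zero {ρ : ℂ} (h : ρ ^ 2 ∉ squares) : Complex.sin (Real.pi * ρ) ≠ 0 := by
  have hpi : (Real.pi : ℂ) ≠ 0 := Complex.ofReal_ne_zero.2 Real.pi_ne_zero
  rw [Ne, Complex.sin_eq_zero_iff]
  rintro ⟨n, hn⟩
  rw [mul_comm] at hn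
  have e := mul_right_cancel₀ hpi hn
  refine h ⟨n.natAbs, ?_⟩
  have : ((n.natAbs : ℤ) : ℂ) ^ 2 = (n : ℂ) ^ 2 := by exact_mod_cast Int.natAbs_sq n
  simpa [e] using this

lemma tendsto_prod_sinK {z : ℂ} (hz : z ∉ squares) : Filter.Tendsto
    (fun N : ℕ => ∏ m ∈ Finset.range N, (1 - z / ((m : ℂ) + 1) ^ 2)) Filter.atTop
    (nhds (sinK z Real.pi / Real.pi)) := by
  have hz0 : z ≠ 0 := by rintro rfl; exact hz ⟨0, by simp⟩
  have hr := sqrtC_ne_zero hz0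
  have h := tendsto_euler_sin_prod' hr
  have e : sinK z Real.pi / Real.pi =
      Complex.sin (Real.pi * sqrtC z) / (Real.pi * sqrtC z) := by
    rw [← sqrtC_sq z, sinK_sq (by simpa [sqrtC_sq] using hr), sqrtC_sq, div_div, mul_comm (sqrtC z)]
  rw [e]
  refine h.congr fun N => Finset.prod_congr rfl fun m _ => ?_
  rw [sineTerm, sqrtC_sq]; ring

lemma prod_range_two_mul {R : Type*} [CommMonoid R] (f : ℕ → R) (N : ℕ) :
    ∏ i ∈ Finset.range (2 * N), f i =
      (∏ j ∈ Finset.range N, f (2 * j)) * ∏ j ∈ Finset.range N, f (2 * j + 1) := by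
  induction N with
  | zero => simp
  | succ N ih =>
    rw [mul_add, mul_one, Finset.prod_range_succ, Finset.prod_range_succ, ih,
      Finset.prod_range_succ, Finset.prod_range_succ]
    ac_rfl

/-- From cos x = sin 2x / (2 sin x): of the first 2N factors for the doubled argument, the
even-indexed belong to half-integers and the odd-indexed form the product for sin x. -/
lemma tendsto_prod_cosK {z : ℂ} (hz : z ∉ squares) : Filter.Tendsto
    (fun N : ℕ => ∏ m ∈ Finset.range N, (1 - z / ((m : ℂ) + 1 / 2) ^ 2)) Filter.atTop
    (nhds (cosK z Real.pi)) := by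
  have hz0 : z ≠ 0 := by rintro rfl; exact hz ⟨0, by simp⟩
  have hr := sqrtC_ne_zero hz0
  have hpi : (Real.pi : ℂ) ≠ 0 := Complex.ofReal_ne_zero.2 Real.pi_ne_zero
  have h1 := tendsto_prod_sinK hz
  have h2 := (tendsto_euler_sin_prod' (mul_ne_zero two_ne_zero hr)).comp
    (Filter.tendsto_id.const_mul_atTop' (two_pos : 0 < 2))
  have hne : sinK z Real.pi / Real.pi ≠ 0 := by
    refine div_ne_zero ?_ hpi
    rw [← sqrtC_sq z] at hz
    have := sin_pi_mul_ne_zero hz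
    rw [sinK, if_neg hz0, mul_comm]
    exact div_ne_zero this hr
  have h3 := h2.div h1 hne
  have e : Complex.sin (Real.pi * (2 * sqrtC z)) / (Real.pi * (2 * sqrtC z)) /
      (sinK z Real.pi / Real.pi) = cosK z Real.pi := by
    rw [div_eq_iff hne, sinK, if_neg hz0, cosK,
      show Real.pi * (2 * sqrtC z) = 2 * (sqrtC z * Real.pi) by ring, Complex.sin_two_mul]
    field_simp
  rw [e] at h3
  refine h3.congr' ?_
  filter_upwards [h1.eventually_ne hne] with N hN
  rw [Pi.div_apply, div_eq_iff hN, Function.comp_apply]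
  simp only [id]
  rw [prod_range_two_mul]
  congr 1 <;> refine Finset.prod_congr rfl fun m _ => ?_
  · have : (2 * m + 1 : ℂ) ≠ 0 := by exact_mod_cast Nat.succ_ne_zero (2 * m)
    rw [sineTerm, mul_pow, sqrtC_sq, show (m : ℂ) + 1 / 2 = (2 * m + 1) / 2 by ring]
    push_cast
    field_simp; ring
  · have : (m + 1 : ℂ) ≠ 0 := by exact_mod_cast Nat.succ_ne_zero m
    rw [sineTerm, mul_pow, sqrtC_sq]
    push_cast
    rw [show (2 * (m : ℂ) + 1 + 1) = 2 * (m + 1) by ring]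
    field_simp; ring

lemma Lists.exists_of_eq_zero {lam : ℕ → ℂ} {D : ℂ → ℂ} (h : Lists lam D)
    (hD : Differentiable ℂ D) {z : ℂ} (hz : D z = 0) : ∃ n, 1 ≤ n ∧ lam n = z := by
  by_contra! hcon
  have h1 := h z
  have h2 : {n : ℕ | 1 ≤ n ∧ lam n = z} = ∅ :=
    Set.eq_empty_of_forall_notMem fun n hn => hcon n hn.1 hn.2
  rw [h2, Set.encard_empty] at h1
  exact (hD.analyticAt z).analyticOrderAt_eq_zero.1 h1.symm hz

lemma le_norm_modelZero {t d : ℕ} (htd : t ≤ 1 + 2 * d) (m : ℕ) :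
    ((m : ℝ) + 1) ^ 2 / 4 ≤ ‖modelZero t (m + (1 + d))‖ := by
  rw [norm_modelZero]
  have h : (t : ℝ) ≤ 1 + 2 * d := by exact_mod_cast htd
  have hm : (0 : ℝ) ≤ m := m.cast_nonneg
  have hd : (0 : ℝ) ≤ d := d.cast_nonneg
  rw [show ((m : ℝ) + 1) ^ 2 / 4 = ((m + 1) / 2) ^ 2 by ring]
  push_cast
  gcongr
  linarith

lemma summable_inv_norm_modelZero {t d : ℕ} (htd : t ≤ 1 + 2 * d) :
    Summable fun m : ℕ => ‖modelZero t (m + (1 + d))‖⁻¹ := by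
  have h1 : Summable fun m : ℕ => (((m : ℝ) + 1) ^ 2 / 4)⁻¹ := by
    have := ((summable_nat_add_iff 1).2 (Real.summable_nat_pow_inv.2 one_lt_two)).mul_left 4
    refine this.congr fun m => ?_
    push_cast
    rw [inv_div, div_eq_mul_inv]
  refine h1.of_nonneg_of_le (fun m => by positivity) fun m => ?_
  exact inv_anti₀ (by positivity) (le_norm_modelZero htd m)

lemma prod_range_shift {R : Type*} [CommMonoid R] (f : ℕ → R) {d : ℕ} (hd : d ≤ 1) (N : ℕ) :
    ∏ m ∈ Finset.range (N + d), f (m + 1) =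
      f 1 ^ d * ∏ m ∈ Finset.range N, f (m + (1 + d)) := by
  interval_cases d
  · simp
  · rw [Finset.prod_range_succ', mul_comm, pow_one]

namespace IsSinePerturbation
variable {t : ℕ} {D M μ J : ℂ → ℂ} {B : ℝ} (h : IsSinePerturbation t D M μ J B)
include h

/-- The factors are 1 + O(n⁻²) locally uniformly in z, so the product converges unconditionally and
is continuous in z. The shift d splits off the first factor, whose model zero is 0 when t = 2 and
cannot be a denominator. -/
lemma hasProd {lam : ℕ → ℂ} (hlam : Lists lam D) (hM : Lists (modelZero t) M)
    (hnum : ∃ N : ℕ, ∀ n ≥ N, ‖lam n‖ ≤ ‖lam (n + 1)‖) {d : ℕ} (hd : d ≤ 1)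
    (htd : t ≤ 1 + 2 * d) {κ : ℂ} {E : ℂ → ℂ} (hME : ∀ z, M z = κ * (modelZero t 1 - z) ^ d * E z)
    (hE : ∀ z ∉ squares, Filter.Tendsto (fun N => ∏ m ∈ Finset.range N,
      (modelZero t (m + (1 + d)) - z) / modelZero t (m + (1 + d))) Filter.atTop (nhds (E z)))
    (z : ℂ) : ∃ P, HasProd (fun m : ℕ => (lam (m + (1 + d)) - z) / modelZero t (m + (1 + d))) P ∧
      D z = κ * (lam 1 - z) ^ d * P := by
  obtain ⟨C, hC0, hC⟩ := h.exists_norm_sub_le hlam hM hnum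
  have hs : ∀ m, modelZero t (m + (1 + d)) ≠ 0 := fun m =>
    norm_pos_iff.1 (lt_of_lt_of_le (by positivity) (le_norm_modelZero htd m))
  set f : ℂ → ℕ → ℂ := fun z m => (lam (m + (1 + d)) - z) / modelZero t (m + (1 + d)) - 1 with hf
  have hf1 : ∀ z m, ‖f z m‖ ≤ (C + ‖z‖) * ‖modelZero t (m + (1 + d))‖⁻¹ := by
    intro z m
    have e : f z m = ((lam (m + (1 + d)) - modelZero t (m + (1 + d))) - z) *
        (modelZero t (m + (1 + d)))⁻¹ := by
      have := hs m
      rw [hf]; field_simp; ring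
    rw [e, norm_mul, norm_inv]
    gcongr
    exact (norm_sub_le _ _).trans (add_le_add_left (hC _ (by omega)) _)
  have hsum := fun c : ℝ => (summable_inv_norm_modelZero htd).mul_left c
  have hmult : ∀ z, Multipliable fun m => 1 + f z m := fun z =>
    multipliable_one_add_of_summable
      ((hsum _).of_nonneg_of_le (fun m => norm_nonneg _) (hf1 z))
  have ef : ∀ z m, 1 + f z m = (lam (m + (1 + d)) - z) / modelZero t (m + (1 + d)) := fun z m => by
    rw [hf]; ring
  have hcont : Continuous fun z => ∏' m, (1 + f z m) := by
    refine continuous_iff_continuousAt.2 fun z₀ => ?_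
    refine tendsto_tprod_one_add_of_dominated_convergence (hsum (C + (‖z₀‖ + 1))) (fun m => ?_) ?_
    · have : Continuous fun z => f z m := by rw [hf]; fun_prop
      exact this.continuousAt
    · have : ∀ᶠ z in nhds z₀, ‖z‖ < ‖z₀‖ + 1 :=
        continuous_norm.continuousAt.eventually_lt continuousAt_const (by simp)
      filter_upwards [this] with z hz m
      refine (hf1 z m).trans ?_
      gcongr
  refine ⟨∏' m, (1 + f z m), ?_, ?_⟩
  · simpa only [ef] using (hmult z).hasProd
  -- The identity is proved off a countable set, where M and the Euler products may be divided by,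
  -- and extends by continuity.
  · have hcount : (squares ∪ Set.range (modelZero t)).Countable :=
      (Set.countable_range _).union (Set.countable_range _)
    have hdense := hcount.dense_compl ℝ
    have hcl := h.diff_left.continuous
    have hcr : Continuous fun z => κ * (lam 1 - z) ^ d * ∏' m, (1 + f z m) := by fun_prop
    refine congrFun (hcl.ext_on hdense hcr fun w hw => ?_) z
    simp only [Set.mem_compl_iff, Set.mem_union, not_or] at hw
    have hMw : M w ≠ 0 := fun h0 => by
      obtain ⟨n, -, hn⟩ := hM.exists_of_eq_zero h.diff_right h0
      exact hw.2 ⟨n, hn⟩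
    have l1 := (h.tendsto_prod_ratio hlam hM hnum hMw).comp (Filter.tendsto_add_atTop_nat d)
    have l2 := (hmult w).hasProd.tendsto_prod_nat
    have l3 := hE w hw.1
    have hMw' := hMw
    rw [hME] at hMw'
    have hEw := right_ne_zero_of_mul hMw'
    have h1w := right_ne_zero_of_mul (left_ne_zero_of_mul hMw')
    have hκ := left_ne_zero_of_mul (left_ne_zero_of_mul hMw')
    have l4 := (l2.div l3 hEw).const_mul (((lam 1 - w) / (modelZero t 1 - w)) ^ d)
    have heq := tendsto_nhds_unique l1 (l4.congr fun N => by
      rw [Function.comp_apply,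
        prod_range_shift (fun i => (lam i - w) / (modelZero t i - w)) hd, Pi.div_apply,
        ← Finset.prod_div_distrib]
      congr 1
      refine Finset.prod_congr rfl fun m _ => ?_
      rw [ef, div_div_div_cancel_right₀ (hs m)])
    rw [div_eq_iff hMw, hME] at heq
    rw [heq, div_pow]
    field_simp

end IsSinePerturbation


/-! ### Δ as the product over its zeros -/

lemma norm_integral_transform_le {W φ : ℝ → ℂ} {ρ : ℂ}
    (hW : IntervalIntegrable W volume 0 Real.pi)
    (hφ : ∀ t : ℝ, ‖φ t‖ ≤ Real.exp |(ρ * t).im|) :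
    ‖∫ t in (0 : ℝ)..Real.pi, W t * φ t‖ ≤
      ((∫ t in (0 : ℝ)..Real.pi, ‖W t‖) + 1) * Real.exp (Real.pi * |ρ.im|) := by
  have h1 : ‖∫ t in (0 : ℝ)..Real.pi, W t * φ t‖ ≤
      ∫ t in (0 : ℝ)..Real.pi, ‖W t‖ * Real.exp (Real.pi * |ρ.im|) := by
    refine intervalIntegral.norm_integral_le_of_norm_le Real.pi_pos.le
      (Filter.Eventually.of_forall fun t ht => ?_) (hW.norm.mul_const _)
    rw [norm_mul]
    refine mul_le_mul_of_nonneg_left ((hφ t).trans (Real.exp_le_exp.2 ?_)) (norm_nonneg _)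
    rw [Complex.im_mul_ofReal, abs_mul, abs_of_pos ht.1, mul_comm]
    exact mul_le_mul_of_nonneg_right ht.2 (abs_nonneg _)
  rw [intervalIntegral.integral_mul_const] at h1
  refine h1.trans ?_
  gcongr
  linarith

lemma integral_norm_add_one_pos (W : ℝ → ℂ) :
    0 < (∫ t in (0 : ℝ)..Real.pi, ‖W t‖) + 1 := by
  have := intervalIntegral.integral_nonneg_of_forall (f := fun t => ‖W t‖) (μ := volume)
    Real.pi_pos.le fun t => norm_nonneg _
  linarith

lemma IsSinePerturbation.isProductOf {α β : ℕ} {D M μ J : ℂ → ℂ} {B : ℝ}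
    (h : IsSinePerturbation (α + β) D M μ J B) {lam : ℕ → ℂ} (hlam : Lists lam D)
    (hM : Lists (modelZero (α + β)) M)
    (hnum : ∃ N : ℕ, ∀ n ≥ N, ‖lam n‖ ≤ ‖lam (n + 1)‖) (hd : α * β ≤ 1)
    (htd : α + β ≤ 1 + 2 * (α * β)) {E : ℂ → ℂ}
    (hME : ∀ z, M z = (-1) ^ α * (if α = β then (Real.pi : ℂ) else 1) *
      (modelZero (α + β) 1 - z) ^ (α * β) * E z)
    (hE : ∀ z ∉ squares, Filter.Tendsto (fun N => ∏ m ∈ Finset.range N,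
      (modelZero (α + β) (m + (1 + α * β)) - z) / modelZero (α + β) (m + (1 + α * β)))
      Filter.atTop (nhds (E z))) : IsProductOf α β lam D := by
  intro z
  obtain ⟨P, hP, e⟩ := h.hasProd hlam hM hnum hd htd hME hE z
  refine ⟨P, ?_, e⟩
  convert hP using 4
  simp only [modelZero]; push_cast; rfl

lemma differentiable_sinK_left (x : ℝ) : Differentiable ℂ fun z => sinK z x :=
  differentiable_of_comp_sq (differentiable_sinK_sq x)

lemma differentiable_cosK_left (x : ℝ) : Differentiable ℂ fun z => cosK z x :=
  differentiable_of_comp_sq (differentiable_cosK_sq x)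

/-- A represented entire function is the product over its zeros. -/
lemma Represents.isProductOf {α β : ℕ} (hab : DegenerateOrders α β) {W : L2 Real.pi}
    {Δ : ℂ → ℂ} (hW : Represents α β W Δ) (hΔ : Differentiable ℂ Δ) {lam : ℕ → ℂ}
    (hlam : Lists lam Δ) (hnum : ∃ N : ℕ, ∀ n ≥ N, ‖lam n‖ ≤ ‖lam (n + 1)‖) :
    IsProductOf α β lam Δ := by
  have hpi : (Real.pi : ℂ) ≠ 0 := Complex.ofReal_ne_zero.2 Real.pi_ne_zero
  have hWi := intervalIntegrable_coe Real.pi_pos.le W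
  have hs0 := sinK_zero_left Real.pi
  have hdiv : ∀ (φ : ℂ → ℝ → ℂ) (c ρ : ℂ), (∫ t in (0 : ℝ)..Real.pi, W t * (φ ρ t / c)) =
      (∫ t in (0 : ℝ)..Real.pi, W t * φ ρ t) / c := fun φ c ρ => by
    simp only [← mul_div_assoc]
    rw [intervalIntegral.integral_div]
  rcases hab with ⟨rfl, rfl⟩ | ⟨rfl, rfl⟩ | ⟨rfl, rfl⟩
  -- The shift t/2 = (α + β)/2 turns the sine into sin, cos or -sin of πρ; the factor μ is 1/ρ, -1
  -- or -ρ in the three cases.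
  · have key : IsSinePerturbation (0 + 0) Δ (fun z => sinK z Real.pi) (fun ρ => 1 / ρ)
        (fun ρ => ∫ t in (0 : ℝ)..Real.pi, W t * Complex.cos (ρ * t))
        ((∫ t in (0 : ℝ)..Real.pi, ‖W t‖) + 1) :=
      { le_two := by norm_num
        pos := integral_norm_add_one_pos W
        diff_left := hΔ
        diff_right := differentiable_sinK_left _
        factor_ne_zero := fun ρ hρ => one_div_ne_zero hρ
        left_eq := fun ρ hρ => by
          rw [hW.1 rfl ρ hρ, hdiv fun ρ t => Complex.cos (ρ * t),
            show (Real.pi : ℂ) * (ρ + ((0 + 0 : ℕ) : ℂ) / 2) = ρ * Real.pi by push_cast; ring]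
          field_simp; ring
        right_eq := fun ρ hρ => by
          rw [sinK_sq hρ,
            show (Real.pi : ℂ) * (ρ + ((0 + 0 : ℕ) : ℂ) / 2) = ρ * Real.pi by push_cast; ring]
          ring
        norm_le := fun ρ => norm_integral_transform_le hWi fun t => norm_cos_le _ }
    refine key.isProductOf hlam (lists_modelZero key.le_two key.diff_right key.factor_ne_zero
      (fun ρ hρ => by fun_prop (disch := exact hρ)) key.right_eq (fun _ => by simp [hs0])
      (fun h => by omega)) hnum (by norm_num) (by norm_num)
      (E := fun z => sinK z Real.pi / Real.pi) (fun z => by simp; field_simp) fun z hz => ?_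
    refine (tendsto_prod_sinK hz).congr fun N => Finset.prod_congr rfl fun m _ => ?_
    have : (m + 1 : ℂ) ≠ 0 := by exact_mod_cast Nat.succ_ne_zero m
    simp only [modelZero]; push_cast; simp only [zero_div, sub_zero]
    field_simp
  · have key : IsSinePerturbation (1 + 0) Δ (fun z => -cosK z Real.pi) (fun ρ => -1)
        (fun ρ => -∫ t in (0 : ℝ)..Real.pi, W t * Complex.sin (ρ * t))
        ((∫ t in (0 : ℝ)..Real.pi, ‖W t‖) + 1) :=
      { le_two := by norm_num
        pos := integral_norm_add_one_pos W
        diff_left := hΔ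
        diff_right := (differentiable_cosK_left _).neg
        factor_ne_zero := fun ρ hρ => by norm_num
        left_eq := fun ρ hρ => by
          rw [hW.2.2 one_ne_zero ρ hρ, hdiv fun ρ t => Complex.sin (ρ * t),
            show (Real.pi : ℂ) * (ρ + ((1 + 0 : ℕ) : ℂ) / 2) = ρ * Real.pi + Real.pi / 2 by
              push_cast; ring, Complex.sin_add_pi_div_two]
          ring
        right_eq := fun ρ hρ => by
          rw [cosK_sq, show (Real.pi : ℂ) * (ρ + ((1 + 0 : ℕ) : ℂ) / 2) =
            ρ * Real.pi + Real.pi / 2 by push_cast; ring, Complex.sin_add_pi_div_two]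
          ring
        norm_le := fun ρ => by
          rw [norm_neg]; exact norm_integral_transform_le hWi fun t => norm_sin_le _ }
    refine key.isProductOf hlam (lists_modelZero key.le_two key.diff_right key.factor_ne_zero
      (fun ρ hρ => by fun_prop) key.right_eq (fun _ => by simp [cosK_zero_left])
      (fun h => by omega)) hnum (by norm_num) (by norm_num)
      (E := fun z => cosK z Real.pi) (fun z => by simp) fun z hz => ?_
    refine (tendsto_prod_cosK hz).congr fun N => Finset.prod_congr rfl fun m _ => ?_
    have : (2 * m + 1 : ℂ) ≠ 0 := by exact_mod_cast Nat.succ_ne_zero (2 * m)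
    simp only [modelZero]; push_cast
    rw [show (m : ℂ) + 1 - 1 / 2 = (2 * m + 1) / 2 by ring,
      show (m : ℂ) + 1 / 2 = (2 * m + 1) / 2 by ring]
    field_simp
  · have key : IsSinePerturbation (1 + 1) Δ (fun z => z * sinK z Real.pi) (fun ρ => -ρ)
        (fun ρ => -∫ t in (0 : ℝ)..Real.pi, W t * Complex.cos (ρ * t))
        ((∫ t in (0 : ℝ)..Real.pi, ‖W t‖) + 1) :=
      { le_two := by norm_num
        pos := integral_norm_add_one_pos W
        diff_left := hΔ
        diff_right := differentiable_id.mul (differentiable_sinK_left _)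
        factor_ne_zero := fun ρ hρ => neg_ne_zero.2 hρ
        left_eq := fun ρ hρ => by
          rw [hW.1 rfl ρ hρ, hdiv fun ρ t => Complex.cos (ρ * t),
            show (Real.pi : ℂ) * (ρ + ((1 + 1 : ℕ) : ℂ) / 2) = ρ * Real.pi + Real.pi by
              push_cast; ring, Complex.sin_add_pi]
          field_simp; ring
        right_eq := fun ρ hρ => by
          rw [sinK_sq hρ, show (Real.pi : ℂ) * (ρ + ((1 + 1 : ℕ) : ℂ) / 2) =
            ρ * Real.pi + Real.pi by push_cast; ring, Complex.sin_add_pi]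
          field_simp
        norm_le := fun ρ => by
          rw [norm_neg]; exact norm_integral_transform_le hWi fun t => norm_cos_le _ }
    have hder : deriv (fun z => z * sinK z Real.pi) 0 = Real.pi := by
      have := ((hasDerivAt_id' (0 : ℂ)).mul (differentiable_sinK_left Real.pi 0).hasDerivAt).deriv
      rw [zero_mul, add_zero, one_mul, hs0] at this
      exact this
    refine key.isProductOf hlam (lists_modelZero key.le_two key.diff_right key.factor_ne_zero
      (fun ρ hρ => by fun_prop) key.right_eq (fun h => by omega)
      (fun _ => ⟨zero_mul _, by rwa [hder]⟩)) hnum (by norm_num) (by norm_num)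
      (E := fun z => sinK z Real.pi / Real.pi) (fun z => by
        simp [modelZero]; field_simp) fun z hz => ?_
    refine (tendsto_prod_sinK hz).congr fun N => Finset.prod_congr rfl fun m _ => ?_
    have : (m + 1 : ℂ) ≠ 0 := by exact_mod_cast Nat.succ_ne_zero m
    simp only [modelZero]; push_cast
    rw [show (m : ℂ) + 2 - 2 / 2 = m + 1 by ring]
    field_simp

lemma IsProductOf.unique {α β : ℕ} {lam : ℕ → ℂ} {Δ₁ Δ₂ : ℂ → ℂ} (h₁ : IsProductOf α β lam Δ₁)
    (h₂ : IsProductOf α β lam Δ₂) : Δ₁ = Δ₂ := by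
  ext z
  obtain ⟨P₁, hP₁, e₁⟩ := h₁ z
  obtain ⟨P₂, hP₂, e₂⟩ := h₂ z
  rw [e₁, e₂, hP₁.unique hP₂]

lemma Represents.eqOn {α β : ℕ} {W : L2 Real.pi} {Δ₁ Δ₂ : ℂ → ℂ} (h₁ : Represents α β W Δ₁)
    (h₂ : Represents α β W Δ₂) (hc₁ : Continuous Δ₁) (hc₂ : Continuous Δ₂) : Δ₁ = Δ₂ := by
  refine hc₁.ext_on (dense_compl_singleton 0) hc₂ fun z hz => ?_
  have hr := sqrtC_ne_zero hz
  rw [← sqrtC_sq z]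
  by_cases h : α = β
  · rw [h₁.1 h _ hr, h₂.1 h _ hr]
  · rw [h₁.2.2 h _ hr, h₂.2.2 h _ hr]


/-! ### Output of the algorithm and isospectral potentials -/

lemma memLp_reflect {c : ℝ} (p : L2 c) :
    MemLp (fun x => p (c - x)) 2 (volume.restrict (Set.Ioo 0 c)) := by
  refine (Lp.memLp p).comp_measurePreserving ?_
  have h := (Measure.measurePreserving_sub_left volume c).restrict_preimage
    (s := Set.Ioo 0 c) measurableSet_Ioo
  simpa using h

/-- The characteristic functions of the problems with a given spectrum coincide. -/
lemma isProductOf_charFn {k α β : ℕ} (hk : 1 < k) (h : DegenerateOrders α β) (q : L2 Real.pi)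
    {lam : ℕ → ℂ} (hspec : IsSpectrum k α β q lam)
    (hnum : ∃ N : ℕ, ∀ n ≥ N, ‖lam n‖ ≤ ‖lam (n + 1)‖) :
    IsProductOf α β lam (charFn k α β q) :=
  (represents_charFn hk h q).isProductOf h
    (differentiable_charFn hk α β (intervalIntegrable_coe Real.pi_pos.le q))
    ((isSpectrum_iff hk α β q lam).1 hspec) hnum

lemma isConstructed_constOp_mainWLp {k α β : ℕ} (hk : 1 < k) (p : L2 (pt k)) {q : L2 Real.pi}
    (hp : ∀ᵐ x, x ∈ Set.Ioo 0 (pt k) → q (pt k - x) = p x) :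
    IsConstructed k α (constOp k p) (mainWLp k α β q) q :=
  (isConstructed_constOp_iff hk α p _ q).2
    ⟨hp, mainWLp_right hk α β q, fun j h1 h2 => mainWLp_middle hk α β q j h1 h2⟩

lemma IsConstructed.isHomogeneous {k α β : ℕ} (hk : 1 < k) {p : L2 (pt k)} {q q₀ : L2 Real.pi}
    (h : IsConstructed k α (constOp k p) (mainWLp k α β q₀) q) :
    IsHomogeneous k α (fun x => q x - q₀ x) := by
  obtain ⟨-, h1, h2⟩ := (isConstructed_constOp_iff hk α p _ q).1 h
  exact isHomogeneous_of_mainW h1 h2 (mainWLp_right hk α β q₀)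
    fun j hj hj' => mainWLp_middle hk α β q₀ j hj hj'

lemma IsHomogeneous.congr {k α : ℕ} (hk : 1 < k) {r r' : ℝ → ℂ} (h : IsHomogeneous k α r)
    (hr : ∀ᵐ x, x ∈ Set.Ioo 0 Real.pi → r' x = r x) : IsHomogeneous k α r' := by
  have h2 := two_pt_le hk
  have ha := pt_pos hk
  constructor
  · filter_upwards [h.1, ae_const_add hr (pt k), ae_const_sub hr (pt k)]
      with x h1 hadd hsub hx
    rw [hadd ⟨by linarith [hx.1], by linarith [hx.2]⟩,
      hsub ⟨by linarith [hx.2], by linarith [hx.1]⟩, h1 hx]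
  · intro j hj hj'
    filter_upwards [h.2 j hj hj', hr, ae_const_add hr (-(2 * pt k))] with x h1 h3 h4 hx
    have hl : 2 * pt k < x := lt_of_le_of_lt (by gcongr; exact_mod_cast hj) hx.1
    have hu : x < Real.pi := hx.2.trans_le (by
      rw [← natCast_mul_pt hk]; gcongr; exact_mod_cast (by omega : j + 1 ≤ k))
    rw [neg_add_eq_sub] at h4
    rw [h3 ⟨by linarith, hu⟩, h4 ⟨by linarith, by linarith⟩, h1 hx]

/-- Add to q₀ the homogeneous function with values p(a - ·) - q₀ on (0, a); by degeneracy this does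
not change W. -/
lemma exists_isConstructed {k α β : ℕ} (hk : 1 < k)
    (hs : (-1 : ℂ) ^ α = (-1) ^ β * ((-1) ^ α) ^ (k - 2)) (p : L2 (pt k)) (q₀ : L2 Real.pi) :
    ∃ q, IsConstructed k α (constOp k p) (mainWLp k α β q₀) q := by
  have hsub : Set.Ioo 0 (pt k) ⊆ Set.Ioo 0 Real.pi := Set.Ioo_subset_Ioo_right (pt_mem hk).2
  obtain ⟨r, hr, hrh, hrp⟩ := exists_isHomogeneous hk α
    ((memLp_reflect p).sub ((Lp.memLp q₀).mono_measure (Measure.restrict_mono_set _ hsub)))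
  have hq := (Lp.memLp q₀).add (hr.restrict (Set.Ioo 0 Real.pi))
  have hcoe := (ae_restrict_iff' measurableSet_Ioo).1 hq.coeFn_toLp
  have hh : IsHomogeneous k α (fun x => hq.toLp _ x - q₀ x) := hrh.congr hk (by
    filter_upwards [hcoe] with x hx hm
    rw [hx hm, Pi.add_apply, add_sub_cancel_left])
  refine ⟨hq.toLp _, ?_⟩
  rw [← mainWLp_eq_of_isHomogeneous hk hs hh]
  refine isConstructed_constOp_mainWLp hk p ?_
  filter_upwards [ae_const_sub hcoe (pt k)] with x hx hm
  have hm' : pt k - x ∈ Set.Ioo 0 (pt k) := ⟨by linarith [hm.2], by linarith [hm.1]⟩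
  rw [hx (hsub hm'), Pi.add_apply, hrp _ hm', Pi.sub_apply, sub_sub_cancel, add_sub_cancel]

lemma IsConstructed.unique {k α β : ℕ} (hk : 1 < k) {p : L2 (pt k)} {q₀ q₁ q₂ : L2 Real.pi}
    (h₁ : IsConstructed k α (constOp k p) (mainWLp k α β q₀) q₁)
    (h₂ : IsConstructed k α (constOp k p) (mainWLp k α β q₀) q₂) : q₁ = q₂ := by
  obtain ⟨a0, a1, a2⟩ := (isConstructed_constOp_iff hk α p _ q₁).1 h₁
  obtain ⟨b0, b1, b2⟩ := (isConstructed_constOp_iff hk α p _ q₂).1 h₂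
  have h := (isHomogeneous_of_mainW a1 a2 b1 b2).ae_eq_zero hk (by
    filter_upwards [a0, b0] with x ha hb hx
    rw [ha hx, hb hx, sub_self])
  refine Lp.ext ?_
  rw [Filter.EventuallyEq, ae_restrict_iff' measurableSet_Ioo]
  filter_upwards [h] with x hx hm
  exact sub_eq_zero.1 (hx hm)

end FrozenArgument

open FrozenArgument

theorem theorem4p3 (k : ℕ) (hk : 1 < k) (α β : ℕ) (hα : α ≤ 1) (hβ : β ≤ 1)
    (hdeg : Degenerate k α β)
    (q₀ : L2 Real.pi) (lam : ℕ → ℂ) (hspec : IsSpectrum k α β q₀ lam)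
    -- numbering of the spectrum: the moduli are eventually nondecreasing
    (hnum : ∃ N : ℕ, ∀ n ≥ N, ‖lam n‖ ≤ ‖lam (n + 1)‖) :
    -- the algorithm can be carried out, with a unique result, for every `p`
    (∃! W : L2 Real.pi, IsObtainedW α β lam W) ∧
    (∀ p : L2 (pt k), Function.Bijective (fun f : L2 (pt k) => f + constOp k p f)) ∧
    (∀ p : L2 (pt k), ∃! q : L2 Real.pi, IsOutput k α β (constOp k p) lam q) ∧
    -- its result equals `p (a - x)` on `(0, a)`
    (∀ (p : L2 (pt k)) (q : L2 Real.pi), IsOutput k α β (constOp k p) lam q →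
      ∀ᵐ x ∂MeasureTheory.volume.restrict (Set.Ioo 0 (pt k)), q x = p (pt k - x)) ∧
    -- the results form the set of all iso-spectral potentials
    {q : L2 Real.pi | ∃ p : L2 (pt k), IsOutput k α β (constOp k p) lam q} =
      {q : L2 Real.pi | IsSpectrum k α β q lam} := by
  have hcases := degenerate_cases hk hα hβ hdeg
  have hab : DegenerateOrders α β := by
    rcases hcases with h | h | h
    · exact Or.inl h
    · exact Or.inr (Or.inl ⟨h.1, h.2.1⟩)
    · exact Or.inr (Or.inr ⟨h.1, h.2.1⟩)
  have hs := pow_sign_of_cases hk hcases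
  have hprod := isProductOf_charFn hk hab q₀ hspec hnum
  have hW : ∀ W, IsObtainedW α β lam W ↔ W = mainWLp k α β q₀ := by
    refine fun W => ⟨?_, ?_⟩
    · rintro ⟨Δ, h1, h2⟩
      rw [h1.unique hprod] at h2
      exact h2.unique (represents_charFn hk hab q₀)
    · rintro rfl
      exact ⟨_, hprod, represents_charFn hk hab q₀⟩
  have hout : ∀ p q, IsOutput k α β (constOp k p) lam q ↔
      IsConstructed k α (constOp k p) (mainWLp k α β q₀) q := fun p q => by
    simp only [IsOutput, hW, exists_eq_left]
  refine ⟨⟨_, (hW _).2 rfl, fun W h => (hW W).1 h⟩, fun p => ?_, fun p => ?_, fun p q h => ?_, ?_⟩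
  · exact (Equiv.addRight p).bijective
  · simp only [hout]
    obtain ⟨q, hq⟩ := exists_isConstructed hk hs p q₀
    exact ⟨q, hq, fun q' hq' => hq'.unique hk hq⟩
  · have h1 := ((isConstructed_constOp_iff hk α p _ q).1 ((hout p q).1 h)).1
    rw [ae_restrict_iff' measurableSet_Ioo]
    filter_upwards [ae_const_sub h1 (pt k)] with x hx hm
    rw [← hx ⟨by linarith [hm.2], by linarith [hm.1]⟩, sub_sub_cancel]
  · ext q
    simp only [Set.mem_ofPred_eq, hout]
    constructor
    · rintro ⟨p, hp⟩
      -- An output shares W with q₀, hence the characteristic function, hence the spectrum with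
      -- multiplicities.
      have hWq := mainWLp_eq_of_isHomogeneous hk hs (hp.isHomogeneous hk)
      have hc : ∀ q : L2 Real.pi, Continuous (charFn k α β q) := fun q =>
        (differentiable_charFn hk α β (intervalIntegrable_coe Real.pi_pos.le q)).continuous
      have h1 := represents_charFn hk hab q
      rw [hWq] at h1
      rw [isSpectrum_iff hk] at hspec ⊢
      rwa [h1.eqOn (represents_charFn hk hab q₀) (hc q) (hc q₀)]
    · intro hq
      have h1 := represents_charFn hk hab q
      -- Both characteristic functions are the same product over the spectrum, so q has the same W
      -- as q₀ and is the output for p = q(a - ·).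
      rw [(isProductOf_charFn hk hab q hq hnum).unique hprod] at h1
      rw [← h1.unique (represents_charFn hk hab q₀)]
      refine ⟨(memLp_comp_pt_sub q).toLp _, isConstructed_constOp_mainWLp hk _ ?_⟩
      filter_upwards [(ae_restrict_iff' measurableSet_Ioo).1 (memLp_comp_pt_sub q).coeFn_toLp]
        with x hx hm
      rw [hx hm, ext0_of_mem (by linarith [hm.2]) (by linarith [hm.1, (pt_mem hk).2])]
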